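/- Let $K$ be a field, let $G$ be a finite simple graph with vertex set $\{1,\dots,n\}$, let $S=K[x_1,\dots,x_n]$ with the standard grading and $\mathfrak m=(x_1,\dots,x_n)$, and let $$I=I(G)=(x_ix_j \mid \{i,j\}\in E(G))\subseteq S$$ be the edge ideal of $G$. For a homogeneous ideal $J\subseteq S$ let $$\operatorname{reg} J=\sup\{\,i+j \mid i\ge 0,\ j\in\mathbb Z,\ H^i_{\mathfrak m}(J)_j\neq 0\,\}$$ be its Castelnuovo–Mumford regularity as a graded $S$-module, where $H^i_{\mathfrak m}(J)_j$ is the degree $j$ component of the $i$-th local cohomology module of $J$ with respect to $\mathfrak m$ (and $\operatorname{reg} 0=-\infty$). For $s\ge 1$ let $$I^{(s)}=\bigcap_{P}\,(I^sS_P\cap S)$$ be the $s$-th symbolic power of $I$, where $P$ runs through the minimal prime ideals of $I$. Then $$\operatorname{reg} I^{(2)}=\operatorname{reg} I^2\qquad\text{and}\qquad \operatorname{reg} I^{(3)}=\operatorname{reg} I^3 .$$ -/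

import Mathlib

noncomputable section

/-! ### Edge ideals and symbolic powers -/

/-- The edge ideal of a graph `G`: the ideal of `K[x_v | v ∈ V]` generated by the products
`x_i x_j` with `{i, j}` an edge of `G`. -/
def edgeIdeal (K : Type*) [Field K] {V : Type*} (G : SimpleGraph V) :
    Ideal (MvPolynomial V K) :=
  Ideal.span {f | ∃ i j : V, G.Adj i j ∧ f = MvPolynomial.X i * MvPolynomial.X j}

/-- The contraction `I S_P ∩ S` of the extension of the ideal `I` to the localization of `S`
at the prime ideal `P`. -/
def localContraction {S : Type*} [CommRing S] (P I : Ideal S) [P.IsPrime] : Ideal S :=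
  (I.map (algebraMap S (Localization.AtPrime P))).comap (algebraMap S (Localization.AtPrime P))

/-- The `s`-th symbolic power of `I`: the intersection of the ideals `I ^ s S_P ∩ S`, where `P`
runs through the minimal primes of `I`. -/
def symbolicPower {S : Type*} [CommRing S] (I : Ideal S) (s : ℕ) : Ideal S :=
  ⨅ (P : Ideal S) (hP : P ∈ I.minimalPrimes),
    haveI : P.IsPrime := hP.1.1
    localContraction P (I ^ s)

/-! ### Graded local cohomology and regularity

Throughout, `S = K[x_k | k ∈ σ]` is a polynomial ring in finitely many variables with its
standard grading, and `J` is a homogeneous ideal of `S`. The local cohomology `H^i_𝔪(J)` with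
respect to the irrelevant ideal `𝔪 = (x_k | k ∈ σ)` is computed by the Čech complex
`0 → J → ⨁_k J_{x_k} → ⨁_{k < l} J_{x_k x_l} → ⋯`, which is a complex of graded modules.
All the localizations that occur live in the ring of Laurent polynomials. -/

/-- The ring of Laurent polynomials `K[x_k, x_k⁻¹ | k ∈ σ]`. -/
abbrev LaurentRing (σ K : Type*) [Field K] : Type _ := AddMonoidAlgebra K (σ →₀ ℤ)

/-- The inclusion of the polynomial ring in the ring of Laurent polynomials. -/
def toLaurent (σ K : Type*) [Field K] : MvPolynomial σ K →ₐ[K] LaurentRing σ K :=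
  MvPolynomial.aeval fun k => AddMonoidAlgebra.single (Finsupp.single k 1) 1

/-- The squarefree monomial `x_F`, the product of the variables `x_k` with `k ∈ F`. -/
def varProd (K : Type*) [Field K] {σ : Type*} (F : Finset σ) : MvPolynomial σ K :=
  ∏ k ∈ F, MvPolynomial.X k

section Cech

variable {K σ : Type*} [Field K]

/-- The localization `J_{x_F}` of the ideal `J` at the powers of `x_F`, as a `K`-subspace of the
ring of Laurent polynomials: the set of all fractions `g / x_F ^ N` with `g ∈ J`. -/
def localizedIdeal (J : Ideal (MvPolynomial σ K)) (F : Finset σ) :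
    Submodule K (LaurentRing σ K) where
  carrier := {f | ∃ N : ℕ, ∃ g ∈ J, toLaurent σ K (varProd K F) ^ N * f = toLaurent σ K g}
  zero_mem' := ⟨0, 0, J.zero_mem, by simp⟩
  add_mem' := by
    rintro a b ⟨N, g, hg, ha⟩ ⟨M, h, hh, hb⟩
    refine ⟨N + M, varProd K F ^ M * g + varProd K F ^ N * h,
      J.add_mem (J.mul_mem_left _ hg) (J.mul_mem_left _ hh), ?_⟩
    simp only [map_add, map_mul, map_pow, ← ha, ← hb]
    ring
  smul_mem' := by
    rintro c a ⟨N, g, hg, ha⟩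
    refine ⟨N, c • g, Submodule.smul_of_tower_mem J c hg, ?_⟩
    rw [mul_smul_comm, ha, map_smul]

lemma localizedIdeal_mono (J : Ideal (MvPolynomial σ K)) {E F : Finset σ} (h : E ⊆ F) :
    localizedIdeal J E ≤ localizedIdeal J F := by
  classical
  rintro f ⟨N, g, hg, hf⟩
  refine ⟨N, varProd K (F \ E) ^ N * g, J.mul_mem_left _ hg, ?_⟩
  have : varProd K F = varProd K (F \ E) * varProd K E := (Finset.prod_sdiff h).symm
  rw [this, map_mul, map_mul, map_pow, ← hf]
  ring

/-- The Laurent polynomials that are homogeneous of degree `j`. -/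
def laurentDegree (K : Type*) [Field K] {σ : Type*} [Fintype σ] (j : ℤ) :
    Submodule K (LaurentRing σ K) :=
  AddMonoidAlgebra.gradeBy K (fun a : σ →₀ ℤ => ∑ k, a k) j

variable [Fintype σ] [LinearOrder σ]

/-- The Čech differential, `(d c)_F = ∑_{k ∈ F} ± c_{F ∖ k}`, where the sign is `(-1) ^ p` if `k`
is the element at position `p` (counting from `0`) of the ordered set `F`. -/
def cechD (K σ : Type*) [Field K] [Fintype σ] [LinearOrder σ] :
    (Finset σ → LaurentRing σ K) →ₗ[K] (Finset σ → LaurentRing σ K) where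
  toFun c F := ∑ k ∈ F, (-1 : ℤ) ^ (F.filter (· < k)).card • c (F.erase k)
  map_add' a b := by
    funext F
    simp [smul_add, Finset.sum_add_distrib]
  map_smul' r a := by
    funext F
    simp only [Pi.smul_apply, RingHom.id_apply, Finset.smul_sum]
    exact Finset.sum_congr rfl fun k _ => smul_comm _ _ _

/-- The component of degree `j` of the module `⨁_{|F| = i} J_{x_F}` of Čech cochains in
cohomological degree `i`. -/
def cechCochains (J : Ideal (MvPolynomial σ K)) (i : ℕ) (j : ℤ) :
    Submodule K (Finset σ → LaurentRing σ K) where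
  carrier := {c | (∀ F, F.card = i → c F ∈ localizedIdeal J F ⊓ laurentDegree K j) ∧
    ∀ F, F.card ≠ i → c F = 0}
  zero_mem' := ⟨fun _ _ => Submodule.zero_mem _, fun _ _ => rfl⟩
  add_mem' := by
    rintro a b ⟨ha, ha'⟩ ⟨hb, hb'⟩
    exact ⟨fun F hF => Submodule.add_mem _ (ha F hF) (hb F hF),
      fun F hF => by simp [ha' F hF, hb' F hF]⟩
  smul_mem' := by
    rintro r a ⟨ha, ha'⟩
    exact ⟨fun F hF => Submodule.smul_mem _ r (ha F hF), fun F hF => by simp [ha' F hF]⟩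

/-- The Čech cocycles of cohomological degree `i` and internal degree `j`. -/
def cechCocycles (J : Ideal (MvPolynomial σ K)) (i : ℕ) (j : ℤ) :
    Submodule K (Finset σ → LaurentRing σ K) :=
  cechCochains J i j ⊓ LinearMap.ker (cechD K σ)

/-- The Čech coboundaries of cohomological degree `i` and internal degree `j`. -/
def cechCoboundaries (J : Ideal (MvPolynomial σ K)) (i : ℕ) (j : ℤ) :
    Submodule K (Finset σ → LaurentRing σ K) :=
  match i with
  | 0 => ⊥
  | i + 1 => (cechCochains J i j).map (cechD K σ)

lemma cechD_mem (J : Ideal (MvPolynomial σ K)) (i : ℕ) (j : ℤ)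
    {c : Finset σ → LaurentRing σ K} (hc : c ∈ cechCochains J i j) :
    cechD K σ c ∈ cechCochains J (i + 1) j := by
  refine ⟨fun F hF => ?_, fun F hF => ?_⟩
  · refine Submodule.sum_mem _ fun k hk => ?_
    refine zsmul_mem ?_ _
    have h := hc.1 (F.erase k) (by rw [Finset.card_erase_of_mem hk, hF]; rfl)
    exact ⟨localizedIdeal_mono J (Finset.erase_subset k F) h.1, h.2⟩
  · refine Finset.sum_eq_zero fun k hk => ?_
    rw [hc.2, smul_zero]
    have := Finset.card_erase_add_one hk
    omega

lemma cechD_cechD (c : Finset σ → LaurentRing σ K) : cechD K σ (cechD K σ c) = 0 := by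
  have key : ∀ (F : Finset σ) (k l : σ), k ∈ F → l ∈ F → l < k →
      (-1 : ℤ) ^ (F.filter (· < k)).card * (-1) ^ ((F.erase k).filter (· < l)).card +
        (-1) ^ (F.filter (· < l)).card * (-1) ^ ((F.erase l).filter (· < k)).card = 0 := by
    intro F k l _ hl hlk
    have h1 : (F.erase k).filter (· < l) = F.filter (· < l) := by
      ext x
      simp only [Finset.mem_filter, Finset.mem_erase]
      exact ⟨fun h => ⟨h.1.2, h.2⟩, fun h => ⟨⟨(h.2.trans hlk).ne, h.1⟩, h.2⟩⟩
    have h2 : (F.erase l).filter (· < k) = (F.filter (· < k)).erase l := by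
      ext x
      simp only [Finset.mem_filter, Finset.mem_erase]
      tauto
    have h3 := Finset.card_erase_add_one
      (Finset.mem_filter.2 ⟨hl, hlk⟩ : l ∈ F.filter (· < k))
    rw [h1, h2, ← h3]
    ring
  funext F
  simp only [cechD, LinearMap.coe_mk, AddHom.coe_mk, Pi.zero_apply, Finset.smul_sum, smul_smul]
  rw [Finset.sum_sigma']
  refine Finset.sum_involution (fun p _ => ⟨p.2, p.1⟩) ?_ ?_ ?_ ?_
  · rintro ⟨k, l⟩ h
    simp only [Finset.mem_sigma, Finset.mem_erase] at h
    obtain ⟨hk, hlk, hl⟩ := h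
    dsimp only
    rw [Finset.erase_right_comm (a := l) (b := k), ← add_smul]
    rcases lt_or_gt_of_ne hlk with h | h
    · rw [key F k l hk hl h, zero_smul]
    · rw [add_comm, key F l k hl hk h, zero_smul]
  · rintro ⟨k, l⟩ h _ he
    simp only [Finset.mem_sigma, Finset.mem_erase] at h
    exact h.2.1 (congrArg Sigma.fst he)
  · rintro ⟨k, l⟩ h
    simp only [Finset.mem_sigma, Finset.mem_erase] at h ⊢
    exact ⟨h.2.2, h.2.1.symm, h.1⟩
  · rintro ⟨k, l⟩ _
    rfl

lemma cechCoboundaries_le_cechCocycles (J : Ideal (MvPolynomial σ K)) (i : ℕ) (j : ℤ) :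
    cechCoboundaries J i j ≤ cechCocycles J i j := by
  cases i with
  | zero => exact bot_le
  | succ i =>
    rintro _ ⟨c, hc, rfl⟩
    exact ⟨cechD_mem J i j hc, cechD_cechD c⟩

/-- The component `H^i_𝔪(J)_j` of degree `j` of the `i`-th local cohomology module of the
homogeneous ideal `J` with respect to `𝔪 = (x_k | k ∈ σ)`: cocycles modulo coboundaries. -/
abbrev LocalCohomologyDegree (J : Ideal (MvPolynomial σ K)) (i : ℕ) (j : ℤ) : Type _ :=
  cechCocycles J i j ⧸ (cechCoboundaries J i j).comap (cechCocycles J i j).subtype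

/-- The Castelnuovo–Mumford regularity of a homogeneous ideal `J`, regarded as a graded module:
the supremum of all `i + j` with `H^i_𝔪(J)_j ≠ 0`, that is, of the numbers `a_i(J) + i`. It is `⊥`,
that is `-∞`, if there is no such pair `(i, j)`. -/
def regularity (J : Ideal (MvPolynomial σ K)) : WithBot (WithTop ℤ) :=
  sSup {r | ∃ (i : ℕ) (j : ℤ), Nontrivial (LocalCohomologyDegree J i j) ∧
    r = (((j + i : ℤ) : WithTop ℤ) : WithBot (WithTop ℤ))}

end Cech

end

/-! Both ideals are monomial, so their local cohomology splits by exponents `b : V →₀ ℤ`. The part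
of exponent `b` is the cohomology of the family of sets `F` such that x^b lies in the ideal once the
variables in `F` are inverted (`nontrivial_localCohomologyDegree_iff`). That family depends only on
the positive part `a` and the negative support `A` of `b`, so the regularity is the supremum of |a|
- |A| + i over the triples (a, A, i) whose family has cohomology in degree `i`. Membership is a
packing problem for I^s (`PowAt`: s edges inside `a`, the vertices of `F` being free) and the dual
covering problem for I^(s) (`SymAt`).

Since I^s ⊆ I^(s), the long exact sequence reduces the theorem to the difference family of the sets
with `SymAt` but not `PowAt` (`regularity_eq_of_difference`). If it has cohomology in degree `i`,
then |a| - |A| + i must be at most reg I^s and |a| - |A| + i + 1 at most reg I^(s). The first bound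
is not needed when x^a itself lies in I^(s), because the symbolic family is then a cone.

For s ≤ 3 the gap between packing and covering has few causes: a triangle for s = 2; a triangle with
a disjoint edge, a complete graph on four vertices, or a five-cycle for s = 3
(`exists_triangle_of_symAt_two`, `hasObstruction`). When such an obstruction lies in `a`, a further
vertex of `a` usually either completes a packing of s edges, which empties the difference family, or
is isolated and makes it a cone. So cohomology tends to force `a` to be the obstruction itself, and
the difference family then consists of the independent sets far from it. In some cases of third
powers the core is a triangle with one more vertex `v`, and sets near `v` occur as well.

The lower bounds come from an edge xy of the obstruction. Independent sets far from x and y,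
suspended by x and y, are again the independent sets of an induced subgraph, and the exponent m(x +
y) turns their complement into a degree family of both (m+1)-st powers
(`le_regularity_of_indep_subset`). The resulting number is at least |a| - |A| + i + 1. A triangle
with an edge far from it needs only the symbolic bound, and there the edge construction is applied
to I^(2), or twice. -/

set_option linter.unusedSectionVars false

/-! ### Cohomology of families of finite sets -/

section FamilyCohomology

variable {K V : Type*} [Field K] [LinearOrder V]

/-- The simplicial coboundary of a `K`-valued function on finite sets. -/
def cobd (c : Finset V → K) (F : Finset V) : K :=
  ∑ k ∈ F, (-1 : ℤ) ^ (F.filter (· < k)).card • c (F.erase k)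

lemma cobd_add (b c : Finset V → K) (F : Finset V) : cobd (b + c) F = cobd b F + cobd c F := by
  simp [cobd, smul_add, Finset.sum_add_distrib, -zsmul_eq_mul]

lemma cobd_sub (b c : Finset V → K) (F : Finset V) : cobd (b - c) F = cobd b F - cobd c F := by
  simp [cobd, smul_sub, Finset.sum_sub_distrib, -zsmul_eq_mul]

lemma cobd_congr {b c : Finset V → K} {F : Finset V} (h : ∀ k ∈ F, b (F.erase k) = c (F.erase k)) :
    cobd b F = cobd c F :=
  Finset.sum_congr rfl fun k hk => by rw [h k hk]

lemma cobd_eq_zero {c : Finset V → K} {F : Finset V} (h : ∀ k ∈ F, c (F.erase k) = 0) :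
    cobd c F = 0 :=
  Finset.sum_eq_zero fun k hk => by rw [h k hk, smul_zero]

lemma cechD_apply_coeff [Fintype V] (c : Finset V → LaurentRing V K) (F : Finset V) (a : V →₀ ℤ) :
    (cechD K V c F).coeff a = cobd (fun E => (c E).coeff a) F := by
  simp [cechD, cobd, AddMonoidAlgebra.coeff_sum, Finset.sum_apply', -zsmul_eq_mul]

/-- This is `cechD_cechD` for cochains of constant Laurent polynomials. -/
lemma cobd_cobd [Fintype V] (c : Finset V → K) (F : Finset V) : cobd (cobd c) F = 0 := by
  have h := congrFun (cechD_cechD (K := K) (σ := V)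
    (fun E => AddMonoidAlgebra.single 0 (c E))) F
  have h2 := congrArg (fun f => f.coeff 0) h
  simp only [cechD_apply_coeff] at h2
  simpa using h2

variable (K) in
/-- The cohomology of the family `𝓕` vanishes in degree `i`, where a set `F` of the family
has degree `F.card`. -/
def AcyclicAt (𝓕 : Set (Finset V)) (i : ℕ) : Prop :=
  ∀ c : Finset V → K, (∀ F, c F ≠ 0 → F ∈ 𝓕 ∧ F.card = i) → (∀ F ∈ 𝓕, cobd c F = 0) →
    ∃ b : Finset V → K, (∀ F, b F ≠ 0 → F ∈ 𝓕 ∧ F.card + 1 = i) ∧ ∀ F ∈ 𝓕, cobd b F = c F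

lemma exists_of_cobd_ne_zero {c : Finset V → K} {F : Finset V} (h : cobd c F ≠ 0) :
    ∃ k ∈ F, c (F.erase k) ≠ 0 := by
  by_contra! h'
  exact h (cobd_eq_zero h')

/-- Order-convexity makes the cochains on `𝓕` a complex: a set outside `𝓕` that lies under a member
of `𝓕` cannot contain a member of `𝓕`, so truncating `cobd b` to `𝓕` loses nothing below `F`. -/
lemma cobd_indicator_cobd [Fintype V] {𝓕 : Set (Finset V)} (h𝓕 : 𝓕.OrdConnected)
    {b : Finset V → K} (hb : ∀ F, b F ≠ 0 → F ∈ 𝓕) {F : Finset V} (hF : F ∈ 𝓕) :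
    cobd (𝓕.indicator (cobd b)) F = 0 := by
  rw [← cobd_cobd b F]
  refine cobd_congr fun k _ => ?_
  by_cases h : F.erase k ∈ 𝓕
  · rw [Set.indicator_of_mem h]
  · rw [Set.indicator_of_notMem h]
    refine (cobd_eq_zero fun l _ => ?_).symm
    by_contra h0
    exact h (h𝓕.out (hb _ h0) hF ⟨Finset.erase_subset _ _, Finset.erase_subset _ _⟩)

/-! ### The long exact sequence of an upward closed subfamily -/

section LongExactSequence

variable [Fintype V] {𝓕 𝓑 : Set (Finset V)} (h𝓕 : 𝓕.OrdConnected) (hsub : 𝓑 ⊆ 𝓕)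
  (hup : ∀ E ∈ 𝓑, ∀ F ∈ 𝓕, E ⊆ F → F ∈ 𝓑) {i : ℕ}
include h𝓕 hsub hup

/-- As `𝓑` is upward closed in `𝓕`, its cochains form a subcomplex with quotient the cochains on `𝓕
\ 𝓑`. This is exactness at H^i(𝓕): a cocycle is first made to vanish on `𝓕 \ 𝓑`, and what remains is
bounded inside `𝓑`. -/
lemma AcyclicAt.of_sdiff (hA : AcyclicAt K (𝓕 \ 𝓑) i) (hB : AcyclicAt K 𝓑 i) :
    AcyclicAt K 𝓕 i := by
  intro c hc hcc
  have key : ∀ (e : Finset V → K), (∀ F, e F ≠ 0 → F ∈ 𝓕) → ∀ F ∈ 𝓕 \ 𝓑,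
      cobd ((𝓕 \ 𝓑).indicator e) F = cobd e F := by
    intro e he F hF
    refine cobd_congr fun k _ => ?_
    by_cases h : F.erase k ∈ 𝓕 \ 𝓑
    · rw [Set.indicator_of_mem h]
    · rw [Set.indicator_of_notMem h]
      by_contra h0
      exact h ⟨he _ (Ne.symm h0), fun h' => hF.2 (hup _ h' _ hF.1 (Finset.erase_subset _ _))⟩
  obtain ⟨b, hb, hbc⟩ := hA ((𝓕 \ 𝓑).indicator c)
    (fun F hF => ⟨Set.mem_of_indicator_ne_zero hF,
      (hc F (fun h => hF (by simp [Set.indicator, h]))).2⟩)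
    (fun F hF => by rw [key c (fun F hF => (hc F hF).1) F hF]; exact hcc F hF.1)
  have hb𝓕 : ∀ F, b F ≠ 0 → F ∈ 𝓕 := fun F hF => (hb F hF).1.1
  obtain ⟨b', hb', hbc'⟩ := hB (c - 𝓕.indicator (cobd b)) (by
      intro F hF
      have hF𝓕 : F ∈ 𝓕 := by
        by_contra h
        have : c F = 0 := by
          by_contra h'
          exact h (hc F h').1
        exact hF (by simp [h, this])
      have hF' : c F - cobd b F ≠ 0 := by simpa [hF𝓕] using hF
      refine ⟨?_, ?_⟩
      · by_contra h
        have := hbc F ⟨hF𝓕, h⟩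
        rw [Set.indicator_of_mem (s := 𝓕 \ 𝓑) ⟨hF𝓕, h⟩] at this
        exact hF' (by rw [this, sub_self])
      · by_cases h : c F = 0
        · rw [h, zero_sub, neg_ne_zero] at hF'
          obtain ⟨k, hk, hbk⟩ := exists_of_cobd_ne_zero hF'
          rw [← (hb _ hbk).2, Finset.card_erase_add_one hk]
        · exact (hc F h).2)
    (by
      intro F hF
      rw [cobd_sub, hcc F (hsub hF), cobd_indicator_cobd h𝓕 hb𝓕 (hsub hF), sub_zero])
  refine ⟨b + b', ?_, ?_⟩
  · intro F hF
    by_cases h : b F = 0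
    · have h' : b' F ≠ 0 := by simpa [h] using hF
      exact ⟨hsub (hb' F h').1, (hb' F h').2⟩
    · exact ⟨(hb F h).1.1, (hb F h).2⟩
  · intro F hF
    rw [cobd_add]
    by_cases h : F ∈ 𝓑
    · rw [hbc' F h, Pi.sub_apply, Set.indicator_of_mem hF]
      ring
    · rw [hbc F ⟨hF, h⟩, Set.indicator_of_mem (s := 𝓕 \ 𝓑) ⟨hF, h⟩,
        cobd_eq_zero (c := b'), add_zero]
      intro k _
      by_contra h0
      exact h (hup _ (hb' _ h0).1 _ hF (Finset.erase_subset _ _))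

/-- Exactness at H^i(𝓕 \ 𝓑): the coboundary in `𝓕` of a cocycle of the quotient lives on `𝓑`, and a
primitive of it there corrects the cocycle to one on `𝓕`. -/
lemma AcyclicAt.sdiff (hF : AcyclicAt K 𝓕 i) (hB : AcyclicAt K 𝓑 (i + 1)) :
    AcyclicAt K (𝓕 \ 𝓑) i := by
  intro c hc hcc
  have hc𝓕 : ∀ F, c F ≠ 0 → F ∈ 𝓕 := fun F hF => (hc F hF).1.1
  have hvan : ∀ (e : Finset V → K), (∀ F, e F ≠ 0 → F ∈ 𝓑) → ∀ F ∈ 𝓕 \ 𝓑, cobd e F = 0 := by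
    intro e he F hF
    refine cobd_eq_zero fun k _ => ?_
    by_contra h0
    exact hF.2 (hup _ (he _ h0) _ hF.1 (Finset.erase_subset _ _))
  obtain ⟨e, he, hec⟩ := hB (𝓕.indicator (cobd c)) (by
      intro F hF
      have h1 := Set.mem_of_indicator_ne_zero hF
      rw [Set.indicator_of_mem h1] at hF
      refine ⟨?_, ?_⟩
      · by_contra h
        exact hF (hcc F ⟨h1, h⟩)
      · obtain ⟨k, hk, hk'⟩ := exists_of_cobd_ne_zero hF
        rw [← (hc _ hk').2, Finset.card_erase_add_one hk])
    (fun F hF => cobd_indicator_cobd h𝓕 hc𝓕 (hsub hF))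
  obtain ⟨b, hb, hbc⟩ := hF (c - e) (by
      intro F hF
      by_cases h : c F = 0
      · have h' : e F ≠ 0 := fun h0 => hF (by simp [h, h0])
        exact ⟨hsub (he F h').1, by simpa using (he F h').2⟩
      · exact ⟨hc𝓕 F h, (hc F h).2⟩)
    (by
      intro F hF
      rw [cobd_sub]
      by_cases h : F ∈ 𝓑
      · rw [hec F h, Set.indicator_of_mem hF, sub_self]
      · rw [hcc F ⟨hF, h⟩, hvan e (fun F hF => (he F hF).1) F ⟨hF, h⟩, sub_zero])
  refine ⟨(𝓕 \ 𝓑).indicator b, fun F hF => ⟨Set.mem_of_indicator_ne_zero hF,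
    (hb F (fun h => hF (by simp [Set.indicator, h]))).2⟩, ?_⟩
  intro F hF
  have hb' : cobd ((𝓕 \ 𝓑).indicator b) F = cobd b F := by
    refine cobd_congr fun k _ => ?_
    by_cases h : F.erase k ∈ 𝓕 \ 𝓑
    · rw [Set.indicator_of_mem h]
    · rw [Set.indicator_of_notMem h]
      by_contra h0
      exact h ⟨(hb _ (Ne.symm h0)).1,
        fun h' => hF.2 (hup _ h' _ hF.1 (Finset.erase_subset _ _))⟩
  have he0 : e F = 0 := by
    by_contra h
    exact hF.2 (he F h).1
  rw [hb', hbc F hF.1, Pi.sub_apply, he0, sub_zero]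

/-- Exactness at H^i(𝓑). The quantified `j` stands for i - 1, so that nothing is required when `i =
0`. -/
lemma AcyclicAt.of_sdiff_prev (hF : AcyclicAt K 𝓕 i)
    (hA : ∀ j, j + 1 = i → AcyclicAt K (𝓕 \ 𝓑) j) : AcyclicAt K 𝓑 i := by
  intro c hc hcc
  obtain ⟨b, hb, hbc⟩ := hF c (fun F hF => ⟨hsub (hc F hF).1, (hc F hF).2⟩) (by
    intro F hF
    by_cases h : F ∈ 𝓑
    · exact hcc F h
    · refine cobd_eq_zero fun k _ => ?_
      by_contra h0
      exact h (hup _ (hc _ h0).1 _ hF (Finset.erase_subset _ _)))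
  -- In degree 0 there are no cochains of lower degree, so the primitive `b` is zero and serves for
  -- `𝓑` as well.
  rcases i with _ | j
  · exact ⟨b, fun F hF => absurd (hb F hF).2 (by omega), fun F hF => hbc F (hsub hF)⟩
  have hb' : ∀ F ∈ 𝓕 \ 𝓑, cobd ((𝓕 \ 𝓑).indicator b) F = cobd b F := by
    intro F hF
    refine cobd_congr fun k _ => ?_
    by_cases h : F.erase k ∈ 𝓕 \ 𝓑
    · rw [Set.indicator_of_mem h]
    · rw [Set.indicator_of_notMem h]
      by_contra h0
      exact h ⟨(hb _ (Ne.symm h0)).1,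
        fun h' => hF.2 (hup _ h' _ hF.1 (Finset.erase_subset _ _))⟩
  obtain ⟨e, he, hec⟩ := hA j rfl ((𝓕 \ 𝓑).indicator b)
    (fun F hF => ⟨Set.mem_of_indicator_ne_zero hF,
      by simpa using (hb F (fun h => hF (by simp [Set.indicator, h]))).2⟩)
    (by
      intro F hF
      rw [hb' F hF, hbc F hF.1]
      by_contra h
      exact hF.2 (hc F h).1)
  refine ⟨b - 𝓕.indicator (cobd e), ?_, ?_⟩
  · intro F hF
    have hF𝓕 : F ∈ 𝓕 := by
      by_contra h
      have : b F = 0 := by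
        by_contra h'
        exact h (hb F h').1
      exact hF (by simp [h, this])
    have hF' : b F - cobd e F ≠ 0 := by simpa [hF𝓕] using hF
    refine ⟨?_, ?_⟩
    · by_contra h
      have := hec F ⟨hF𝓕, h⟩
      rw [Set.indicator_of_mem (s := 𝓕 \ 𝓑) ⟨hF𝓕, h⟩] at this
      exact hF' (by rw [this, sub_self])
    · by_cases h : b F = 0
      · rw [h, zero_sub, neg_ne_zero] at hF'
        obtain ⟨k, hk, hk'⟩ := exists_of_cobd_ne_zero hF'
        rw [← (he _ hk').2, Finset.card_erase_add_one hk]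
      · exact (hb F h).2
  · intro F hF
    rw [cobd_sub, hbc F (hsub hF),
      cobd_indicator_cobd h𝓕 (fun F hF => (he F hF).1.1) (hsub hF), sub_zero]

end LongExactSequence

/-- The sign rule that makes the contraction by `q` anticommute with the other terms of the
coboundary. -/
lemma neg_one_pow_insert_erase {q k : V} {F : Finset V} (hq : q ∉ F) (hk : k ∈ F) :
    (-1 : ℤ) ^ (F.filter (· < k)).card * (-1) ^ ((F.erase k).filter (· < q)).card =
      -((-1) ^ (F.filter (· < q)).card * (-1) ^ ((insert q F).filter (· < k)).card) := by
  have hqk : q ≠ k := fun h => hq (h ▸ hk)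
  rcases lt_or_gt_of_ne hqk with h | h
  · have h1 : (F.erase k).filter (· < q) = F.filter (· < q) := by
      ext x
      simp only [Finset.mem_filter, Finset.mem_erase]
      exact ⟨fun hx => ⟨hx.1.2, hx.2⟩, fun hx => ⟨⟨(hx.2.trans h).ne, hx.1⟩, hx.2⟩⟩
    rw [h1, Finset.filter_insert, if_pos h, Finset.card_insert_of_notMem (by simp [hq])]
    ring
  · have h1 : (F.erase k).filter (· < q) = (F.filter (· < q)).erase k := by
      ext x
      simp only [Finset.mem_filter, Finset.mem_erase]
      tauto
    have h2 := Finset.card_erase_add_one (Finset.mem_filter.2 ⟨hk, h⟩ : k ∈ F.filter (· < q))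
    rw [h1, Finset.filter_insert, if_neg h.not_gt, ← h2]
    ring

/-- A family that is a cone over a vertex is acyclic. -/
lemma AcyclicAt.of_cone {𝓕 : Set (Finset V)} {q : V}
    (hq : ∀ F ∈ 𝓕, insert q F ∈ 𝓕 ∧ F.erase q ∈ 𝓕) (i : ℕ) : AcyclicAt K 𝓕 i := by
  intro c hc hcc
  -- The contracting homotopy of the cone, with the sign of `q` in `insert q F`.
  refine ⟨fun F => if q ∈ F then 0 else (-1 : ℤ) ^ (F.filter (· < q)).card • c (insert q F),
    ?_, ?_⟩
  · intro F hF
    by_cases hqF : q ∈ F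
    · simp [hqF] at hF
    · simp only [hqF, if_false] at hF
      have h := hc (insert q F) (fun h => hF (by rw [h, smul_zero]))
      refine ⟨?_, by rw [← h.2, Finset.card_insert_of_notMem hqF]⟩
      have := (hq _ h.1).2
      rwa [Finset.erase_insert hqF] at this
  · intro F hF
    by_cases hqF : q ∈ F
    · rw [cobd, Finset.sum_eq_single q]
      · have h1 : (F.erase q).filter (· < q) = F.filter (· < q) := by
          ext x
          simp only [Finset.mem_filter, Finset.mem_erase]
          exact ⟨fun hx => ⟨hx.1.2, hx.2⟩, fun hx => ⟨⟨hx.2.ne, hx.1⟩, hx.2⟩⟩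
        rw [if_neg (by simp), h1, smul_smul, ← mul_pow, Finset.insert_erase hqF]
        simp
      · intro k hk hkq
        rw [if_pos (Finset.mem_erase.2 ⟨hkq.symm, hqF⟩), smul_zero]
      · exact fun h => absurd hqF h
    · have h := hcc _ (hq F hF).1
      rw [cobd, Finset.sum_insert hqF, Finset.erase_insert hqF] at h
      have h1 : (insert q F).filter (· < q) = F.filter (· < q) := by
        rw [Finset.filter_insert, if_neg (lt_irrefl q)]
      rw [h1] at h
      have h2 := congrArg (fun x => (-1 : ℤ) ^ (F.filter (· < q)).card • x) h
      simp only [smul_add, smul_smul, ← mul_pow, Finset.smul_sum, smul_zero] at h2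
      rw [neg_one_mul, neg_neg, one_pow, one_smul] at h2
      rw [eq_neg_of_add_eq_zero_left h2, cobd, ← Finset.sum_neg_distrib]
      refine Finset.sum_congr rfl fun k hk => ?_
      rw [if_neg (fun h => hqF (Finset.mem_of_mem_erase h)), smul_smul,
        neg_one_pow_insert_erase hqF hk, neg_smul,
        Finset.erase_insert_of_ne (by rintro rfl; exact hqF hk)]

lemma AcyclicAt.congr {𝓕 𝓖 : Set (Finset V)} {i : ℕ} (h : AcyclicAt K 𝓕 i)
    (h' : ∀ F, F ∈ 𝓕 ↔ F ∈ 𝓖) : AcyclicAt K 𝓖 i := by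
  rwa [← Set.ext h']

lemma nonempty_of_not_acyclicAt {𝓕 : Set (Finset V)} {i : ℕ} (h : ¬ AcyclicAt K 𝓕 i) :
    𝓕.Nonempty := by
  by_contra h'
  rw [Set.not_nonempty_iff_eq_empty] at h'
  subst h'
  exact h fun c _ _ => ⟨0, by simp, by simp⟩

end FamilyCohomology

/-! ### Local cohomology of monomial ideals -/

section MonomialIdeal

variable {K σ : Type*} [Field K] [LinearOrder σ]

/-- The ideal `J` is spanned as a `K`-vector space by the monomials with exponents in `M`. -/
def IsMonomialWith (J : Ideal (MvPolynomial σ K)) (M : Set (σ →₀ ℕ)) : Prop :=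
  ∀ f, f ∈ J ↔ ∀ m ∈ f.support, m ∈ M

/-- The family of the sets `F` such that the monomial `x ^ a` lies in `J_{x_F}`, for a monomial
ideal `J` with set of exponents `M`. -/
def degreeFamily (M : Set (σ →₀ ℕ)) (a : σ →₀ ℤ) : Set (Finset σ) :=
  {F | ∃ N : ℕ, ∃ m ∈ M, ∀ k, ((m k : ℕ) : ℤ) = a k + if k ∈ F then (N : ℤ) else 0}

/-- Natural exponents as integral exponents. -/
noncomputable def natExp (σ : Type*) : (σ →₀ ℕ) →+ (σ →₀ ℤ) :=
  Finsupp.mapRange.addMonoidHom (Nat.castAddMonoidHom ℤ)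

lemma natExp_apply (m : σ →₀ ℕ) (k : σ) : natExp σ m k = m k := rfl

lemma toLaurent_eq : toLaurent σ K =
    (AddMonoidAlgebra.mapDomainAlgHom K K (natExp σ) :
      AddMonoidAlgebra K (σ →₀ ℕ) →ₐ[K] LaurentRing σ K) := by
  refine MvPolynomial.algHom_ext fun k => ?_
  rw [toLaurent, MvPolynomial.aeval_X]
  change _ = AddMonoidAlgebra.mapDomain (natExp σ) (AddMonoidAlgebra.single (Finsupp.single k 1) 1)
  rw [AddMonoidAlgebra.mapDomain_single]
  congr 1
  simp [natExp]

lemma toLaurent_monomial (m : σ →₀ ℕ) (c : K) :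
    toLaurent σ K (MvPolynomial.monomial m c) = AddMonoidAlgebra.single (natExp σ m) c := by
  rw [toLaurent_eq]
  exact AddMonoidAlgebra.mapDomain_single

lemma toLaurent_coeff (g : MvPolynomial σ K) (a : σ →₀ ℤ) (h : (toLaurent σ K g).coeff a ≠ 0) :
    ∃ m ∈ g.support, natExp σ m = a := by
  have h1 : a ∈ (Finsupp.mapDomain (natExp σ) (AddMonoidAlgebra.coeff g)).support := by
    rw [toLaurent_eq] at h
    exact Finsupp.mem_support_iff.2 h
  obtain ⟨m, hm, hma⟩ := Finset.mem_image.1 (Finsupp.mapDomain_support h1)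
  exact ⟨m, hm, hma⟩

lemma varProd_eq (F : Finset σ) :
    varProd K F = MvPolynomial.monomial (∑ k ∈ F, Finsupp.single k 1) 1 := by
  simp [varProd, MvPolynomial.monomial_sum_one, MvPolynomial.X]

lemma toLaurent_varProd_pow (F : Finset σ) (N : ℕ) : toLaurent σ K (varProd K F) ^ N =
    AddMonoidAlgebra.single (natExp σ (N • ∑ k ∈ F, Finsupp.single k 1)) 1 := by
  rw [← map_pow, varProd_eq, MvPolynomial.monomial_pow, one_pow, toLaurent_monomial]

lemma natExp_smul_sum_apply (F : Finset σ) (N : ℕ) (k : σ) :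
    natExp σ (N • ∑ k ∈ F, Finsupp.single k 1) k = if k ∈ F then (N : ℤ) else 0 := by
  simp [natExp_apply, Finsupp.single_apply]

lemma single_mem_localizedIdeal {J : Ideal (MvPolynomial σ K)} {M : Set (σ →₀ ℕ)}
    (hJ : IsMonomialWith J M) {F : Finset σ} {a : σ →₀ ℤ} (h : F ∈ degreeFamily M a) (c : K) :
    AddMonoidAlgebra.single a c ∈ localizedIdeal J F := by
  obtain ⟨N, m, hm, hN⟩ := h
  refine ⟨N, MvPolynomial.monomial m c, (hJ _).2 fun m' hm' => ?_, ?_⟩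
  · rw [Finset.mem_singleton.1 (MvPolynomial.support_monomial_subset hm')]
    exact hm
  · rw [toLaurent_varProd_pow, toLaurent_monomial, AddMonoidAlgebra.single_mul_single, one_mul]
    congr 1
    ext k
    rw [Finsupp.add_apply, natExp_smul_sum_apply, natExp_apply, add_comm]
    exact (hN k).symm

lemma mem_localizedIdeal_iff {J : Ideal (MvPolynomial σ K)} {M : Set (σ →₀ ℕ)}
    (hJ : IsMonomialWith J M) {F : Finset σ} {f : LaurentRing σ K} :
    f ∈ localizedIdeal J F ↔ ∀ a, f.coeff a ≠ 0 → F ∈ degreeFamily M a := by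
  constructor
  · rintro ⟨N, g, hg, hf⟩ a ha
    have h1 : (toLaurent σ K g).coeff (natExp σ (N • ∑ k ∈ F, Finsupp.single k 1) + a) ≠ 0 := by
      rw [← hf, toLaurent_varProd_pow, AddMonoidAlgebra.coeff_single_mul_add, one_mul]
      exact ha
    obtain ⟨m, hm, hma⟩ := toLaurent_coeff g _ h1
    refine ⟨N, m, (hJ g).1 hg m hm, fun k => ?_⟩
    have := DFunLike.congr_fun hma k
    rw [natExp_apply, Finsupp.add_apply, natExp_smul_sum_apply] at this
    rw [this, add_comm]
  · intro h
    have : f = ∑ a ∈ f.coeff.support, AddMonoidAlgebra.single a (f.coeff a) := by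
      apply AddMonoidAlgebra.ext
      rw [AddMonoidAlgebra.coeff_sum]
      exact (Finsupp.sum_single f.coeff).symm
    rw [this]
    exact Submodule.sum_mem _ fun a ha =>
      single_mem_localizedIdeal hJ (h a (Finsupp.mem_support_iff.1 ha)) _

lemma degreeFamily_mono {J : Ideal (MvPolynomial σ K)} {M : Set (σ →₀ ℕ)}
    (hJ : IsMonomialWith J M) {E F : Finset σ} {a : σ →₀ ℤ} (hEF : E ⊆ F)
    (h : E ∈ degreeFamily M a) : F ∈ degreeFamily M a :=
  (mem_localizedIdeal_iff hJ).1
    (localizedIdeal_mono J hEF (single_mem_localizedIdeal hJ h 1)) a (by simp)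

variable [Fintype σ]

lemma mem_laurentDegree_iff {f : LaurentRing σ K} {j : ℤ} :
    f ∈ laurentDegree K j ↔ ∀ a : σ →₀ ℤ, f.coeff a ≠ 0 → ∑ k, a k = j := by
  rw [laurentDegree, AddMonoidAlgebra.mem_gradeBy_iff]
  simp [Set.subset_def]

lemma mem_cechCochains_iff {J : Ideal (MvPolynomial σ K)} {M : Set (σ →₀ ℕ)}
    (hJ : IsMonomialWith J M) {i : ℕ} {j : ℤ} {c : Finset σ → LaurentRing σ K} :
    c ∈ cechCochains J i j ↔ ∀ F (a : σ →₀ ℤ), (c F).coeff a ≠ 0 →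
      F.card = i ∧ F ∈ degreeFamily M a ∧ ∑ k, a k = j := by
  constructor
  · rintro ⟨h1, h2⟩ F a ha
    have hF : F.card = i := by
      by_contra h
      exact ha (by rw [h2 F h]; rfl)
    have := h1 F hF
    exact ⟨hF, (mem_localizedIdeal_iff hJ).1 this.1 a ha, mem_laurentDegree_iff.1 this.2 a ha⟩
  · intro h
    refine ⟨fun F _ => ⟨(mem_localizedIdeal_iff hJ).2 fun a ha => (h F a ha).2.1,
      mem_laurentDegree_iff.2 fun a ha => (h F a ha).2.2⟩, fun F hF => ?_⟩
    apply AddMonoidAlgebra.ext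
    ext a
    by_contra h0
    exact hF (h F a h0).1

lemma mem_cechCoboundaries_iff {J : Ideal (MvPolynomial σ K)} {M : Set (σ →₀ ℕ)}
    (hJ : IsMonomialWith J M) {i : ℕ} {j : ℤ} {c : Finset σ → LaurentRing σ K} :
    c ∈ cechCoboundaries J i j ↔ ∃ b : Finset σ → LaurentRing σ K,
      (∀ F (a : σ →₀ ℤ), (b F).coeff a ≠ 0 →
        F.card + 1 = i ∧ F ∈ degreeFamily M a ∧ ∑ k, a k = j) ∧ cechD K σ b = c := by
  cases i with
  | zero =>
    constructor
    · intro h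
      rw [show c = 0 from h]
      exact ⟨0, by simp, map_zero _⟩
    · rintro ⟨b, hb, rfl⟩
      have : b = 0 := by
        funext F
        apply AddMonoidAlgebra.ext
        ext a
        by_contra h0
        exact absurd (hb F a h0).1 (by omega)
      rw [this, map_zero]
      exact Submodule.zero_mem _
  | succ i =>
    constructor
    · rintro ⟨b, hb, rfl⟩
      refine ⟨b, fun F a h => ?_, rfl⟩
      simpa using (mem_cechCochains_iff hJ).1 hb F a h
    · rintro ⟨b, hb, rfl⟩
      refine ⟨b, (mem_cechCochains_iff hJ).2 fun F a h => ?_, rfl⟩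
      simpa using hb F a h

lemma cobd_eq_zero_of_notMem {J : Ideal (MvPolynomial σ K)} {M : Set (σ →₀ ℕ)}
    (hJ : IsMonomialWith J M) {a : σ →₀ ℤ} {c : Finset σ → K}
    (hc : ∀ F, c F ≠ 0 → F ∈ degreeFamily M a) {F : Finset σ} (hF : F ∉ degreeFamily M a) :
    cobd c F = 0 := by
  refine cobd_eq_zero fun k _ => ?_
  by_contra h
  exact hF (degreeFamily_mono hJ (Finset.erase_subset _ _) (hc _ h))

/-- The multigraded description of the local cohomology of a monomial ideal. -/
lemma nontrivial_localCohomologyDegree_iff {J : Ideal (MvPolynomial σ K)} {M : Set (σ →₀ ℕ)}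
    (hJ : IsMonomialWith J M) (i : ℕ) (j : ℤ) :
    Nontrivial (LocalCohomologyDegree J i j) ↔
      ∃ a : σ →₀ ℤ, ∑ k, a k = j ∧ ¬ AcyclicAt K (degreeFamily M a) i := by
  rw [Submodule.Quotient.nontrivial_iff, Ne, Submodule.comap_subtype_eq_top]
  constructor
  · intro h
    by_contra! hac
    apply h
    rintro z ⟨hz, hz'⟩
    replace hz := (mem_cechCochains_iff hJ).1 hz
    replace hz' : cechD K σ z = 0 := hz'
    have hz0 : ∀ F a, cobd (fun E => (z E).coeff a) F = 0 := fun F a => by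
      rw [← cechD_apply_coeff, hz']
      rfl
    have hb : ∀ a : σ →₀ ℤ, ∃ b : Finset σ → K,
        (∀ F, b F ≠ 0 → F ∈ degreeFamily M a ∧ F.card + 1 = i ∧ ∑ k, a k = j) ∧
          ∀ F, cobd b F = (z F).coeff a := by
      intro a
      by_cases ha : ∑ k, a k = j
      · obtain ⟨b, hb, hbc⟩ := hac a ha (fun E => (z E).coeff a)
          (fun F hF => ⟨(hz F a hF).2.1, (hz F a hF).1⟩) (fun F _ => hz0 F a)
        refine ⟨b, fun F hF => ⟨(hb F hF).1, (hb F hF).2, ha⟩, fun F => ?_⟩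
        by_cases hF : F ∈ degreeFamily M a
        · exact hbc F hF
        · rw [cobd_eq_zero_of_notMem hJ (fun F hF => (hb F hF).1) hF]
          by_contra h0
          exact hF (hz F a (Ne.symm h0)).2.1
      · refine ⟨0, by simp, fun F => ?_⟩
        rw [cobd_eq_zero (by simp)]
        by_contra h0
        exact ha (hz F a (Ne.symm h0)).2.2
    choose b hb hbc using hb
    -- Only finitely many exponents occur in `z`, so the primitives found exponent by exponent add
    -- up to Laurent polynomials.
    let S : Finset (σ →₀ ℤ) := Finset.univ.biUnion fun F => (z F).coeff.support
    have hcoeff : ∀ F a, (∑ a ∈ S, AddMonoidAlgebra.single a (b a F)).coeff a =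
        if a ∈ S then b a F else 0 := by
      intro F a
      simp [AddMonoidAlgebra.coeff_sum, Finsupp.single_apply]
    refine (mem_cechCoboundaries_iff hJ).2
      ⟨fun F => ∑ a ∈ S, AddMonoidAlgebra.single a (b a F), fun F a hF => ?_, ?_⟩
    · rw [hcoeff] at hF
      have := hb a F (fun h => hF (by rw [h, ite_self]))
      exact ⟨this.2.1, this.1, this.2.2⟩
    · funext F
      apply AddMonoidAlgebra.ext
      ext a
      rw [cechD_apply_coeff]
      simp only [hcoeff]
      by_cases ha : a ∈ S
      · simp only [ha, if_true]
        exact hbc a F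
      · simp only [ha, if_false]
        rw [cobd_eq_zero (by simp)]
        by_contra h0
        exact ha (Finset.mem_biUnion.2 ⟨F, Finset.mem_univ _, Finsupp.mem_support_iff.2 (Ne.symm h0)⟩)
  · rintro ⟨a, ha, hac⟩ h
    apply hac
    intro c hc hcc
    have hz : (fun F => AddMonoidAlgebra.single a (c F)) ∈ cechCocycles J i j := by
      refine ⟨(mem_cechCochains_iff hJ).2 fun F a' hF => ?_, ?_⟩
      · simp only [AddMonoidAlgebra.coeff_single, Finsupp.single_apply] at hF
        split_ifs at hF with h1
        · subst h1
          exact ⟨(hc F hF).2, (hc F hF).1, ha⟩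
        · exact absurd rfl hF
      · change cechD K σ _ = 0
        funext F
        apply AddMonoidAlgebra.ext
        ext a'
        rw [cechD_apply_coeff]
        simp only [AddMonoidAlgebra.coeff_single, Finsupp.single_apply]
        by_cases h1 : a = a'
        · subst h1
          simp only [if_true]
          by_cases hF : F ∈ degreeFamily M a
          · exact hcc F hF
          · exact cobd_eq_zero_of_notMem hJ (fun F hF => (hc F hF).1) hF
        · simp only [h1, if_false]
          exact cobd_eq_zero (by simp)
    obtain ⟨b, hb, hbz⟩ := (mem_cechCoboundaries_iff hJ).1 (h hz)
    refine ⟨fun F => (b F).coeff a, fun F hF => ⟨(hb F a hF).2.1, (hb F a hF).1⟩, fun F _ => ?_⟩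
    rw [← cechD_apply_coeff, hbz]
    simp

end MonomialIdeal

/-! ### Powers and symbolic powers of edge ideals -/

section EdgeIdeal

variable {V : Type*} [LinearOrder V] (G : SimpleGraph V)

/-- The multiset of the endpoints of a list of pairs. -/
def endpoints (l : List (V × V)) : Multiset V :=
  (l.map fun e => ({e.1, e.2} : Multiset V)).sum

/-- There are `s` edges whose endpoints, if those in `F` are discarded, form a submultiset
of `a`: the monomial `x ^ a x_F ^ N` lies in the `s`-th power of the edge ideal for large `N`. -/
def PowAt (s : ℕ) (a : Multiset V) (F : Finset V) : Prop :=
  ∃ l : List (V × V), l.length = s ∧ (∀ e ∈ l, G.Adj e.1 e.2) ∧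
    ∀ x, x ∉ F → (endpoints l).count x ≤ a.count x

/-- A finite set of pairwise nonadjacent vertices. -/
def Indep (M : Finset V) : Prop := ∀ x ∈ M, ∀ y ∈ M, ¬ G.Adj x y

/-- Every vertex cover disjoint from `F` has weight at least `s` in `a`: the monomial
`x ^ a x_F ^ N` lies in the `s`-th symbolic power of the edge ideal for large `N`. -/
def SymAt (s : ℕ) (a : Multiset V) (F : Finset V) : Prop :=
  ∀ M : Finset V, Indep G M → F ⊆ M → s ≤ (a.filter (· ∉ M)).card

variable {G}

lemma endpoints_cons (e : V × V) (l : List (V × V)) :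
    endpoints (e :: l) = {e.1, e.2} + endpoints l := by
  simp [endpoints]

lemma card_endpoints (l : List (V × V)) : (endpoints l).card = 2 * l.length := by
  induction l with
  | nil => simp [endpoints]
  | cons e l ih =>
    rw [endpoints_cons, Multiset.card_add, ih, List.length_cons]
    simp
    ring

variable {K : Type*} [Field K]

lemma edgeIdeal_pow_eq_span (s : ℕ) : edgeIdeal K G ^ s =
    Ideal.span ((fun m => MvPolynomial.monomial m (1 : K)) '' {m | ∃ l : List (V × V),
      l.length = s ∧ (∀ e ∈ l, G.Adj e.1 e.2) ∧ m = Multiset.toFinsupp (endpoints l)}) := by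
  induction s with
  | zero =>
    rw [pow_zero, Ideal.one_eq_top, eq_comm, Ideal.eq_top_iff_one]
    refine Ideal.subset_span ⟨0, ⟨[], rfl, by simp, by simp [endpoints]⟩, rfl⟩
  | succ s ih =>
    rw [pow_succ', ih, edgeIdeal, Ideal.span_mul_span']
    congr 1
    ext f
    rw [Set.mem_mul]
    constructor
    · rintro ⟨_, ⟨i, j, hij, rfl⟩, _, ⟨m, ⟨l, hl, hadj, rfl⟩, rfl⟩, rfl⟩
      refine ⟨_, ⟨(i, j) :: l, by simp [hl], by simpa [hij] using hadj, rfl⟩, ?_⟩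
      rw [endpoints_cons, map_add]
      simp only [MvPolynomial.X, MvPolynomial.monomial_mul, mul_one]
      congr 2
      simp [← Multiset.singleton_add, Multiset.insert_eq_cons]
    · rintro ⟨_, ⟨_ | ⟨⟨i, j⟩, l⟩, hl, hadj, rfl⟩, rfl⟩
      · simp at hl
      refine ⟨_, ⟨i, j, hadj (i, j) (by simp), rfl⟩, _,
        ⟨_, ⟨l, by simpa using hl, fun e he => hadj e (by simp [he]), rfl⟩, rfl⟩, ?_⟩
      rw [endpoints_cons, map_add]
      simp only [MvPolynomial.X, MvPolynomial.monomial_mul, mul_one]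
      congr 2
      simp [← Multiset.singleton_add, Multiset.insert_eq_cons]

lemma isMonomialWith_edgeIdeal_pow (s : ℕ) : IsMonomialWith (edgeIdeal K G ^ s)
    {m | PowAt G s (Finsupp.toMultiset m) ∅} := by
  intro f
  rw [edgeIdeal_pow_eq_span, MvPolynomial.mem_ideal_span_monomial_image]
  refine forall₂_congr fun m _ => ?_
  constructor
  · rintro ⟨_, ⟨l, hl, hadj, rfl⟩, hm⟩
    refine ⟨l, hl, hadj, fun x _ => ?_⟩
    simpa using hm x
  · rintro ⟨l, hl, hadj, hm⟩
    refine ⟨_, ⟨l, hl, hadj, rfl⟩, fun x => ?_⟩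
    simpa using hm x

/-- The `C`-weight of an exponent. -/
def coverWeight (C : Finset V) (m : V →₀ ℕ) : ℕ := ∑ k ∈ C, m k

/-- The substitution `x_k ↦ x_k t` for `k ∈ C`. -/
noncomputable def gradeHom (K : Type*) [Field K] (C : Finset V) :
    MvPolynomial V K →ₐ[K] Polynomial (MvPolynomial V K) :=
  MvPolynomial.aeval fun k => Polynomial.C (MvPolynomial.X k) * if k ∈ C then Polynomial.X else 1

lemma gradeHom_monomial (C : Finset V) (m : V →₀ ℕ) (c : K) :
    gradeHom K C (MvPolynomial.monomial m c) =
      Polynomial.C (MvPolynomial.monomial m c) * Polynomial.X ^ coverWeight C m := by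
  have h2 : (m.prod fun k n => ((if k ∈ C then Polynomial.X else 1 : Polynomial (MvPolynomial V K))) ^ n)
      = Polynomial.X ^ coverWeight C m := by
    rw [coverWeight, ← Finset.prod_pow_eq_pow_sum]
    simp only [ite_pow, one_pow, Finsupp.prod, Finset.prod_ite, Finset.prod_const_one, mul_one]
    refine Finset.prod_subset (fun x hx => (Finset.mem_filter.1 hx).2) fun x hx hx' => ?_
    have : m x = 0 := by
      by_contra h
      exact hx' (by simp [h, hx])
    rw [this, pow_zero]
  rw [gradeHom, MvPolynomial.aeval_monomial]
  simp only [mul_pow]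
  rw [Finsupp.prod_mul, h2, ← mul_assoc]
  congr 1
  rw [MvPolynomial.monomial_eq, map_mul, Finsupp.prod, Finsupp.prod, map_prod]
  simp only [map_pow]
  rfl

/-- The order in t of the substituted polynomial is the least `C`-weight of a monomial of `f`.
Orders in t are additive, which is how units of the localization at `coverPrime K C` get cancelled
later. -/
lemma X_pow_dvd_gradeHom_iff (C : Finset V) (f : MvPolynomial V K) (s : ℕ) :
    Polynomial.X ^ s ∣ gradeHom K C f ↔ ∀ m ∈ f.support, s ≤ coverWeight C m := by
  have key : ∀ d m, ((gradeHom K C f).coeff d).coeff m =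
      if coverWeight C m = d then f.coeff m else 0 := by
    intro d m
    conv_lhs => rw [← MvPolynomial.support_sum_monomial_coeff f]
    rw [map_sum, Polynomial.finsetSum_coeff, MvPolynomial.coeff_sum]
    simp only [gradeHom_monomial, Polynomial.coeff_C_mul_X_pow]
    rw [Finset.sum_eq_single m]
    · by_cases h : d = coverWeight C m
      · simp [h]
      · simp [h, Ne.symm h]
    · intro m' _ hm
      split_ifs
      · simp [MvPolynomial.coeff_monomial, hm]
      · simp
    · intro h
      rw [MvPolynomial.notMem_support_iff.1 h]
      simp
  rw [Polynomial.X_pow_dvd_iff]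
  constructor
  · intro h m hm
    by_contra! hlt
    have := key (coverWeight C m) m
    rw [h _ hlt, if_pos rfl, MvPolynomial.coeff_zero] at this
    exact MvPolynomial.mem_support_iff.1 hm this.symm
  · intro h d hd
    ext m
    rw [key, MvPolynomial.coeff_zero]
    split_ifs with h1
    · by_contra h0
      have := h m (MvPolynomial.mem_support_iff.2 h0)
      omega
    · rfl

/-- The prime ideal generated by the variables in `C`. -/
noncomputable def coverPrime (K : Type*) [Field K] (C : Finset V) : Ideal (MvPolynomial V K) :=
  (Ideal.span {Polynomial.X}).comap (gradeHom K C)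

instance coverPrime_isPrime (C : Finset V) : (coverPrime K C).IsPrime := by
  have : (Ideal.span {(Polynomial.X : Polynomial (MvPolynomial V K))}).IsPrime :=
    (Ideal.span_singleton_prime Polynomial.X_ne_zero).2 Polynomial.prime_X
  exact Ideal.comap_isPrime _ _

lemma mem_coverPrime_iff {C : Finset V} {f : MvPolynomial V K} :
    f ∈ coverPrime K C ↔ ∀ m ∈ f.support, ∃ k ∈ C, m k ≠ 0 := by
  rw [coverPrime, Ideal.mem_comap, Ideal.mem_span_singleton]
  have := X_pow_dvd_gradeHom_iff C f 1
  rw [pow_one] at this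
  refine this.trans (forall₂_congr fun m _ => ?_)
  rw [Nat.one_le_iff_ne_zero, coverWeight, Ne, Finset.sum_eq_zero_iff]
  push Not
  rfl

lemma X_mem_coverPrime_iff {C : Finset V} {k : V} :
    (MvPolynomial.X k : MvPolynomial V K) ∈ coverPrime K C ↔ k ∈ C := by
  rw [mem_coverPrime_iff, MvPolynomial.support_X]
  simp only [Finset.mem_singleton, forall_eq]
  constructor
  · rintro ⟨j, hj, h⟩
    rw [Finsupp.single_apply] at h
    split_ifs at h with h1
    · exact h1 ▸ hj
    · exact absurd rfl h
  · exact fun h => ⟨k, h, by simp⟩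

lemma edgeIdeal_le_coverPrime {C : Finset V} (hC : ∀ i j, G.Adj i j → i ∈ C ∨ j ∈ C) :
    edgeIdeal K G ≤ coverPrime K C := by
  refine Ideal.span_le.2 ?_
  rintro _ ⟨i, j, hij, rfl⟩
  rcases hC i j hij with h | h
  · exact Ideal.mul_mem_right _ _ (X_mem_coverPrime_iff.2 h)
  · exact Ideal.mul_mem_left _ _ (X_mem_coverPrime_iff.2 h)

lemma coverPrime_le {C : Finset V} {P : Ideal (MvPolynomial V K)}
    (hC : ∀ k ∈ C, MvPolynomial.X k ∈ P) : coverPrime K C ≤ P := by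
  intro f hf
  rw [mem_coverPrime_iff] at hf
  rw [← MvPolynomial.support_sum_monomial_coeff f]
  refine Ideal.sum_mem _ fun m hm => ?_
  obtain ⟨k, hk, hmk⟩ := hf m hm
  have : (MvPolynomial.monomial m (f.coeff m)) =
      MvPolynomial.monomial (m - Finsupp.single k 1) (f.coeff m) * MvPolynomial.X k := by
    rw [MvPolynomial.X, MvPolynomial.monomial_mul, mul_one, tsub_add_cancel_of_le]
    rw [Finsupp.single_le_iff]
    omega
  rw [this]
  exact Ideal.mul_mem_left _ _ (hC k hk)

variable [Fintype V]

lemma card_filter_notMem (m : V →₀ ℕ) (M : Finset V) :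
    ((Finsupp.toMultiset m).filter (· ∉ M)).card = coverWeight Mᶜ m := by
  rw [coverWeight, ← Multiset.toFinset_sum_count_eq]
  have : ∀ k ∈ Mᶜ, m k = ((Finsupp.toMultiset m).filter (· ∉ M)).count k := by
    intro k hk
    rw [Multiset.count_filter, if_pos (Finset.mem_compl.1 hk), Finsupp.count_toMultiset]
  rw [Finset.sum_congr rfl this]
  refine Finset.sum_subset (fun k hk => ?_) fun k _ hk => ?_
  · rw [Multiset.mem_toFinset, Multiset.mem_filter] at hk
    exact Finset.mem_compl.2 hk.2
  · rwa [Multiset.mem_toFinset, ← Multiset.count_eq_zero] at hk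

open Classical in
/-- The vertices whose variables lie in `P`. -/
noncomputable def coverOf (P : Ideal (MvPolynomial V K)) : Finset V :=
  Finset.univ.filter fun k => MvPolynomial.X k ∈ P

lemma mem_coverOf {P : Ideal (MvPolynomial V K)} {k : V} :
    k ∈ coverOf P ↔ MvPolynomial.X k ∈ P := by
  simp [coverOf]

lemma coverOf_isCover {P : Ideal (MvPolynomial V K)} [hP : P.IsPrime] (h : edgeIdeal K G ≤ P)
    (i j : V) (hij : G.Adj i j) : i ∈ coverOf P ∨ j ∈ coverOf P := by
  rw [mem_coverOf, mem_coverOf]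
  exact hP.mem_or_mem (h (Ideal.subset_span ⟨i, j, hij, rfl⟩))

lemma eq_coverPrime_of_mem_minimalPrimes {P : Ideal (MvPolynomial V K)}
    (hP : P ∈ (edgeIdeal K G).minimalPrimes) : P = coverPrime K (coverOf P) := by
  have := hP.1.1
  have h1 : coverPrime K (coverOf P) ≤ P := coverPrime_le fun k hk => mem_coverOf.1 hk
  exact le_antisymm
    (hP.2 ⟨inferInstance, edgeIdeal_le_coverPrime (coverOf_isCover hP.1.2)⟩ h1) h1

/-- Otherwise `coverOf P` without `k` would still be a cover, and its prime would lie strictly below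
`P`. -/
lemma exists_adj_notMem_coverOf {P : Ideal (MvPolynomial V K)}
    (hP : P ∈ (edgeIdeal K G).minimalPrimes) {k : V} (hk : k ∈ coverOf P) :
    ∃ k', G.Adj k k' ∧ k' ∉ coverOf P := by
  have := hP.1.1
  by_contra! h
  have h1 : edgeIdeal K G ≤ coverPrime K ((coverOf P).erase k) := by
    refine edgeIdeal_le_coverPrime fun i j hij => ?_
    by_cases hi : i = k
    · subst hi
      exact Or.inr (Finset.mem_erase.2 ⟨hij.ne', h j hij⟩)
    by_cases hj : j = k
    · subst hj
      exact Or.inl (Finset.mem_erase.2 ⟨hij.ne, h i hij.symm⟩)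
    rcases coverOf_isCover hP.1.2 i j hij with h' | h'
    · exact Or.inl (Finset.mem_erase.2 ⟨hi, h'⟩)
    · exact Or.inr (Finset.mem_erase.2 ⟨hj, h'⟩)
  have h2 := hP.2 ⟨inferInstance, h1⟩
    (coverPrime_le fun k hk => mem_coverOf.1 (Finset.mem_of_mem_erase hk))
  exact Finset.notMem_erase k _ (X_mem_coverPrime_iff.1 (h2 (mem_coverOf.1 hk)))

lemma mem_localContraction_iff {S : Type*} [CommRing S] [IsDomain S] {P I : Ideal S}
    [hP : P.IsPrime] {f : S} : f ∈ localContraction P I ↔ ∃ u, u ∉ P ∧ u * f ∈ I := by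
  rw [localContraction, Ideal.mem_comap, IsLocalization.mem_map_algebraMap_iff P.primeCompl]
  constructor
  · rintro ⟨⟨g, u⟩, h⟩
    refine ⟨u, u.2, ?_⟩
    rw [← map_mul] at h
    have := IsLocalization.injective (Localization.AtPrime P)
      (P.primeCompl_le_nonZeroDivisors) h
    rw [mul_comm, this]
    exact g.2
  · rintro ⟨u, hu, h⟩
    exact ⟨(⟨u * f, h⟩, ⟨u, hu⟩), by rw [← map_mul, mul_comm]⟩

/-- Minimal primes are generated by the variables of vertex covers, that is, of complements of
independent sets. Locally at such a prime, membership in I^s means weight at least `s` on the cover;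
covers that are not minimal add no condition. -/
lemma isMonomialWith_symbolicPower (s : ℕ) : IsMonomialWith (symbolicPower (edgeIdeal K G) s)
    {m | SymAt G s (Finsupp.toMultiset m) ∅} := by
  intro f
  rw [symbolicPower]
  simp only [Submodule.mem_iInf]
  constructor
  · intro hf m hm M hM _
    have hI : edgeIdeal K G ≤ coverPrime K Mᶜ := by
      refine edgeIdeal_le_coverPrime fun i j hij => ?_
      by_contra! h
      simp only [Finset.mem_compl, not_not] at h
      exact hM i h.1 j h.2 hij
    obtain ⟨P, hP, hPM⟩ := Ideal.exists_minimalPrimes_le hI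
    have := hP.1.1
    obtain ⟨u, hu, huf⟩ := mem_localContraction_iff.1 (hf P hP)
    rw [card_filter_notMem]
    have h1 : coverWeight (coverOf P) m ≤ coverWeight Mᶜ m :=
      Finset.sum_le_sum_of_subset fun k hk => X_mem_coverPrime_iff.1 (hPM (mem_coverOf.1 hk))
    refine le_trans ?_ h1
    rw [eq_coverPrime_of_mem_minimalPrimes hP, coverPrime, Ideal.mem_comap,
      Ideal.mem_span_singleton] at hu
    -- The product u f lies in I^s and hence has order at least `s` in t, while u ∉ P has order
    -- zero, so the order is that of `f`.
    have h2 : gradeHom K (coverOf P) (u * f) ∈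
        (Ideal.span {(Polynomial.X : Polynomial (MvPolynomial V K))}) ^ s :=
      Ideal.mem_comap.1 (Ideal.le_comap_pow _ _ (Ideal.pow_right_mono
        (hP.1.2.trans (eq_coverPrime_of_mem_minimalPrimes hP).le) s huf))
    rw [Ideal.span_singleton_pow, Ideal.mem_span_singleton, map_mul] at h2
    exact (X_pow_dvd_gradeHom_iff _ f s).1
      (Polynomial.prime_X.pow_dvd_of_dvd_mul_left s hu h2) m hm
  · intro hf P hP
    have := hP.1.1
    rw [← MvPolynomial.support_sum_monomial_coeff f]
    refine Ideal.sum_mem _ fun m hm => mem_localContraction_iff.2 ?_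
    have hs := hf m hm (coverOf P)ᶜ (by
      intro x hx y hy hxy
      rw [Finset.mem_compl] at hx hy
      exact (coverOf_isCover hP.1.2 x y hxy).elim hx hy) (Finset.empty_subset _)
    rw [card_filter_notMem, compl_compl] at hs
    choose! p hp using fun k (hk : k ∈ coverOf P) => exists_adj_notMem_coverOf hP hk
    -- Each `k` in the cover is paired with a neighbour `p k` outside it: the multiplier is a unit
    -- at `P`, and it completes the cover part of x^m to a product of at least `s` edges.
    refine ⟨∏ k ∈ coverOf P, MvPolynomial.X (p k) ^ m k, fun h => ?_, ?_⟩
    · obtain ⟨k, hk, h⟩ := (Ideal.IsPrime.prod_mem_iff).1 h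
      exact (hp k hk).2 (mem_coverOf.2 (hP.1.1.mem_of_pow_mem _ h))
    · have key : ∏ k ∈ coverOf P, (MvPolynomial.X (p k) * MvPolynomial.X k : MvPolynomial V K) ^ m k ∈
          edgeIdeal K G ^ s := by
        refine Ideal.pow_le_pow_right hs ?_
        rw [coverWeight, ← Finset.prod_pow_eq_pow_sum]
        refine Ideal.prod_mem_prod fun k hk => Ideal.pow_mem_pow (Ideal.subset_span ?_) _
        exact ⟨p k, k, (hp k hk).1.symm, rfl⟩
      rw [MvPolynomial.monomial_eq, Finsupp.prod_fintype _ _ (fun _ => pow_zero _),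
        ← Finset.prod_mul_prod_compl (coverOf P)]
      simp only [mul_pow, Finset.prod_mul_distrib] at key
      convert Ideal.mul_mem_right (MvPolynomial.C (f.coeff m) *
        ∏ k ∈ (coverOf P)ᶜ, MvPolynomial.X k ^ m k) _ key using 1
      ring

/-- The positive part of an integral exponent, as a multiset. -/
noncomputable def posExp (a : V →₀ ℤ) : Multiset V :=
  Finsupp.toMultiset (a.mapRange Int.toNat rfl)

lemma count_posExp (a : V →₀ ℤ) (x : V) : (posExp a).count x = (a x).toNat := by
  simp [posExp]

/-- The negative support of an integral exponent. -/
def negSupport (a : V →₀ ℤ) : Finset V := Finset.univ.filter fun k => a k < 0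

lemma mem_negSupport {a : V →₀ ℤ} {k : V} : k ∈ negSupport a ↔ a k < 0 := by
  simp [negSupport]

lemma exists_nat_exponent (a : V →₀ ℤ) {F : Finset V} (hF : negSupport a ⊆ F) (t : ℕ) :
    ∃ (N : ℕ) (m : V →₀ ℕ), (∀ k, ((m k : ℕ) : ℤ) = a k + if k ∈ F then (N : ℤ) else 0) ∧
      ∀ k ∈ F, t ≤ m k := by
  -- Large enough for `a k + N` to be at least `t` for every `k`.
  let N := t + ∑ k, (a k).natAbs
  have hN : ∀ k, t + (a k).natAbs ≤ N := fun k => Nat.add_le_add_left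
    (Finset.single_le_sum (f := fun k => (a k).natAbs) (fun _ _ => Nat.zero_le _)
      (Finset.mem_univ k)) t
  have hm : ∀ k, (((a k + if k ∈ F then (N : ℤ) else 0).toNat : ℕ) : ℤ) =
      a k + if k ∈ F then (N : ℤ) else 0 := by
    intro k
    apply Int.toNat_of_nonneg
    split_ifs with h
    · have := hN k
      omega
    · have : ¬ a k < 0 := fun h' => h (hF (mem_negSupport.2 h'))
      omega
  refine ⟨N, Finsupp.equivFunOnFinite.symm fun k => (a k + if k ∈ F then (N : ℤ) else 0).toNat,
    hm, fun k hk => ?_⟩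
  have h1 := hm k
  have h2 := hN k
  rw [if_pos hk] at h1
  simp only [Finsupp.equivFunOnFinite_symm_apply_apply, if_pos hk]
  omega

lemma negSupport_subset {a : V →₀ ℤ} {F : Finset V} {N : ℕ} {m : V →₀ ℕ}
    (hm : ∀ k, ((m k : ℕ) : ℤ) = a k + if k ∈ F then (N : ℤ) else 0) : negSupport a ⊆ F := by
  intro k hk
  by_contra h
  have h1 := hm k
  rw [if_neg h] at h1
  have := mem_negSupport.1 hk
  omega

lemma mem_degreeFamily_pow_iff (s : ℕ) (a : V →₀ ℤ) (F : Finset V) :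
    F ∈ degreeFamily {m | PowAt G s (Finsupp.toMultiset m) ∅} a ↔
      negSupport a ⊆ F ∧ PowAt G s (posExp a) F := by
  constructor
  · rintro ⟨N, m, ⟨l, hl, hadj, hlm⟩, hm⟩
    refine ⟨negSupport_subset hm, l, hl, hadj, fun x hx => (hlm x (by simp)).trans ?_⟩
    have h1 := hm x
    rw [if_neg hx] at h1
    rw [Finsupp.count_toMultiset, count_posExp]
    omega
  · rintro ⟨hF, l, hl, hadj, hla⟩
    obtain ⟨N, m, hm, ht⟩ := exists_nat_exponent a hF (endpoints l).card
    refine ⟨N, m, ⟨l, hl, hadj, fun x _ => ?_⟩, hm⟩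
    rw [Finsupp.count_toMultiset]
    by_cases hx : x ∈ F
    · exact (Multiset.count_le_card _ _).trans (ht x hx)
    · have h1 := hm x
      have h2 := hla x hx
      rw [if_neg hx] at h1
      rw [count_posExp] at h2
      omega

/-- After multiplication by a high power of x_F, a cover that meets `F` has weight at least `s`
automatically, so only the covers disjoint from `F` remain. -/
lemma mem_degreeFamily_sym_iff (s : ℕ) (a : V →₀ ℤ) (F : Finset V) :
    F ∈ degreeFamily {m | SymAt G s (Finsupp.toMultiset m) ∅} a ↔
      negSupport a ⊆ F ∧ SymAt G s (posExp a) F := by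
  have key : ∀ (N : ℕ) (m : V →₀ ℕ) (M : Finset V), F ⊆ M →
      (∀ k, ((m k : ℕ) : ℤ) = a k + if k ∈ F then (N : ℤ) else 0) →
      (Finsupp.toMultiset m).filter (· ∉ M) = (posExp a).filter (· ∉ M) := by
    intro N m M hFM hm
    ext x
    rw [Multiset.count_filter, Multiset.count_filter]
    by_cases hx : x ∈ M
    · rw [if_neg (not_not.2 hx), if_neg (not_not.2 hx)]
    · have h1 := hm x
      rw [if_neg fun h => hx (hFM h)] at h1
      rw [if_pos hx, if_pos hx, Finsupp.count_toMultiset, count_posExp]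
      omega
  constructor
  · rintro ⟨N, m, hm', hm⟩
    refine ⟨negSupport_subset hm, fun M hM hFM => ?_⟩
    rw [← key N m M hFM hm]
    exact hm' M hM (Finset.empty_subset _)
  · rintro ⟨hF, h⟩
    obtain ⟨N, m, hm, ht⟩ := exists_nat_exponent a hF s
    refine ⟨N, m, fun M hM _ => ?_, hm⟩
    by_cases hFM : F ⊆ M
    · rw [key N m M hFM hm]
      exact h M hM hFM
    · obtain ⟨f, hf, hfM⟩ := Finset.not_subset.1 hFM
      refine (ht f hf).trans ?_
      refine le_trans ?_ (Multiset.count_le_card f _)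
      rw [Multiset.count_filter, if_pos hfM, Finsupp.count_toMultiset]

end EdgeIdeal

/-! ### Regularity of monomial ideals -/

section Regularity

variable {K V : Type*} [Field K] [Fintype V] [LinearOrder V]

/-- The monomial ideal `J` is described by the predicate `R`: the monomial `x ^ a x_F ^ N` lies
in `J` for large `N` if and only if `R a F`. -/
structure IsDescribedBy (J : Ideal (MvPolynomial V K)) (R : Multiset V → Finset V → Prop) :
    Prop where
  exists_exponents : ∃ M, IsMonomialWith J M ∧
    ∀ a F, F ∈ degreeFamily M a ↔ negSupport a ⊆ F ∧ R (posExp a) F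

lemma isDescribedBy_edgeIdeal_pow (G : SimpleGraph V) (s : ℕ) :
    IsDescribedBy (edgeIdeal K G ^ s) (PowAt G s) :=
  ⟨_, isMonomialWith_edgeIdeal_pow s, mem_degreeFamily_pow_iff s⟩

lemma isDescribedBy_symbolicPower (G : SimpleGraph V) (s : ℕ) :
    IsDescribedBy (symbolicPower (edgeIdeal K G) s) (SymAt G s) :=
  ⟨_, isMonomialWith_symbolicPower s, mem_degreeFamily_sym_iff s⟩

/-- `z ≤ reg J`. -/
def LERegularity (z : ℤ) (J : Ideal (MvPolynomial V K)) : Prop :=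
  ((z : WithTop ℤ) : WithBot (WithTop ℤ)) ≤ regularity J

lemma LERegularity.mono {y z : ℤ} {J : Ideal (MvPolynomial V K)} (h : LERegularity z J)
    (hyz : y ≤ z) : LERegularity y J :=
  le_trans (WithBot.coe_le_coe.2 (WithTop.coe_le_coe.2 hyz)) h

/-- The exponent with positive part `a` and value `-1` on `A`. -/
noncomputable def signedExp (a : Multiset V) (A : Finset V) : V →₀ ℤ :=
  Finsupp.equivFunOnFinite.symm fun k => (a.count k : ℤ) - if k ∈ A then 1 else 0

lemma signedExp_apply (a : Multiset V) (A : Finset V) (k : V) :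
    signedExp a A k = (a.count k : ℤ) - if k ∈ A then 1 else 0 := rfl

lemma sum_signedExp (a : Multiset V) (A : Finset V) :
    ∑ k, signedExp a A k = (a.card : ℤ) - A.card := by
  simp only [signedExp_apply, Finset.sum_sub_distrib]
  rw [← Nat.cast_sum, Multiset.sum_count_eq_card (fun _ _ => Finset.mem_univ _)]
  simp

lemma negSupport_signedExp {a : Multiset V} {A : Finset V} (h : ∀ x ∈ a, x ∉ A) :
    negSupport (signedExp a A) = A := by
  ext k
  rw [mem_negSupport, signedExp_apply]
  split_ifs with hk
  · have : a.count k = 0 := Multiset.count_eq_zero.2 fun h' => h k h' hk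
    simp [this, hk]
  · simp [hk]

lemma posExp_signedExp {a : Multiset V} {A : Finset V} (h : ∀ x ∈ a, x ∉ A) :
    posExp (signedExp a A) = a := by
  ext k
  rw [count_posExp, signedExp_apply]
  split_ifs with hk
  · have : a.count k = 0 := Multiset.count_eq_zero.2 fun h' => h k h' hk
    simp [this]
  · simp

variable {J : Ideal (MvPolynomial V K)} {R : Multiset V → Finset V → Prop}

lemma IsDescribedBy.upward (hJ : IsDescribedBy J R) {a : Multiset V} {E F : Finset V}
    (hEF : E ⊆ F) (h : R a E) : R a F := by
  obtain ⟨M, hM, hMR⟩ := hJ.exists_exponents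
  have h0 : posExp (signedExp a ∅) = a := posExp_signedExp (by simp)
  have h1 : negSupport (signedExp a ∅) = ∅ := negSupport_signedExp (by simp)
  have := degreeFamily_mono hM hEF ((hMR (signedExp a ∅) E).2 ⟨by simp [h1], by rwa [h0]⟩)
  rw [hMR, h0] at this
  exact this.2

lemma ordConnected_of_upward {R : Finset V → Prop} (hR : ∀ E F, E ⊆ F → R E → R F)
    (A W : Finset V) : {F | A ⊆ F ∧ F ⊆ W ∧ R F}.OrdConnected :=
  ⟨fun _ hx _ hy _ hz => ⟨hx.1.trans hz.1, hz.2.trans hy.2.1, hR _ _ hz.1 hx.2.2⟩⟩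

lemma IsDescribedBy.le_regularity_of_univ (hJ : IsDescribedBy J R) {a : Multiset V}
    {A : Finset V} {i : ℕ} (haA : ∀ x ∈ a, x ∉ A)
    (h : ¬ AcyclicAt K {F | A ⊆ F ∧ R a F} i) :
    LERegularity ((a.card : ℤ) - A.card + i) J := by
  obtain ⟨M, hM, hMR⟩ := hJ.exists_exponents
  refine le_sSup ⟨i, a.card - A.card, ?_, rfl⟩
  refine (nontrivial_localCohomologyDegree_iff hM i _).2
    ⟨signedExp a A, sum_signedExp a A, fun h' => h (h'.congr fun F => ?_)⟩
  rw [hMR, negSupport_signedExp haA, posExp_signedExp haA]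
  rfl

/-- Nonvanishing cohomology of a restricted link of a degree complex bounds the regularity
from below. -/
lemma IsDescribedBy.le_regularity (hJ : IsDescribedBy J R) {a : Multiset V} {W A : Finset V}
    {i : ℕ} (haA : ∀ x ∈ a, x ∉ A) (haW : ∀ x ∈ a, x ∈ W)
    (h : ¬ AcyclicAt K {F | A ⊆ F ∧ F ⊆ W ∧ R a F} i) :
    LERegularity ((a.card : ℤ) - A.card + i) J := by
  induction hn : Wᶜ.card generalizing W A i with
  | zero =>
    rw [Finset.card_eq_zero, Finset.compl_eq_empty_iff] at hn
    subst hn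
    exact hJ.le_regularity_of_univ haA fun h' => h (h'.congr fun F => by simp)
  | succ n ih =>
    obtain ⟨v, hv⟩ := Finset.card_pos.1 (by omega : 0 < Wᶜ.card)
    have hvW := Finset.mem_compl.1 hv
    have hcard : (insert v W)ᶜ.card = n := by
      rw [Finset.compl_insert, Finset.card_erase_of_mem hv, hn]
      rfl
    have hva : ∀ x ∈ a, x ≠ v := fun x hx hxv => hvW (hxv ▸ haW x hx)
    by_cases hvA : v ∈ A
    · refine absurd ?_ h
      rw [show {F | A ⊆ F ∧ F ⊆ W ∧ R a F} = ∅ from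
        Set.eq_empty_of_forall_notMem fun F hF => hvW (hF.2.1 (hF.1 hvA))]
      exact fun c _ _ => ⟨0, by simp, by simp⟩
    -- The sets inside `insert v W` that contain `v` form an upward closed subfamily whose
    -- difference is the family on `W`. So cohomology survives either on `insert v W` in degree `i`,
    -- or with `v` added to `A` in degree `i + 1`; in both cases `-A.card + i` is unchanged.
    by_cases h1 : AcyclicAt K {F | A ⊆ F ∧ F ⊆ insert v W ∧ R a F} i
    · by_cases h2 : AcyclicAt K {F | insert v A ⊆ F ∧ F ⊆ insert v W ∧ R a F} (i + 1)
      · refine absurd ?_ h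
        refine (AcyclicAt.sdiff (ordConnected_of_upward (fun _ _ => hJ.upward) _ _) ?_ ?_
          h1 h2).congr fun F => ?_
        · exact fun F hF => ⟨(Finset.subset_insert _ _).trans hF.1, hF.2⟩
        · exact fun E hE F hF hEF => ⟨hE.1.trans hEF, hF.2⟩
        · constructor
          · rintro ⟨⟨hA, hW, hR⟩, hn⟩
            refine ⟨hA, (Finset.subset_insert_iff_of_notMem fun hvF => ?_).1 hW, hR⟩
            exact hn ⟨Finset.insert_subset hvF hA, hW, hR⟩
          · rintro ⟨hA, hW, hR⟩
            exact ⟨⟨hA, hW.trans (Finset.subset_insert _ _), hR⟩,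
              fun h => hvW (hW (h.1 (Finset.mem_insert_self _ _)))⟩
      · have := ih (A := insert v A) (fun x hx => by simp [hva x hx, haA x hx])
          (fun x hx => Finset.mem_insert_of_mem (haW x hx)) h2 hcard
        refine this.mono ?_
        rw [Finset.card_insert_of_notMem hvA]
        push_cast
        omega
    · exact ih haA (fun x hx => Finset.mem_insert_of_mem (haW x hx)) h1 hcard

/-- Raising all negative entries of an exponent to -1 keeps the family and does not lower the
degree, so signed exponents suffice. -/
lemma IsDescribedBy.regularity_le {J' : Ideal (MvPolynomial V K)} (hJ : IsDescribedBy J R)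
    (h : ∀ (a : Multiset V) (A : Finset V) (i : ℕ), (∀ x ∈ a, x ∉ A) →
      ¬ AcyclicAt K {F | A ⊆ F ∧ R a F} i → LERegularity ((a.card : ℤ) - A.card + i) J') :
    regularity J ≤ regularity J' := by
  obtain ⟨M, hM, hMR⟩ := hJ.exists_exponents
  refine sSup_le ?_
  rintro _ ⟨i, j, hij, rfl⟩
  obtain ⟨b, hb, hac⟩ := (nontrivial_localCohomologyDegree_iff hM i j).1 hij
  have hdisj : ∀ x ∈ posExp b, x ∉ negSupport b := by
    intro x hx hx'
    have h1 := Multiset.count_pos.2 hx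
    rw [count_posExp] at h1
    rw [mem_negSupport] at hx'
    omega
  refine (h (posExp b) (negSupport b) i hdisj fun h' => hac (h'.congr fun F =>
    (hMR b F).symm)).mono ?_
  rw [← hb, ← sum_signedExp]
  refine add_le_add_left (Finset.sum_le_sum fun k _ => ?_) _
  rw [signedExp_apply, count_posExp]
  simp only [mem_negSupport]
  split_ifs <;> omega

/-- Comparison of the regularities of two monomial ideals, in terms of the differences of their
degree complexes. -/
theorem regularity_eq_of_difference {J' : Ideal (MvPolynomial V K)}
    {R' : Multiset V → Finset V → Prop} (hJ : IsDescribedBy J R) (hJ' : IsDescribedBy J' R')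
    (hRR' : ∀ a F, R a F → R' a F) (h0 : ¬ R' 0 ∅)
    (h : ∀ (a : Multiset V) (A : Finset V) (i : ℕ), (∀ x ∈ a, x ∉ A) →
      ¬ AcyclicAt K {F | A ⊆ F ∧ R' a F ∧ ¬ R a F} i →
        (¬ R' a ∅ → LERegularity ((a.card : ℤ) - A.card + i) J) ∧
          LERegularity ((a.card : ℤ) - A.card + i + 1) J') :
    regularity J' = regularity J := by
  have hord : ∀ a A, {F | A ⊆ F ∧ R' a F}.OrdConnected := fun a A =>
    ⟨fun _ hx _ hy _ hz => ⟨hx.1.trans hz.1, hJ'.upward hz.1 hx.2⟩⟩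
  have hsub : ∀ a A, {F | A ⊆ F ∧ R a F} ⊆ {F | A ⊆ F ∧ R' a F} :=
    fun a A F hF => ⟨hF.1, hRR' _ _ hF.2⟩
  have hup : ∀ a A, ∀ E ∈ {F | A ⊆ F ∧ R a F}, ∀ F ∈ {F | A ⊆ F ∧ R' a F}, E ⊆ F →
      F ∈ {F | A ⊆ F ∧ R a F} :=
    fun a A E hE F hF hEF => ⟨hF.1, hJ.upward hEF hE.2⟩
  have hdiff : ∀ a A F, F ∈ {F | A ⊆ F ∧ R' a F} \ {F | A ⊆ F ∧ R a F} ↔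
      F ∈ {F | A ⊆ F ∧ R' a F ∧ ¬ R a F} := by
    intro a A F
    simp only [Set.mem_sdiff, Set.mem_ofPred_eq]
    tauto
  refine le_antisymm (hJ'.regularity_le fun a A i haA hac => ?_)
    (hJ.regularity_le fun a A i haA hac => ?_)
  · by_cases ha : R' a ∅
    · obtain ⟨x, hx⟩ := Multiset.exists_mem_of_ne_zero (fun h => h0 (h ▸ ha) : a ≠ 0)
      -- When `R' a ∅` holds, the family consists of all sets containing `A`, a cone over any vertex
      -- outside `A`; `a` supplies one because it is nonzero.
      refine absurd (AcyclicAt.of_cone (𝓕 := {F | A ⊆ F ∧ R' a F}) (q := x) (fun F hF => ⟨⟨?_, ?_⟩, ?_, ?_⟩) i) hac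
      · exact hF.1.trans (Finset.subset_insert _ _)
      · exact hJ'.upward (Finset.empty_subset _) ha
      · exact fun y hy => Finset.mem_erase.2 ⟨fun h => haA x hx (h ▸ hy), hF.1 hy⟩
      · exact hJ'.upward (Finset.empty_subset _) ha
    by_cases h1 : AcyclicAt K {F | A ⊆ F ∧ R a F} i
    · refine (h a A i haA fun h2 => hac ?_).1 ha
      exact AcyclicAt.of_sdiff (hord a A) (hsub a A) (hup a A)
        (h2.congr fun F => (hdiff a A F).symm) h1
    · exact hJ.le_regularity_of_univ haA h1
  · by_cases h1 : AcyclicAt K {F | A ⊆ F ∧ R' a F} i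
    · by_cases h2 : ∀ j, j + 1 = i → AcyclicAt K {F | A ⊆ F ∧ R' a F ∧ ¬ R a F} j
      · refine absurd ?_ hac
        exact AcyclicAt.of_sdiff_prev (hord a A) (hsub a A) (hup a A) h1
          fun j hj => (h2 j hj).congr fun F => (hdiff a A F).symm
      · push Not at h2
        obtain ⟨j, rfl, hj⟩ := h2
        exact (h a A j haA hj).2.mono (by push_cast; omega)
    · exact hJ'.le_regularity_of_univ haA h1

end Regularity

/-! ### Matchings and covers in weighted graphs -/

section Combinatorics

variable {V : Type*} [LinearOrder V] {G : SimpleGraph V}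

lemma PowAt.mono {s : ℕ} {a b : Multiset V} {E F : Finset V} (h : PowAt G s a E) (hab : a ≤ b)
    (hEF : E ⊆ F) : PowAt G s b F := by
  obtain ⟨l, hl, hadj, hle⟩ := h
  exact ⟨l, hl, hadj, fun x hx => (hle x fun h => hx (hEF h)).trans (Multiset.count_le_of_le x hab)⟩

lemma PowAt.zero (a : Multiset V) (F : Finset V) : PowAt G 0 a F :=
  ⟨[], rfl, by simp, by simp [endpoints]⟩

lemma PowAt.edge {s : ℕ} {a : Multiset V} {F : Finset V} {p q : V} (hpq : G.Adj p q)
    (h : PowAt G s a F) : PowAt G (s + 1) ({p} + {q} + a) F := by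
  obtain ⟨l, hl, hadj, hle⟩ := h
  refine ⟨(p, q) :: l, by simp [hl], by simpa [hpq] using hadj, fun x hx => ?_⟩
  rw [endpoints_cons, Multiset.count_add, Multiset.count_add]
  exact Nat.add_le_add le_rfl (hle x hx)

lemma PowAt.half {s : ℕ} {a : Multiset V} {F : Finset V} {p f : V} (hpf : G.Adj p f)
    (hf : f ∈ F) (h : PowAt G s a F) : PowAt G (s + 1) ({p} + a) F := by
  obtain ⟨l, hl, hadj, hle⟩ := h
  refine ⟨(p, f) :: l, by simp [hl], by simpa [hpf] using hadj, fun x hx => ?_⟩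
  have hxf : x ≠ f := fun h => hx (h ▸ hf)
  have := hle x hx
  rw [endpoints_cons, Multiset.count_add, Multiset.count_add]
  simp [Multiset.insert_eq_cons, Multiset.count_cons, Multiset.count_singleton, hxf]
  exact this

lemma PowAt.of_adj_mem {a : Multiset V} {F : Finset V} {f g : V} (hfg : G.Adj f g)
    (hf : f ∈ F) (hg : g ∈ F) (s : ℕ) : PowAt G s a F := by
  refine ⟨List.replicate s (f, g), by simp, fun e he => ?_, fun x hx => ?_⟩
  · rw [List.eq_of_mem_replicate he]
    exact hfg
  · have hxf : x ≠ f := fun h => hx (h ▸ hf)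
    have hxg : x ≠ g := fun h => hx (h ▸ hg)
    simp [endpoints, hxf, hxg]

lemma PowAt.anti {s t : ℕ} {a : Multiset V} {F : Finset V} (h : PowAt G s a F) (hts : t ≤ s) :
    PowAt G t a F := by
  obtain ⟨l, hl, hadj, hle⟩ := h
  refine ⟨l.take t, by simp [hl, hts], fun e he => hadj e (List.mem_of_mem_take he),
    fun x hx => le_trans ?_ (hle x hx)⟩
  conv_rhs => rw [← List.take_append_drop t l]
  rw [endpoints, endpoints, List.map_append, List.sum_append, Multiset.count_add]
  exact Nat.le_add_right _ _

lemma indep_of_not_powAt {s : ℕ} {a : Multiset V} {F : Finset V} (h : ¬ PowAt G s a F) :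
    Indep G F :=
  fun _ hx _ hy hxy => h (PowAt.of_adj_mem hxy hx hy s)

lemma mem_endpoints {l : List (V × V)} {x : V} :
    x ∈ endpoints l ↔ ∃ e ∈ l, x = e.1 ∨ x = e.2 := by
  induction l with
  | nil => simp [endpoints]
  | cons e l ih =>
    rw [endpoints_cons, Multiset.mem_add, ih]
    simp

lemma mem_or_mem_of_count_le {l : List (V × V)} {a : Multiset V} {F : Finset V}
    (h : ∀ x, x ∉ F → (endpoints l).count x ≤ a.count x) {x : V} (hx : x ∈ endpoints l) :
    x ∈ a ∨ x ∈ F := by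
  by_cases hxF : x ∈ F
  · exact Or.inr hxF
  · exact Or.inl (Multiset.count_pos.1 ((Multiset.count_pos.2 hx).trans_le (h x hxF)))

/-- A weight that is at least `c` on edges bounds the number of edges from above. -/
lemma PowAt.le_sum_weight {s c : ℕ} {a : Multiset V} {F : Finset V} (h : PowAt G s a F)
    (w : V → ℕ) (hF : ∀ f ∈ F, w f = 0)
    (hw : ∀ p q, G.Adj p q → (p ∈ a ∨ p ∈ F) → (q ∈ a ∨ q ∈ F) → c ≤ w p + w q) :
    c * s ≤ (a.map w).sum := by
  obtain ⟨l, rfl, hadj, hle⟩ := h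
  have h1 : c * l.length ≤ ((endpoints l).map w).sum := by
    have hl : ∀ e ∈ l, c ≤ w e.1 + w e.2 := fun e he => hw _ _ (hadj e he)
      (mem_or_mem_of_count_le hle (mem_endpoints.2 ⟨e, he, Or.inl rfl⟩))
      (mem_or_mem_of_count_le hle (mem_endpoints.2 ⟨e, he, Or.inr rfl⟩))
    clear hle hadj
    induction l with
    | nil => simp
    | cons e l ih =>
      rw [endpoints_cons, Multiset.map_add, Multiset.sum_add, List.length_cons]
      have h2 := ih fun e he => hl e (by simp [he])
      have h3 := hl e (by simp)
      have h4 : ((({e.1, e.2} : Multiset V)).map w).sum = w e.1 + w e.2 := by simp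
      rw [h4, mul_add, mul_one]
      omega
  have h2 : (endpoints l).filter (· ∉ F) ≤ a := by
    rw [Multiset.le_iff_count]
    intro x
    rw [Multiset.count_filter]
    split_ifs with hx
    · exact Nat.zero_le _
    · exact hle x hx
  have h3 : (((endpoints l).filter (¬ · ∉ F)).map w).sum = 0 := by
    apply Multiset.sum_eq_zero
    intro n hn
    obtain ⟨x, hx, rfl⟩ := Multiset.mem_map.1 hn
    exact hF x (not_not.1 (Multiset.mem_filter.1 hx).2)
  have h4 := congrArg (fun m => (Multiset.map w m).sum)
    (Multiset.filter_add_not (· ∉ F) (endpoints l))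
  simp only [Multiset.map_add, Multiset.sum_add] at h4
  obtain ⟨d, hd⟩ := Multiset.le_iff_exists_add.1 h2
  rw [hd, Multiset.map_add, Multiset.sum_add]
  omega

lemma card_filter_eq_sum (a : Multiset V) (M : Finset V) :
    (a.filter (· ∉ M)).card = (a.map fun x => if x ∈ M then 0 else 1).sum := by
  induction a using Multiset.induction_on with
  | empty => simp
  | cons x a ih =>
    rw [Multiset.filter_cons, Multiset.card_add, ih, Multiset.map_cons, Multiset.sum_cons]
    by_cases hx : x ∈ M <;> simp [hx]

/-- Weak duality of packing and covering: each of the `s` edges has an end outside the independent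
set `M`. -/
lemma PowAt.symAt {s : ℕ} {a : Multiset V} {F : Finset V} (h : PowAt G s a F) :
    SymAt G s a F := by
  intro M hM hFM
  rw [card_filter_eq_sum, ← one_mul s]
  refine h.le_sum_weight _ (fun f hf => if_pos (hFM hf)) fun p q hpq _ _ => ?_
  by_cases hp : p ∈ M
  · by_cases hq : q ∈ M
    · exact absurd hpq (hM p hp q hq)
    · simp [hq]
  · simp [hp]

/-- A vertex `q` outside the closed neighbourhood of `F` whose multiplicity is at least that of
its neighbourhood can be added to `F`. -/
lemma PowAt.of_insert [DecidableRel G.Adj] {s : ℕ} {a : Multiset V} {F : Finset V} {q : V}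
    (h : PowAt G s a (insert q F)) (hF : ∀ f ∈ F, ¬ G.Adj q f)
    (hq : (a.filter (G.Adj q)).card ≤ a.count q) : PowAt G s a F := by
  obtain ⟨l, hl, hadj, hle⟩ := h
  refine ⟨l, hl, hadj, fun x hx => ?_⟩
  by_cases hxq : x = q
  · subst hxq
    -- Every edge of `l` that uses the vertex consumes a neighbour of it, and the neighbours all
    -- come from `a`.
    have h1 : (endpoints l).count x ≤ ((endpoints l).filter (G.Adj x)).card := by
      clear hle hl
      induction l with
      | nil => simp [endpoints]
      | cons e l ih =>
        have h2 := ih fun e he => hadj e (by simp [he])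
        have h3 := hadj e (by simp)
        rw [endpoints_cons, Multiset.count_add, Multiset.filter_add, Multiset.card_add]
        refine Nat.add_le_add ?_ h2
        obtain ⟨p, q⟩ := e
        simp only at h3
        by_cases hp : x = p
        · subst hp
          simp [Multiset.insert_eq_cons, Multiset.filter_singleton, h3, h3.ne]
        · by_cases hq : x = q
          · subst hq
            simp [Multiset.insert_eq_cons, Multiset.filter_singleton, h3.symm, hp]
          · simp [Multiset.insert_eq_cons, hp, hq]
    refine h1.trans (le_trans (Multiset.card_le_card ?_) hq)
    rw [Multiset.le_iff_count]
    intro y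
    rw [Multiset.count_filter, Multiset.count_filter]
    split_ifs with hy
    · refine hle y fun h => ?_
      rcases Finset.mem_insert.1 h with rfl | h
      · exact hy.ne rfl
      · exact hF y h hy
    · exact le_rfl
  · exact hle x (by simp [hxq, hx])

/-- Edges of a graph that splits into `T` and a part far from `T`. -/
lemma PowAt.of_add_of_card_le {s : ℕ} {T c : Multiset V} {F : Finset V}
    (h : PowAt G (s + 1) (T + c) F) (hT : T.card ≤ 3)
    (hTc : ∀ t ∈ T, ∀ x ∈ c, t ≠ x ∧ ¬ G.Adj t x) (hTF : ∀ t ∈ T, ∀ x ∈ F, t ≠ x ∧ ¬ G.Adj t x) :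
    PowAt G s c F := by
  classical
  obtain ⟨l, hl, hadj, hle⟩ := h
  have hmem : ∀ x ∈ endpoints l, x ∈ T ∨ x ∈ c ∨ x ∈ F := by
    intro x hx
    have := mem_or_mem_of_count_le hle hx
    rw [Multiset.mem_add] at this
    tauto
  have hsplit : ∀ e ∈ l, e.1 ∈ T ↔ e.2 ∈ T := by
    intro e he
    have h1 := hmem _ (mem_endpoints.2 ⟨e, he, Or.inl rfl⟩)
    have h2 := hmem _ (mem_endpoints.2 ⟨e, he, Or.inr rfl⟩)
    constructor
    · intro h
      rcases h2 with h2 | h2 | h2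
      · exact h2
      · exact absurd (hadj e he) (hTc _ h _ h2).2
      · exact absurd (hadj e he) (hTF _ h _ h2).2
    · intro h
      rcases h1 with h1 | h1 | h1
      · exact h1
      · exact absurd (hadj e he).symm (hTc _ h _ h1).2
      · exact absurd (hadj e he).symm (hTF _ h _ h1).2
  have hcount : ∀ (p : V × V → Bool) x, (endpoints (l.filter p)).count x ≤ (endpoints l).count x := by
    intro p x
    clear hle hadj hmem hsplit hl
    induction l with
    | nil => simp
    | cons e l ih =>
      rw [List.filter_cons]
      split_ifs
      · rw [endpoints_cons, endpoints_cons, Multiset.count_add, Multiset.count_add]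
        omega
      · rw [endpoints_cons, Multiset.count_add]
        omega
  have h1 : endpoints (l.filter fun e => decide (e.1 ∈ T)) ≤ T := by
    rw [Multiset.le_iff_count]
    intro x
    by_cases hx : x ∈ T
    · refine (hcount _ x).trans ((hle x fun h => (hTF x hx x h).1 rfl).trans ?_)
      rw [Multiset.count_add, Multiset.count_eq_zero.2 fun h => (hTc x hx x h).1 rfl, add_zero]
    · refine (Multiset.count_eq_zero.2 fun h => hx ?_).le.trans (Nat.zero_le _)
      obtain ⟨e, he, h⟩ := mem_endpoints.1 h
      rw [List.mem_filter, decide_eq_true_iff] at he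
      rcases h with rfl | rfl
      · exact he.2
      · exact (hsplit e he.1).1 he.2
  have h2 := Multiset.card_le_card h1
  rw [card_endpoints] at h2
  have h3 : (l.filter fun e => decide (e.1 ∈ T)).length +
      (l.filter fun e => !decide (e.1 ∈ T)).length = l.length :=
    (List.length_eq_length_filter_add _).symm
  refine PowAt.anti (s := (l.filter fun e => !decide (e.1 ∈ T)).length)
    ⟨_, rfl, fun e he => hadj e (List.mem_of_mem_filter he), fun x hx => ?_⟩ (by omega)
  by_cases hxT : x ∈ T
  · refine (Multiset.count_eq_zero.2 fun h => ?_).le.trans (Nat.zero_le _)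
    obtain ⟨e, he, h⟩ := mem_endpoints.1 h
    rw [List.mem_filter] at he
    have he2 : e.1 ∉ T := by simpa using he.2
    rcases h with rfl | rfl
    · exact he2 hxT
    · exact he2 ((hsplit e he.1).2 hxT)
  · refine (hcount _ x).trans ((hle x hx).trans ?_)
    rw [Multiset.count_add, Multiset.count_eq_zero.2 hxT, zero_add]

lemma SymAt.mono {s : ℕ} {a b : Multiset V} {E F : Finset V} (h : SymAt G s a E) (hab : a ≤ b)
    (hEF : E ⊆ F) : SymAt G s b F :=
  fun M hM hFM => (h M hM (hEF.trans hFM)).trans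
    (Multiset.card_le_card (Multiset.filter_le_filter _ hab))

lemma SymAt.anti {s t : ℕ} {a : Multiset V} {F : Finset V} (h : SymAt G s a F) (hts : t ≤ s) :
    SymAt G t a F :=
  fun M hM hFM => hts.trans (h M hM hFM)

lemma SymAt.add {s t : ℕ} {a b : Multiset V} {F : Finset V} (ha : SymAt G s a F)
    (hb : SymAt G t b F) : SymAt G (s + t) (a + b) F := by
  intro M hM hFM
  rw [Multiset.filter_add, Multiset.card_add]
  exact Nat.add_le_add (ha M hM hFM) (hb M hM hFM)

lemma symAt_edge {u v : V} (h : G.Adj u v) (F : Finset V) : SymAt G 1 ({u} + {v}) F := by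
  simpa using (PowAt.edge h (PowAt.zero 0 F)).symAt

lemma symAt_half {u f : V} {F : Finset V} (h : G.Adj u f) (hf : f ∈ F) : SymAt G 1 {u} F := by
  simpa using (PowAt.half h hf (PowAt.zero 0 F)).symAt

lemma symAt_triangle {x y z : V} (hxy : G.Adj x y) (hyz : G.Adj y z) (hxz : G.Adj x z)
    (F : Finset V) : SymAt G 2 ({x} + {y} + {z}) F := by
  intro M hM _
  rw [card_filter_eq_sum]
  simp only [Multiset.map_add, Multiset.map_singleton, Multiset.sum_add, Multiset.sum_singleton]
  by_cases hx : x ∈ M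
  · have hy : y ∉ M := fun h => hM x hx y h hxy
    have hz : z ∉ M := fun h => hM x hx z h hxz
    simp [hx, hy, hz]
  · by_cases hy : y ∈ M
    · have hz : z ∉ M := fun h => hM y hy z h hyz
      simp [hx, hy, hz]
    · simp [hx, hy]

lemma symAt_completeFour {x y z u : V} (hxy : G.Adj x y) (hyz : G.Adj y z) (hxz : G.Adj x z)
    (hxu : G.Adj x u) (hyu : G.Adj y u) (hzu : G.Adj z u) (F : Finset V) :
    SymAt G 3 ({x} + {y} + {z} + {u}) F := by
  intro M hM hF
  by_cases hu : u ∈ M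
  · have hx : x ∉ M := fun h => hM x h u hu hxu
    have hy : y ∉ M := fun h => hM y h u hu hyu
    have hz : z ∉ M := fun h => hM z h u hu hzu
    rw [card_filter_eq_sum]
    simp [hx, hy, hz, hu]
  · have := symAt_triangle hxy hyz hxz F M hM hF
    rw [Multiset.filter_add, Multiset.card_add]
    simp only [Multiset.filter_singleton, hu, not_false_eq_true, if_true, Multiset.card_singleton]
    omega

lemma symAt_fiveCycle {x y z u v : V} (hxy : G.Adj x y) (hyz : G.Adj y z) (hzu : G.Adj z u)
    (huv : G.Adj u v) (hvx : G.Adj v x) (F : Finset V) :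
    SymAt G 3 ({x} + {y} + {z} + {u} + {v}) F := by
  intro M hM hF
  by_cases hx : x ∈ M
  · have hy : y ∉ M := hM x hx y |>.mt (not_not.2 hxy)
    have hv : v ∉ M := fun h => hM v h x hx hvx
    have := symAt_edge hzu F M hM hF
    rw [card_filter_eq_sum] at this ⊢
    simp [hy, hv, hx] at this ⊢
    omega
  · have h1 := symAt_edge hyz F M hM hF
    have h2 := symAt_edge huv F M hM hF
    rw [card_filter_eq_sum] at h1 h2 ⊢
    simp [hx] at h1 h2 ⊢
    omega

/-- If the weight outside the support of `b` is too small, then that support contains an edge. -/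
lemma SymAt.exists_adj {s : ℕ} {m d b : Multiset V} (h : SymAt G s m ∅) (hm : m = d + b)
    (hd : d.card < s) : ∃ x ∈ b, ∃ y ∈ b, G.Adj x y := by
  by_contra! hb
  have := h b.toFinset (fun x hx y hy => hb x (Multiset.mem_toFinset.1 hx) y
    (Multiset.mem_toFinset.1 hy)) (Finset.empty_subset _)
  have h2 : b.filter (· ∉ b.toFinset) = 0 := by
    rw [Multiset.filter_eq_nil]
    simp
  rw [hm, Multiset.filter_add, h2, add_zero] at this
  have h3 := Multiset.card_le_card (Multiset.filter_le (· ∉ b.toFinset) d)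
  omega

lemma singleton_add_singleton_le {a : Multiset V} {x y : V} (hx : x ∈ a) (hy : y ∈ a)
    (hxy : x ≠ y) : {x} + {y} ≤ a := by
  rw [Multiset.singleton_add, Multiset.cons_le_of_notMem (by simpa using hxy)]
  simpa using ⟨hx, hy⟩

lemma PowAt.of_le {s : ℕ} {a b : Multiset V} {F : Finset V} (h : PowAt G s a F) (hab : a ≤ b) :
    PowAt G s b F := h.mono hab subset_rfl

end Combinatorics

/-! ### The structure of symbolic powers of small order -/

section Structure

variable {V : Type*} [LinearOrder V] {G : SimpleGraph V}

/-- Three pairwise adjacent vertices. -/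
def IsTriangle (G : SimpleGraph V) (x y z : V) : Prop := G.Adj x y ∧ G.Adj y z ∧ G.Adj x z

/-- Take an edge pq in `m`. The rest is independent, and removing either end must leave an edge, so
both p and q have neighbours in the rest. Distinct neighbours would give two edges, so p and q share
one. -/
lemma exists_triangle_of_symAt_two {m : Multiset V} (hs : SymAt G 2 m ∅) (hp : ¬ PowAt G 2 m ∅) :
    ∃ x y z, IsTriangle G x y z ∧ {x} + {y} + {z} ≤ m := by
  obtain ⟨p, hpm, q, hqm, hpq⟩ := hs.exists_adj (d := 0) (zero_add m).symm (by simp)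
  obtain ⟨r, rfl⟩ := Multiset.le_iff_exists_add.1 (singleton_add_singleton_le hpm hqm hpq.ne)
  have hr : ∀ x ∈ r, ∀ y ∈ r, ¬ G.Adj x y := by
    intro x hx y hy hxy
    refine hp ((PowAt.edge hpq (PowAt.edge hxy (PowAt.zero 0 ∅))).of_le
      (add_le_add_right ?_ _))
    simpa using singleton_add_singleton_le hx hy hxy.ne
  have h1 : ∃ x ∈ r, G.Adj p x := by
    obtain ⟨x, hx, y, hy, hxy⟩ := hs.exists_adj (d := {q}) (b := {p} + r) (by abel) (by simp)
    rw [Multiset.mem_add, Multiset.mem_singleton] at hx hy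
    rcases hx with rfl | hx <;> rcases hy with rfl | hy
    · exact absurd rfl hxy.ne
    · exact ⟨y, hy, hxy⟩
    · exact ⟨x, hx, hxy.symm⟩
    · exact absurd hxy (hr x hx y hy)
  have h2 : ∃ x ∈ r, G.Adj q x := by
    obtain ⟨x, hx, y, hy, hxy⟩ := hs.exists_adj (d := {p}) (b := {q} + r) (by abel) (by simp)
    rw [Multiset.mem_add, Multiset.mem_singleton] at hx hy
    rcases hx with rfl | hx <;> rcases hy with rfl | hy
    · exact absurd rfl hxy.ne
    · exact ⟨y, hy, hxy⟩
    · exact ⟨x, hx, hxy.symm⟩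
    · exact absurd hxy (hr x hx y hy)
  obtain ⟨x, hx, hpx⟩ := h1
  obtain ⟨y, hy, hqy⟩ := h2
  by_cases hxy : x = y
  · subst hxy
    exact ⟨p, q, x, ⟨hpq, hqy, hpx⟩, add_le_add_right (Multiset.singleton_le.2 hx) _⟩
  · refine absurd ((PowAt.edge hpx (PowAt.edge hqy (PowAt.zero 0 ∅))).of_le ?_) hp
    have := add_le_add_right (singleton_add_singleton_le hx hy hxy) ({p} + {q})
    convert this using 1
    abel

/-- The three types of minimal obstructions between the third symbolic and ordinary powers. -/
def HasObstruction (G : SimpleGraph V) (m : Multiset V) : Prop :=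
  (∃ x y z u v, IsTriangle G x y z ∧ G.Adj u v ∧ {x} + {y} + {z} + {u} + {v} ≤ m) ∨
  (∃ x y z u, IsTriangle G x y z ∧ G.Adj x u ∧ G.Adj y u ∧ G.Adj z u ∧
    {x} + {y} + {z} + {u} ≤ m) ∨
  (∃ x y z u v, G.Adj x y ∧ G.Adj y z ∧ G.Adj z u ∧ G.Adj u v ∧ G.Adj v x ∧
    {x} + {y} + {z} + {u} + {v} ≤ m)

/-- Discarding two of the four endpoints must leave an edge, which forces the kept endpoints to be
adjacent if neither has neighbours in `r`. So qt is an edge. If p and s both have neighbours in `r`,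
a common one closes a five-cycle and distinct ones give an augmenting path; otherwise a triangle
appears. -/
lemma hasObstruction_of_pair {m r : Multiset V} (hs : SymAt G 3 m ∅) (hp : ¬ PowAt G 3 m ∅)
    {p q s t : V} (hpq : G.Adj p q) (hst : G.Adj s t) (hm : m = {p} + {q} + {s} + {t} + r)
    (hr : ∀ x ∈ r, ∀ y ∈ r, ¬ G.Adj x y) (hq : ∀ x ∈ r, ¬ G.Adj q x)
    (ht : ∀ x ∈ r, ¬ G.Adj t x) : HasObstruction G m := by
  have pair : ∀ {d : Multiset V} {x y : V}, d.card < 3 → m = d + ({x} + {y} + r) →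
      (∀ z ∈ r, ¬ G.Adj x z) → (∀ z ∈ r, ¬ G.Adj y z) → G.Adj x y := by
    intro d x y hd hm hx hy
    obtain ⟨a, ha, b, hb, hab⟩ := hs.exists_adj hm hd
    simp only [Multiset.mem_add, Multiset.mem_singleton] at ha hb
    rcases ha with (rfl | rfl) | ha <;> rcases hb with (rfl | rfl) | hb
    · exact absurd rfl hab.ne
    · exact hab
    · exact absurd hab (hx _ hb)
    · exact hab.symm
    · exact absurd rfl hab.ne
    · exact absurd hab (hy _ hb)
    · exact absurd hab.symm (hx _ ha)
    · exact absurd hab.symm (hy _ ha)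
    · exact absurd hab (hr _ ha _ hb)
  have hqt : G.Adj q t := pair (d := {p} + {s}) (by simp) (by rw [hm]; abel) hq ht
  -- the case in which one of the two outer vertices has no neighbours in `r`
  have main : ∀ {p q s t : V}, G.Adj p q → G.Adj s t → G.Adj q t →
      m = {p} + {q} + {s} + {t} + r → (∀ x ∈ r, ¬ G.Adj q x) → (∀ x ∈ r, ¬ G.Adj t x) →
      (∀ x ∈ r, ¬ G.Adj s x) → HasObstruction G m := by
    intro p q s t hpq hst hqt hm hq ht hs'
    have hqs : G.Adj q s := pair (d := {p} + {t}) (by simp) (by rw [hm]; abel) hq hs'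
    by_cases hp' : ∀ x ∈ r, ¬ G.Adj p x
    · have hpt : G.Adj p t := pair (d := {q} + {s}) (by simp) (by rw [hm]; abel) hp' ht
      have hps : G.Adj p s := pair (d := {q} + {t}) (by simp) (by rw [hm]; abel) hp' hs'
      exact Or.inr (Or.inl ⟨p, q, s, t, ⟨hpq, hqs, hps⟩, hpt, hqt, hst,
        hm ▸ Multiset.le_add_right _ _⟩)
    · push Not at hp'
      obtain ⟨x, hx, hpx⟩ := hp'
      refine Or.inl ⟨q, s, t, p, x, ⟨hqs, hst, hqt⟩, hpx, ?_⟩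
      have := add_le_add_right (Multiset.singleton_le.2 hx) ({p} + {q} + {s} + {t})
      rw [← hm] at this
      convert this using 1
      abel
  by_cases hs' : ∀ x ∈ r, ¬ G.Adj s x
  · exact main hpq hst hqt hm hq ht hs'
  by_cases hp' : ∀ x ∈ r, ¬ G.Adj p x
  · exact main hst hpq hqt.symm (by rw [hm]; abel) ht hq hp'
  push Not at hs' hp'
  obtain ⟨x, hx, hsx⟩ := hs'
  obtain ⟨y, hy, hpy⟩ := hp'
  by_cases hxy : x = y
  · subst hxy
    refine Or.inr (Or.inr ⟨p, q, t, s, x, hpq, hqt, hst.symm, hsx, hpy.symm, ?_⟩)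
    have := add_le_add_right (Multiset.singleton_le.2 hx) ({p} + {q} + {s} + {t})
    rw [← hm] at this
    convert this using 1
    abel
  · refine absurd ((PowAt.edge hsx (PowAt.edge hpy (PowAt.edge hqt (PowAt.zero 0 ∅)))).of_le ?_) hp
    have := add_le_add_right (singleton_add_singleton_le hx hy hxy) ({p} + {q} + {s} + {t})
    rw [← hm] at this
    convert this using 1
    abel

lemma exists_pair_of_powAt_two {m : Multiset V} (h : PowAt G 2 m ∅) :
    ∃ p q s t r, G.Adj p q ∧ G.Adj s t ∧ m = {p} + {q} + {s} + {t} + r := by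
  obtain ⟨l, hl, hadj, hle⟩ := h
  obtain ⟨e, f, rfl⟩ := List.length_eq_two.1 hl
  have h1 : endpoints [e, f] ≤ m := Multiset.le_iff_count.2 fun x => hle x (by simp)
  obtain ⟨r, rfl⟩ := Multiset.le_iff_exists_add.1 h1
  refine ⟨e.1, e.2, f.1, f.2, r, hadj e (by simp), hadj f (by simp), ?_⟩
  rw [endpoints_cons, endpoints_cons]
  simp only [endpoints, List.map_nil, List.sum_nil, add_zero, Multiset.insert_eq_cons,
    ← Multiset.singleton_add]
  abel

/-- If two edges can be packed, the remainder `r` is independent, and an edge whose two ends both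
have neighbours in `r` gives either a triangle beside the other edge or a third edge. Hence each
edge has an end without neighbours in `r`. If two edges cannot be packed, the case s = 2 supplies a
triangle. -/
lemma hasObstruction {m : Multiset V} (hs : SymAt G 3 m ∅) (hp : ¬ PowAt G 3 m ∅) :
    HasObstruction G m := by
  by_cases h2 : PowAt G 2 m ∅
  · obtain ⟨p, q, s, t, r, hpq, hst, hm⟩ := exists_pair_of_powAt_two h2
    have hr : ∀ x ∈ r, ∀ y ∈ r, ¬ G.Adj x y := by
      intro x hx y hy hxy
      refine hp ((PowAt.edge hpq (PowAt.edge hst (PowAt.edge hxy (PowAt.zero 0 ∅)))).of_le ?_)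
      have := add_le_add_right (singleton_add_singleton_le hx hy hxy.ne) ({p} + {q} + {s} + {t})
      rw [← hm] at this
      convert this using 1
      abel
    have both : ∀ {p q s t : V}, G.Adj p q → G.Adj s t → m = {p} + {q} + {s} + {t} + r →
        HasObstruction G m ∨ (∀ x ∈ r, ¬ G.Adj p x) ∨ ∀ x ∈ r, ¬ G.Adj q x := by
      intro p q s t hpq hst hm
      by_contra! h
      obtain ⟨h0, ⟨x, hx, hpx⟩, y, hy, hqy⟩ := h
      by_cases hxy : x = y
      · subst hxy
        refine h0 (Or.inl ⟨p, q, x, s, t, ⟨hpq, hqy, hpx⟩, hst, ?_⟩)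
        have := add_le_add_right (Multiset.singleton_le.2 hx) ({p} + {q} + {s} + {t})
        rw [← hm] at this
        convert this using 1
        abel
      · refine hp ((PowAt.edge hpx (PowAt.edge hqy (PowAt.edge hst (PowAt.zero 0 ∅)))).of_le ?_)
        have := add_le_add_right (singleton_add_singleton_le hx hy hxy) ({p} + {q} + {s} + {t})
        rw [← hm] at this
        convert this using 1
        abel
    rcases both hpq hst hm with h | h1 | h1
    · exact h
    · rcases both hst hpq (by rw [hm]; abel) with h | h2 | h2
      · exact h
      · exact hasObstruction_of_pair hs hp hpq.symm hst.symm (by rw [hm]; abel) hr h1 h2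
      · exact hasObstruction_of_pair hs hp hpq.symm hst (by rw [hm]; abel) hr h1 h2
    · rcases both hst hpq (by rw [hm]; abel) with h | h2 | h2
      · exact h
      · exact hasObstruction_of_pair hs hp hpq hst.symm (by rw [hm]; abel) hr h1 h2
      · exact hasObstruction_of_pair hs hp hpq hst hm hr h1 h2
  · obtain ⟨x, y, z, hT, hle⟩ := exists_triangle_of_symAt_two (hs.anti (by norm_num)) h2
    obtain ⟨b, rfl⟩ := Multiset.le_iff_exists_add.1 hle
    -- Two discarded vertices weigh less than 3, so an edge survives; it cannot use this copy of
    -- `x`, which would then pack together with yz.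
    obtain ⟨u, hu, v, hv, huv⟩ := hs.exists_adj (d := {y} + {z}) (b := {x} + b) (by abel) (by simp)
    obtain ⟨hxy, hyz, hxz⟩ := hT
    rw [Multiset.mem_add, Multiset.mem_singleton] at hu hv
    have hxb : ∀ w ∈ b, ¬ G.Adj x w := by
      intro w hw hxw
      refine h2 ((PowAt.edge hxw (PowAt.edge hyz (PowAt.zero 0 ∅))).of_le ?_)
      have := add_le_add_right (Multiset.singleton_le.2 hw) ({x} + {y} + {z})
      convert this using 1
      abel
    rcases hu with rfl | hu <;> rcases hv with rfl | hv
    · exact absurd rfl huv.ne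
    · exact absurd huv (hxb v hv)
    · exact absurd huv.symm (hxb u hu)
    · refine Or.inl ⟨x, y, z, u, v, ⟨hxy, hyz, hxz⟩, huv, ?_⟩
      have := add_le_add_right (singleton_add_singleton_le hu hv huv.ne) ({x} + {y} + {z})
      rwa [← add_assoc] at this

/-- Giving the vertices of `F` multiplicity `s` replaces inverting them, so that the structure
results, stated at ∅, apply at `F`. -/
lemma SymAt.add_nsmul {s : ℕ} {a : Multiset V} {F : Finset V} (h : SymAt G s a F) :
    SymAt G s (a + s • F.val) ∅ := by
  intro M hM _
  by_cases hF : F ⊆ M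
  · exact (h M hM hF).trans (Multiset.card_le_card
      (Multiset.filter_le_filter _ (Multiset.le_add_right _ _)))
  · obtain ⟨f, hf, hfM⟩ := Finset.not_subset.1 hF
    refine le_trans ?_ (Multiset.count_le_card f _)
    rw [Multiset.count_filter, if_pos hfM, Multiset.count_add, Multiset.count_nsmul,
      Multiset.count_eq_one_of_mem F.nodup hf]
    omega

lemma count_add_nsmul_of_notMem {s : ℕ} {a : Multiset V} {F : Finset V} {x : V} (hx : x ∉ F) :
    (a + s • F.val).count x = a.count x := by
  have h0 : F.val.count x = 0 := Multiset.count_eq_zero.2 hx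
  rw [Multiset.count_add, Multiset.count_nsmul, h0, mul_zero, add_zero]

lemma PowAt.of_add_nsmul {s t : ℕ} {a : Multiset V} {F : Finset V}
    (h : PowAt G s (a + t • F.val) ∅) : PowAt G s a F := by
  obtain ⟨l, hl, hadj, hle⟩ := h
  refine ⟨l, hl, hadj, fun x hx => (hle x (by simp)).trans ?_⟩
  rw [count_add_nsmul_of_notMem hx]

lemma le_of_le_add_nsmul {t : ℕ} {a b : Multiset V} {F : Finset V} (h : b ≤ a + t • F.val)
    (hb : ∀ x ∈ b, x ∉ F) : b ≤ a := by
  rw [Multiset.le_iff_count] at h ⊢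
  intro x
  by_cases hx : x ∈ b
  · exact (h x).trans (count_add_nsmul_of_notMem (hb x hx)).le
  · rw [Multiset.count_eq_zero.2 hx]
    exact Nat.zero_le _

end Structure

/-! ### Lower bounds for the regularity -/

section Suspension

variable {K V : Type*} [Field K] [Fintype V] [LinearOrder V]

/-- The suspension of a family on `W` by two new vertices `x` and `y`. -/
lemma not_acyclicAt_suspension {S : Finset V → Prop} (hS : ∀ E F, E ⊆ F → S F → S E)
    {A W : Finset V} {x y : V} (hx : x ∉ W) (hy : y ∉ W) (hxy : x ≠ y) {i : ℕ}
    (h : ¬ AcyclicAt K {F | A ⊆ F ∧ F ⊆ W ∧ S F} i) :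
    ¬ AcyclicAt K {F | A ⊆ F ∧ F ⊆ insert x (insert y W) ∧ S (F ∩ W) ∧ ¬ (x ∈ F ∧ y ∈ F)}
      (i + 1) := by
  obtain ⟨F₀, hAF, hFW, -⟩ := nonempty_of_not_acyclicAt h
  have hxA : x ∉ A := fun h => hx (hFW (hAF h))
  have hyA : y ∉ A := fun h => hy (hFW (hAF h))
  intro hac
  apply h
  -- the sets that contain `y`
  have h1 : AcyclicAt K {F | A ⊆ F ∧ F ⊆ insert y W ∧ S (F ∩ W) ∧ y ∈ F} (i + 1) := by
    refine (AcyclicAt.of_sdiff_prev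
      (𝓕 := {F | A ⊆ F ∧ F ⊆ insert x (insert y W) ∧ S (F ∩ W) ∧ ¬ (x ∈ F ∧ y ∈ F)})
      (𝓑 := {F | A ⊆ F ∧ F ⊆ insert y W ∧ S (F ∩ W) ∧ y ∈ F}) ⟨?_⟩ ?_ ?_ hac
      fun j _ => AcyclicAt.of_cone (q := x) ?_ j)
    · rintro E ⟨hE, -⟩ F ⟨-, hF2, hF3, hF4⟩ D ⟨hED, hDF⟩
      exact ⟨hE.trans hED, hDF.trans hF2, hS _ _ (Finset.inter_subset_inter_right hDF) hF3,
        fun hD => hF4 ⟨hDF hD.1, hDF hD.2⟩⟩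
    · rintro F ⟨hF1, hF2, hF3, hF4⟩
      refine ⟨hF1, hF2.trans (Finset.subset_insert _ _), hF3, fun hF => ?_⟩
      exact (Finset.mem_insert.1 (hF2 hF.1)).elim hxy hx
    · rintro E ⟨-, -, -, hyE⟩ F ⟨hF1, hF2, hF3, hF4⟩ hEF
      have hyF := hEF hyE
      exact ⟨hF1, (Finset.subset_insert_iff_of_notMem fun hxF => hF4 ⟨hxF, hyF⟩).1 hF2, hF3, hyF⟩
    · rintro F ⟨⟨hF1, hF2, hF3, hF4⟩, hF5⟩
      have hyF : y ∉ F := by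
        intro hyF
        exact hF5 ⟨hF1, (Finset.subset_insert_iff_of_notMem fun hxF => hF4 ⟨hxF, hyF⟩).1 hF2,
          hF3, hyF⟩
      refine ⟨⟨⟨hF1.trans (Finset.subset_insert _ _), ?_, ?_, ?_⟩, ?_⟩,
        ⟨⟨?_, ?_, ?_, ?_⟩, ?_⟩⟩
      · exact Finset.insert_subset (Finset.mem_insert_self _ _) hF2
      · rwa [Finset.insert_inter_of_notMem hx]
      · simp [hyF, hxy.symm]
      · exact fun h => hyF ((Finset.mem_insert.1 h.2.2.2).resolve_left hxy.symm)
      · exact fun z hz => Finset.mem_erase.2 ⟨fun h => hxA (h ▸ hz), hF1 hz⟩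
      · exact (Finset.erase_subset _ _).trans hF2
      · exact hS _ _ (Finset.inter_subset_inter_right (Finset.erase_subset _ _)) hF3
      · simp
      · exact fun h => hyF (Finset.mem_of_mem_erase h.2.2.2)
  -- The sets avoiding `y` form a cone over `x`, which moved acyclicity to the sets containing `y`.
  -- Now the family on `insert y W` is a cone over `y`, and removing the sets containing `y` leaves
  -- the family on `W` one degree lower.
  refine (AcyclicAt.sdiff (𝓕 := {F | A ⊆ F ∧ F ⊆ insert y W ∧ S (F ∩ W)})
    (𝓑 := {F | A ⊆ F ∧ F ⊆ insert y W ∧ S (F ∩ W) ∧ y ∈ F}) ⟨?_⟩ ?_ ?_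
    (AcyclicAt.of_cone (q := y) ?_ i) h1).congr fun F => ?_
  · rintro E ⟨hE, -⟩ F ⟨-, hF2, hF3⟩ D ⟨hED, hDF⟩
    exact ⟨hE.trans hED, hDF.trans hF2, hS _ _ (Finset.inter_subset_inter_right hDF) hF3⟩
  · exact fun F hF => ⟨hF.1, hF.2.1, hF.2.2.1⟩
  · exact fun E hE F hF hEF => ⟨hF.1, hF.2.1, hF.2.2, hEF hE.2.2.2⟩
  · rintro F ⟨hF1, hF2, hF3⟩
    refine ⟨⟨hF1.trans (Finset.subset_insert _ _),
      Finset.insert_subset (Finset.mem_insert_self _ _) hF2, ?_⟩,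
      fun z hz => Finset.mem_erase.2 ⟨fun h => hyA (h ▸ hz), hF1 hz⟩,
      (Finset.erase_subset _ _).trans hF2,
      hS _ _ (Finset.inter_subset_inter_right (Finset.erase_subset _ _)) hF3⟩
    rwa [Finset.insert_inter_of_notMem hy]
  · constructor
    · rintro ⟨⟨hF1, hF2, hF3⟩, hF4⟩
      have hFW := (Finset.subset_insert_iff_of_notMem fun hyF => hF4 ⟨hF1, hF2, hF3, hyF⟩).1 hF2
      rw [Finset.inter_eq_left.2 hFW] at hF3
      exact ⟨hF1, hFW, hF3⟩
    · rintro ⟨hF1, hF2, hF3⟩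
      refine ⟨⟨hF1, hF2.trans (Finset.subset_insert _ _), ?_⟩, fun h => hy (hF2 h.2.2.2)⟩
      rwa [Finset.inter_eq_left.2 hF2]

/-- The complementary form of `not_acyclicAt_suspension`. -/
lemma not_acyclicAt_compl_suspension {S : Finset V → Prop} (hS : ∀ E F, E ⊆ F → S F → S E)
    {A W : Finset V} {x y : V} (hx : x ∉ W) (hy : y ∉ W) (hxy : x ≠ y) {i : ℕ}
    (h : ¬ AcyclicAt K {F | A ⊆ F ∧ F ⊆ W ∧ S F} i) :
    ¬ AcyclicAt K {F | A ⊆ F ∧ F ⊆ insert x (insert y W) ∧ (¬ S (F ∩ W) ∨ (x ∈ F ∧ y ∈ F))}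
      (i + 2) := by
  have h1 := not_acyclicAt_suspension hS hx hy hxy h
  obtain ⟨F₀, hAF, hFW, -⟩ := nonempty_of_not_acyclicAt h
  have hxA : x ∉ A := fun h => hx (hFW (hAF h))
  intro hac
  -- The suspension and its complement make up a full interval, which is a cone over `x`; this costs
  -- one further degree.
  refine h1 ((AcyclicAt.sdiff (𝓕 := {F | A ⊆ F ∧ F ⊆ insert x (insert y W)})
    (𝓑 := {F | A ⊆ F ∧ F ⊆ insert x (insert y W) ∧ (¬ S (F ∩ W) ∨ (x ∈ F ∧ y ∈ F))}) ⟨?_⟩ ?_ ?_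
    (AcyclicAt.of_cone (q := x) ?_ _) hac).congr fun F => ?_)
  · rintro E ⟨hE, -⟩ F ⟨-, hF2⟩ D ⟨hED, hDF⟩
    exact ⟨hE.trans hED, hDF.trans hF2⟩
  · exact fun F hF => ⟨hF.1, hF.2.1⟩
  · rintro E ⟨hE1, hE2, hE3⟩ F ⟨hF1, hF2⟩ hEF
    refine ⟨hF1, hF2, hE3.imp (fun h h' => h (hS _ _ (Finset.inter_subset_inter_right hEF) h'))
      fun h => ⟨hEF h.1, hEF h.2⟩⟩
  · rintro F ⟨hF1, hF2⟩
    exact ⟨⟨hF1.trans (Finset.subset_insert _ _),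
      Finset.insert_subset (Finset.mem_insert_self _ _) hF2⟩,
      fun z hz => Finset.mem_erase.2 ⟨fun h => hxA (h ▸ hz), hF1 hz⟩,
      (Finset.erase_subset _ _).trans hF2⟩
  · simp only [Set.mem_sdiff, Set.mem_ofPred_eq]
    tauto

end Suspension

/-! ### Lower bounds from an edge far from the rest -/

section LowerBounds

variable {K V : Type*} [Field K] [Fintype V] [LinearOrder V] {G : SimpleGraph V}

lemma Indep.mono {E F : Finset V} (h : Indep G F) (hEF : E ⊆ F) : Indep G E :=
  fun _ hx _ hy => h _ (hEF hx) _ (hEF hy)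

/-- An independent set of `W` together with `x` is independent and leaves at most weight `m` of the
exponent m(x + y) uncovered by it. So `c` must supply the other `k`. This tests `F` as long as `F`
misses `y`, and symmetrically with `x`. -/
lemma SymAt.of_edge_add {k m : ℕ} {c : Multiset V} {W F : Finset V} {x y : V}
    (hc : ∀ v ∈ c, v ∈ W) (hWx : ∀ w ∈ W, w ≠ x ∧ ¬ G.Adj w x)
    (hWy : ∀ w ∈ W, w ≠ y ∧ ¬ G.Adj w y) (hF : F ⊆ insert x (insert y W))
    (h : SymAt G (m + k) (m • ({x} + {y}) + c) F) :
    SymAt G k c (F ∩ W) ∨ (x ∈ F ∧ y ∈ F) := by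
  have main : ∀ x y, (∀ w ∈ W, w ≠ x ∧ ¬ G.Adj w x) → F ⊆ insert x (insert y W) →
      SymAt G (m + k) (m • ({x} + {y}) + c) F → y ∉ F → SymAt G k c (F ∩ W) := by
    intro x y hWx hF h hyF M hM hFM
    have hIndep : Indep G (insert x (M ∩ W)) := by
      intro u hu v hv
      rw [Finset.mem_insert, Finset.mem_inter] at hu hv
      rcases hu with rfl | hu <;> rcases hv with rfl | hv
      · exact G.loopless.irrefl _
      · exact fun h => (hWx v hv.2).2 h.symm
      · exact (hWx u hu.2).2
      · exact hM u hu.1 v hv.1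
    have h1 := h _ hIndep (by
      intro f hf
      rcases Finset.mem_insert.1 (hF hf) with rfl | hf'
      · exact Finset.mem_insert_self _ _
      rcases Finset.mem_insert.1 hf' with rfl | hf'
      · exact absurd hf hyF
      · exact Finset.mem_insert_of_mem (Finset.mem_inter.2
          ⟨hFM (Finset.mem_inter.2 ⟨hf, hf'⟩), hf'⟩))
    have h2 : c.filter (· ∉ insert x (M ∩ W)) = c.filter (· ∉ M) := by
      refine Multiset.filter_congr fun v hv => ?_
      have h3 := hc v hv
      simp [(hWx v h3).1, h3]
    rw [Multiset.filter_add, Multiset.card_add, h2, Multiset.filter_nsmul, Multiset.card_nsmul,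
      Multiset.filter_add, Multiset.card_add] at h1
    have h3 : (({x} : Multiset V).filter (· ∉ insert x (M ∩ W))).card = 0 := by
      simp [Multiset.filter_singleton]
    have h4 := Multiset.card_le_card (Multiset.filter_le (· ∉ insert x (M ∩ W)) ({y} : Multiset V))
    rw [Multiset.card_singleton] at h4
    have h5 := Nat.mul_le_mul_left m h4
    rw [h3, zero_add] at h1
    linarith
  by_cases hy : y ∈ F
  · by_cases hx : x ∈ F
    · exact Or.inr ⟨hx, hy⟩
    · refine Or.inl (main y x hWy (by rwa [Finset.insert_comm]) ?_ hx)
      rwa [add_comm ({y} : Multiset V)]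
  · exact Or.inl (main x y hWx hF h hy)

lemma SymAt.edge_add {k m : ℕ} {c : Multiset V} {W F : Finset V} {x y : V} (hxy : G.Adj x y)
    (h : SymAt G k c (F ∩ W) ∨ (x ∈ F ∧ y ∈ F)) :
    SymAt G (m + k) (m • ({x} + {y}) + c) F := by
  rcases h with h | h
  · refine SymAt.add ?_ (h.mono le_rfl Finset.inter_subset_left)
    induction m with
    | zero => exact fun _ _ _ => Nat.zero_le _
    | succ m ih =>
      rw [add_smul, one_smul]
      exact ih.add (symAt_edge hxy F)
  · exact (PowAt.of_adj_mem hxy h.1 h.2 _).symAt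

lemma not_symAt_one_zero_iff {F : Finset V} : ¬ SymAt G 1 0 F ↔ Indep G F := by
  constructor
  · exact fun h => indep_of_not_powAt fun h' => h h'.symAt
  · intro hF h
    have := h F hF subset_rfl
    simp at this

/-- Adding m(x + y) to `c` turns the sets on `W` where `SymAt G k c` fails into their suspension by
x and y; passing to the complement makes this a degree family, for a total shift by two. -/
lemma le_regularity_symbolicPower_of_edge {k m : ℕ} {c : Multiset V} {A W : Finset V} {x y : V}
    (hxy : G.Adj x y) (hc : ∀ v ∈ c, v ∈ W) (hcA : ∀ v ∈ c, v ∉ A)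
    (hWx : ∀ w ∈ W, w ≠ x ∧ ¬ G.Adj w x) (hWy : ∀ w ∈ W, w ≠ y ∧ ¬ G.Adj w y) {i : ℕ}
    (h : ¬ AcyclicAt K {F | A ⊆ F ∧ F ⊆ W ∧ ¬ SymAt G k c F} i) :
    LERegularity (2 * m + c.card - A.card + i + 2 : ℤ)
      (symbolicPower (edgeIdeal K G) (m + k)) := by
  have hxW : x ∉ W := fun h => (hWx x h).1 rfl
  have hyW : y ∉ W := fun h => (hWy y h).1 rfl
  obtain ⟨F₀, hAF, hFW, -⟩ := nonempty_of_not_acyclicAt h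
  have h1 := not_acyclicAt_compl_suspension (S := fun F => ¬ SymAt G k c F)
    (fun E F hEF hF hE => hF (hE.mono le_rfl hEF)) hxW hyW hxy.ne h
  have hmem : ∀ v ∈ m • ({x} + {y}) + c, v = x ∨ v = y ∨ v ∈ c := by
    intro v hv
    rw [Multiset.mem_add] at hv
    rcases hv with hv | hv
    · have := Multiset.mem_of_mem_nsmul hv
      simp only [Multiset.mem_add, Multiset.mem_singleton] at this
      tauto
    · tauto
  refine ((isDescribedBy_symbolicPower G (m + k)).le_regularity (K := K)
    (a := m • ({x} + {y}) + c) (A := A) (W := insert x (insert y W)) (i := i + 2) ?_ ?_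
    fun h' => h1 (h'.congr fun F => ?_)).mono ?_
  · intro v hv
    rcases hmem v hv with rfl | rfl | hv
    · exact fun h => hxW (hFW (hAF h))
    · exact fun h => hyW (hFW (hAF h))
    · exact hcA v hv
  · intro v hv
    rcases hmem v hv with rfl | rfl | hv
    · exact Finset.mem_insert_self _ _
    · exact Finset.mem_insert_of_mem (Finset.mem_insert_self _ _)
    · exact Finset.mem_insert_of_mem (Finset.mem_insert_of_mem (hc v hv))
  · simp only [Set.mem_ofPred_eq, not_not]
    refine and_congr_right fun _ => and_congr_right fun hF => ⟨fun h => ?_, fun h => ?_⟩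
    · exact h.of_edge_add hc hWx hWy hF
    · exact SymAt.edge_add hxy h
  · simp only [Multiset.card_add, Multiset.card_nsmul, Multiset.card_singleton]
    push_cast
    omega

/-- With exponent m(x + y), the ordinary and the symbolic (m+1)-st power have the same family on `W
∪ {x, y}`: the sets containing an edge. -/
lemma le_regularity_of_indep_subset {m : ℕ} {A W : Finset V} {x y : V}
    (hxy : G.Adj x y) (hWx : ∀ w ∈ W, w ≠ x ∧ ¬ G.Adj w x) (hWy : ∀ w ∈ W, w ≠ y ∧ ¬ G.Adj w y)
    {i : ℕ} (h : ¬ AcyclicAt K {F | A ⊆ F ∧ F ⊆ W ∧ Indep G F} i) :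
    LERegularity (2 * m - A.card + i + 2 : ℤ) (edgeIdeal K G ^ (m + 1)) ∧
      LERegularity (2 * m - A.card + i + 2 : ℤ) (symbolicPower (edgeIdeal K G) (m + 1)) := by
  refine ⟨?_, ?_⟩
  · have hxW : x ∉ W := fun h => (hWx x h).1 rfl
    have hyW : y ∉ W := fun h => (hWy y h).1 rfl
    obtain ⟨F₀, hAF, hFW, -⟩ := nonempty_of_not_acyclicAt h
    have h1 := not_acyclicAt_compl_suspension (S := Indep G)
      (fun E F hEF hF => hF.mono hEF) hxW hyW hxy.ne h
    have hmem : ∀ v ∈ m • ({x} + {y} : Multiset V), v = x ∨ v = y := by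
      intro v hv
      simpa using Multiset.mem_of_mem_nsmul hv
    refine ((isDescribedBy_edgeIdeal_pow G (m + 1)).le_regularity (K := K)
      (a := m • ({x} + {y})) (A := A) (W := insert x (insert y W)) (i := i + 2) ?_ ?_
      fun h' => h1 (h'.congr fun F => ?_)).mono ?_
    · intro v hv
      rcases hmem v hv with rfl | rfl
      · exact fun h => hxW (hFW (hAF h))
      · exact fun h => hyW (hFW (hAF h))
    · intro v hv
      rcases hmem v hv with rfl | rfl
      · exact Finset.mem_insert_self _ _
      · exact Finset.mem_insert_of_mem (Finset.mem_insert_self _ _)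
    · simp only [Set.mem_ofPred_eq]
      refine and_congr_right fun _ => and_congr_right fun hF => ⟨fun h => ?_, fun h => ?_⟩
      · have h2 : SymAt G (m + 1) (m • ({x} + {y}) + 0) F := by
          rw [add_zero]
          exact h.symAt
        rw [← not_symAt_one_zero_iff, not_not]
        exact h2.of_edge_add (by simp) hWx hWy hF
      · rcases h with h | h
        · unfold Indep at h
          push Not at h
          obtain ⟨u, hu, v, hv, huv⟩ := h
          exact PowAt.of_adj_mem huv (Finset.mem_of_mem_inter_left hu)
            (Finset.mem_of_mem_inter_left hv) _
        · exact PowAt.of_adj_mem hxy h.1 h.2 _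
    · simp only [Multiset.card_add, Multiset.card_nsmul, Multiset.card_singleton]
      push_cast
      omega
  · refine (le_regularity_symbolicPower_of_edge (K := K) (k := 1) (m := m) (c := 0) (A := A) hxy
      (by simp) (by simp) hWx hWy (i := i) fun h' => h (h'.congr fun F => ?_)).mono (by simp)
    simp only [Set.mem_ofPred_eq, not_symAt_one_zero_iff]

variable (G) in
/-- No element of `F` is equal or adjacent to an element of `a`. -/
def Far (F : Finset V) (a : Multiset V) : Prop := ∀ f ∈ F, ∀ x ∈ a, f ≠ x ∧ ¬ G.Adj f x

lemma Far.mono {E F : Finset V} {a b : Multiset V} (h : Far G F a) (hEF : E ⊆ F)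
    (hba : ∀ x ∈ b, x ∈ a) : Far G E b :=
  fun f hf x hx => h f (hEF hf) x (hba x hx)

open Classical in
variable (G) in
/-- The vertices outside the closed neighbourhood of `a`. -/
noncomputable def farSet (a : Multiset V) : Finset V :=
  Finset.univ.filter fun v => ∀ x ∈ a, v ≠ x ∧ ¬ G.Adj v x

lemma mem_farSet {a : Multiset V} {v : V} : v ∈ farSet G a ↔ ∀ x ∈ a, v ≠ x ∧ ¬ G.Adj v x := by
  simp [farSet]

lemma subset_farSet_iff {F : Finset V} {a : Multiset V} : F ⊆ farSet G a ↔ Far G F a :=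
  ⟨fun h _ hf => mem_farSet.1 (h hf), fun h f hf => mem_farSet.2 (h f hf)⟩

lemma le_regularity_of_far {m : ℕ} {A : Finset V} {a : Multiset V} {x y : V} (hxy : G.Adj x y)
    (hx : x ∈ a) (hy : y ∈ a) {i : ℕ}
    (h : ¬ AcyclicAt K {F | A ⊆ F ∧ Indep G F ∧ Far G F a} i) :
    LERegularity (2 * m - A.card + i + 2 : ℤ) (edgeIdeal K G ^ (m + 1)) ∧
      LERegularity (2 * m - A.card + i + 2 : ℤ) (symbolicPower (edgeIdeal K G) (m + 1)) := by
  refine le_regularity_of_indep_subset (W := farSet G a) hxy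
    (fun w hw => mem_farSet.1 hw x hx) (fun w hw => mem_farSet.1 hw y hy)
    fun h' => h (h'.congr fun F => ?_)
  simp only [Set.mem_ofPred_eq, subset_farSet_iff]
  tauto

end LowerBounds

/-! ### The differences of the degree complexes -/

section Difference

variable {K V : Type*} [Field K] [Fintype V] [LinearOrder V] {G : SimpleGraph V}

variable (G) in
/-- Some element of `F` is adjacent to `v`. -/
def Near (F : Finset V) (v : V) : Prop := ∃ f ∈ F, G.Adj v f

variable (G) in
/-- The sets in which the degree complexes of the `s`-th power and the `s`-th symbolic power
differ. -/
def differenceFamily (s : ℕ) (a : Multiset V) (A : Finset V) : Set (Finset V) :=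
  {F | A ⊆ F ∧ SymAt G s a F ∧ ¬ PowAt G s a F}

lemma differenceFamily_ordConnected (s : ℕ) (a : Multiset V) (A : Finset V) :
    (differenceFamily G s a A).OrdConnected :=
  ⟨fun _ hE _ hF _ hD => ⟨hE.1.trans hD.1, hE.2.1.mono le_rfl hD.1,
    fun h => hF.2.2 (h.mono le_rfl hD.2)⟩⟩

lemma PowAt.add {s t : ℕ} {a b : Multiset V} {F : Finset V} (ha : PowAt G s a F)
    (hb : PowAt G t b F) : PowAt G (s + t) (a + b) F := by
  obtain ⟨l, hl, hadj, hle⟩ := ha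
  obtain ⟨l', hl', hadj', hle'⟩ := hb
  refine ⟨l ++ l', by simp [hl, hl'], fun e he => ?_, fun x hx => ?_⟩
  · exact (List.mem_append.1 he).elim (hadj e) (hadj' e)
  · have : endpoints (l ++ l') = endpoints l + endpoints l' := by simp [endpoints]
    rw [this, Multiset.count_add, Multiset.count_add]
    exact Nat.add_le_add (hle x hx) (hle' x hx)

lemma powAt_edge {u v : V} (h : G.Adj u v) (F : Finset V) : PowAt G 1 ({u} + {v}) F :=
  (PowAt.edge h (PowAt.zero 0 F)).of_le (by simp)

lemma powAt_half {u : V} {F : Finset V} (h : Near G F u) : PowAt G 1 {u} F := by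
  obtain ⟨f, hf, h⟩ := h
  exact (PowAt.half h hf (PowAt.zero 0 F)).of_le (by simp)

lemma PowAt.of_empty {s : ℕ} {a : Multiset V} {F : Finset V} (h : PowAt G s a ∅) :
    PowAt G s a F := h.mono le_rfl (Finset.empty_subset _)

lemma PowAt.of_singleton_add {s : ℕ} {a : Multiset V} {F : Finset V} {f : V}
    (h : PowAt G s ({f} + a) F) (hf : f ∈ F) : PowAt G s a F := by
  obtain ⟨l, hl, hadj, hle⟩ := h
  refine ⟨l, hl, hadj, fun x hx => ?_⟩
  have h1 := hle x hx
  have hxf : x ≠ f := fun h => hx (h ▸ hf)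
  rwa [Multiset.count_add, Multiset.count_singleton, if_neg hxf, zero_add] at h1

lemma PowAt.of_add_nsmul_self {s t : ℕ} {a : Multiset V} {F : Finset V}
    (h : PowAt G s (a + t • F.val) F) : PowAt G s a F := by
  obtain ⟨l, hl, hadj, hle⟩ := h
  refine ⟨l, hl, hadj, fun x hx => (hle x hx).trans ?_⟩
  rw [count_add_nsmul_of_notMem hx]

lemma IsTriangle.rotate {x y z : V} (h : IsTriangle G x y z) : IsTriangle G y z x :=
  ⟨h.2.1, h.2.2.symm, h.1.symm⟩

lemma IsTriangle.powAt_one {x y z : V} (h : IsTriangle G x y z) (F : Finset V) :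
    PowAt G 1 ({x} + {y} + {z}) F :=
  (powAt_edge h.1 F).of_le (Multiset.le_add_right _ _)

lemma IsTriangle.symAt_two {x y z : V} (h : IsTriangle G x y z) (F : Finset V) :
    SymAt G 2 ({x} + {y} + {z}) F :=
  symAt_triangle h.1 h.2.1 h.2.2 F

/-- A vertex in the closed neighbourhood of a triangle pairs with one corner (or doubles it),
leaving an edge. -/
lemma IsTriangle.powAt_two {x y z q : V} (h : IsTriangle G x y z)
    (hq : ∃ t ∈ ({x} + {y} + {z} : Multiset V), q = t ∨ G.Adj q t) (F : Finset V) :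
    PowAt G 2 ({q} + ({x} + {y} + {z})) F := by
  have main : ∀ {x y z : V}, IsTriangle G x y z → (q = x ∨ G.Adj q x) →
      PowAt G 2 ({q} + ({x} + {y} + {z})) F := by
    rintro x y z h (rfl | hq)
    · exact ((powAt_edge h.1 F).add (powAt_edge h.2.2 F)).of_le (le_of_eq (by abel))
    · exact ((powAt_edge hq F).add (powAt_edge h.2.1 F)).of_le (le_of_eq (by abel))
  obtain ⟨t, ht, hq⟩ := hq
  simp only [Multiset.mem_add, Multiset.mem_singleton] at ht
  rcases ht with (rfl | rfl) | rfl
  · exact main h hq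
  · exact (main h.rotate hq).of_le (le_of_eq (by abel))
  · exact (main h.rotate.rotate hq).of_le (le_of_eq (by abel))

lemma IsTriangle.far {x y z : V} (h : IsTriangle G x y z) {F : Finset V}
    (hF : ¬ PowAt G 2 ({x} + {y} + {z}) F) : Far G F ({x} + {y} + {z}) := by
  intro f hf t ht
  by_contra h'
  refine hF ((h.powAt_two (q := f) ⟨t, ht, ?_⟩ F).of_singleton_add hf)
  tauto

/-- With weight 0 on `F` and 1 elsewhere, every available edge weighs 2, while `a` weighs less than
2s. -/
lemma not_powAt_of_far {s : ℕ} {a : Multiset V} {F : Finset V} (hF : Indep G F)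
    (hFa : Far G F a) (ha : a.card < 2 * s) : ¬ PowAt G s a F := by
  intro h
  have h1 := h.le_sum_weight (c := 2) (fun x => if x ∈ F then 0 else 1) (fun f hf => if_pos hf)
    (fun p q hpq hp hq => ?_)
  · have h2 : (a.map fun x => if x ∈ F then 0 else 1).sum ≤ a.card := by
      rw [← card_filter_eq_sum]
      exact Multiset.card_le_card (Multiset.filter_le _ _)
    omega
  · by_cases hpF : p ∈ F
    · rcases hq with hq | hq
      · exact absurd hpq (hFa p hpF q hq).2
      · exact absurd hpq (hF p hpF q hq)
    · by_cases hqF : q ∈ F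
      · exact absurd hpq.symm (hFa q hqF p (hp.resolve_right hpF)).2
      · simp [hpF, hqF]

/-- A vertex `q` with no neighbour in `a` or in `F` is useless for packings, so inserting it in `F`
creates none. -/
lemma acyclicAt_of_cone_powAt {s : ℕ} {a : Multiset V} {A : Finset V} {S : Finset V → Prop} {q : V}
    (hqA : q ∉ A)
    (hS : ∀ F, A ⊆ F → S F → ¬ PowAt G s a F → S (insert q F) ∧ S (F.erase q) ∧ ¬ Near G F q)
    (hq : ∀ p ∈ a, ¬ G.Adj q p) (i : ℕ) :
    AcyclicAt K {F | A ⊆ F ∧ S F ∧ ¬ PowAt G s a F} i := by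
  classical
  refine AcyclicAt.of_cone (q := q) ?_ i
  rintro F ⟨hAF, hSF, hF⟩
  obtain ⟨h1, h2, h3⟩ := hS F hAF hSF hF
  refine ⟨⟨hAF.trans (Finset.subset_insert _ _), h1, fun h => hF ?_⟩,
    fun z hz => Finset.mem_erase.2 ⟨fun h => hqA (h ▸ hz), hAF hz⟩, h2,
    fun h => hF (h.mono le_rfl (Finset.erase_subset _ _))⟩
  refine h.of_insert (fun f hf hqf => h3 ⟨f, hf, hqf⟩) ?_
  rw [Multiset.filter_eq_nil.2 hq]
  simp

/-- If `a` contains a core of order `s` that is far from the rest of `a`, then the rest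
is empty. -/
lemma eq_zero_of_not_acyclicAt {s : ℕ} {a b : Multiset V} {A : Finset V} {i : ℕ}
    (hA : ∀ x ∈ a + b, x ∉ A) (hpow : PowAt G s a ∅) (hsym : SymAt G (s + 1) a ∅)
    (hfar : ∀ q ∈ b, ∀ p ∈ a, ¬ G.Adj q p)
    (h : ¬ AcyclicAt K (differenceFamily G (s + 1) (a + b) A) i) : b = 0 := by
  by_contra hb
  obtain ⟨q, hq⟩ := Multiset.exists_mem_of_ne_zero hb
  obtain ⟨F₀, -, -, hF₀⟩ := nonempty_of_not_acyclicAt h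
  have hsym' : ∀ F, SymAt G (s + 1) (a + b) F := fun F =>
    hsym.mono (Multiset.le_add_right _ _) (Finset.empty_subset _)
  refine h (acyclicAt_of_cone_powAt (q := q) (hA q (Multiset.mem_add.2 (Or.inr hq)))
    (fun F _ _ hF => ⟨hsym' _, hsym' _, fun hn => hF ?_⟩) (fun p hp hqp => ?_) i)
  · exact (hpow.of_empty.add (powAt_half hn)).of_le
      (add_le_add_right (Multiset.singleton_le.2 hq) _)
  · rcases Multiset.mem_add.1 hp with hp | hp
    · exact hfar q hq p hp hqp
    · exact hF₀ ((hpow.of_empty.add (powAt_edge hqp F₀)).of_le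
        (add_le_add_right (singleton_add_singleton_le hq hp hqp.ne) _))

/-- The case in which every vertex near the core `a` increases the order of the core. -/
lemma not_acyclicAt_far_of_core {s : ℕ} {a c : Multiset V} {A : Finset V} {i : ℕ}
    (hac : a ≤ c) (hA : ∀ x ∈ c, x ∉ A) (hpow : PowAt G s a ∅) (hsym : SymAt G (s + 1) a ∅)
    (hN : ∀ q, (∃ x ∈ a, q = x ∨ G.Adj q x) → PowAt G (s + 1) ({q} + a) ∅)
    (hlt : ∀ F, Indep G F → Far G F a → ¬ PowAt G (s + 1) a F)
    (h : ¬ AcyclicAt K (differenceFamily G (s + 1) c A) i) :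
    c = a ∧ ¬ AcyclicAt K {F | A ⊆ F ∧ Indep G F ∧ Far G F a} i := by
  obtain ⟨b, rfl⟩ := Multiset.le_iff_exists_add.1 hac
  obtain ⟨F₀, -, -, hF₀⟩ := nonempty_of_not_acyclicAt h
  have hb : b = 0 := by
    refine eq_zero_of_not_acyclicAt hA hpow hsym (fun q hq p hp hqp => hF₀ ?_) h
    refine (hN q ⟨p, hp, Or.inr hqp⟩).of_empty.of_le ?_
    rw [add_comm]
    exact add_le_add_right (Multiset.singleton_le.2 hq) _
  subst hb
  rw [add_zero] at h ⊢
  refine ⟨rfl, fun h' => h (h'.congr fun F => ?_)⟩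
  refine and_congr_right fun _ => ⟨fun hF => ⟨hsym.mono le_rfl (Finset.empty_subset _),
    hlt F hF.1 hF.2⟩, fun hF => ⟨indep_of_not_powAt hF.2, fun f hf x hx => ?_⟩⟩
  by_contra h'
  refine hF.2 (((hN f ⟨x, hx, ?_⟩).of_empty).of_singleton_add hf)
  tauto

/-- The exponent collapses to the core, of size 2s + 1, and 2s + 2 is the shift given by one of its
edges taken `s` times. -/
lemma le_regularity_of_core {s : ℕ} {a c : Multiset V} {A : Finset V} {i : ℕ}
    (hac : a ≤ c) (hA : ∀ x ∈ c, x ∉ A) (hpow : PowAt G s a ∅) (hsym : SymAt G (s + 1) a ∅)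
    (hN : ∀ q, (∃ x ∈ a, q = x ∨ G.Adj q x) → PowAt G (s + 1) ({q} + a) ∅)
    (hcard : a.card = 2 * s + 1) {x y : V} (hx : x ∈ a) (hy : y ∈ a) (hxy : G.Adj x y)
    (h : ¬ AcyclicAt K (differenceFamily G (s + 1) c A) i) :
    LERegularity (c.card - A.card + i + 1 : ℤ) (edgeIdeal K G ^ (s + 1)) ∧
      LERegularity (c.card - A.card + i + 1 : ℤ) (symbolicPower (edgeIdeal K G) (s + 1)) := by
  obtain ⟨rfl, h1⟩ := not_acyclicAt_far_of_core hac hA hpow hsym hN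
    (fun F hF hFa => not_powAt_of_far hF hFa (by omega)) h
  have h2 := le_regularity_of_far (m := s) hxy hx hy h1
  rw [hcard]
  exact ⟨h2.1.mono (by push_cast; omega), h2.2.mono (by push_cast; omega)⟩

/-- The case of second powers. -/
lemma le_regularity_of_difference_two {a : Multiset V} {A : Finset V} {i : ℕ}
    (hA : ∀ x ∈ a, x ∉ A) (h : ¬ AcyclicAt K (differenceFamily G 2 a A) i) :
    LERegularity (a.card - A.card + i + 1 : ℤ) (edgeIdeal K G ^ 2) ∧
      LERegularity (a.card - A.card + i + 1 : ℤ) (symbolicPower (edgeIdeal K G) 2) := by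
  obtain ⟨F, -, hs, hp⟩ := nonempty_of_not_acyclicAt h
  obtain ⟨x, y, z, hT, hle⟩ := exists_triangle_of_symAt_two (hs.add_nsmul)
    (fun h => hp h.of_add_nsmul)
  have hfar : Far G F ({x} + {y} + {z}) :=
    hT.far fun h' => hp (h'.of_le hle).of_add_nsmul_self
  refine le_regularity_of_core (s := 1)
    (le_of_le_add_nsmul hle fun t ht htF => (hfar t htF t ht).1 rfl) hA (hT.powAt_one _)
    (hT.symAt_two _) (fun q hq => hT.powAt_two hq _) (by simp) (x := x) (y := y) (by simp)
    (by simp) hT.1 h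

/-- The differences of degree complexes of third powers. -/
lemma hasObstruction_or_of_mem_difference {a : Multiset V} {F : Finset V} (hs : SymAt G 3 a F)
    (hp : ¬ PowAt G 3 a F) : HasObstruction G a ∨
      ∃ x y z v, IsTriangle G x y z ∧ {x} + {y} + {z} + {v} ≤ a ∧ Far G F ({x} + {y} + {z}) ∧
        Near G F v := by
  have hp' : ∀ b : Multiset V, b ≤ a + 3 • F.val → ¬ PowAt G 3 b F :=
    fun b hb h => hp (h.of_le hb).of_add_nsmul_self
  rcases hasObstruction hs.add_nsmul (fun h => hp h.of_add_nsmul) with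
    ⟨x, y, z, u, v, hT, huv, hle⟩ | ⟨x, y, z, u, hT, hxu, hyu, hzu, hle⟩ |
      ⟨x, y, z, u, v, hxy, hyz, hzu, huv, hvx, hle⟩
  · have hfar : Far G F ({x} + {y} + {z}) := by
      refine hT.far fun h => hp' _ hle ?_
      rw [add_assoc _ ({u} : Multiset V)]
      exact h.add (powAt_edge huv F)
    have hTF : ∀ t ∈ ({x} + {y} + {z} : Multiset V), t ∉ F :=
      fun t ht htF => (hfar t htF t ht).1 rfl
    -- An edge with an end in `F` shows up in `a` only as its other end, a vertex near `F`.
    have half : ∀ {u v : V}, G.Adj u v → {x} + {y} + {z} + {u} + {v} ≤ a + 3 • F.val → u ∈ F →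
        v ∉ F ∧ {x} + {y} + {z} + {v} ≤ a := by
      intro u v huv hle hu
      have hv : v ∉ F := fun hv => hp (PowAt.of_adj_mem huv hu hv 3)
      refine ⟨hv, le_of_le_add_nsmul (t := 3) (F := F) (le_trans ?_ hle) fun t ht => ?_⟩
      · rw [add_right_comm _ ({u} : Multiset V)]
        exact Multiset.le_add_right _ _
      · rcases Multiset.mem_add.1 ht with ht | ht
        · exact hTF t ht
        · rwa [Multiset.mem_singleton.1 ht]
    by_cases hu : u ∈ F
    · exact Or.inr ⟨x, y, z, v, hT, (half huv hle hu).2, hfar, u, hu, huv.symm⟩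
    by_cases hv : v ∈ F
    · rw [add_right_comm _ ({u} : Multiset V)] at hle
      exact Or.inr ⟨x, y, z, u, hT, (half huv.symm hle hv).2, hfar, v, hv, huv⟩
    refine Or.inl (Or.inl ⟨x, y, z, u, v, hT, huv, le_of_le_add_nsmul hle fun t ht => ?_⟩)
    rw [Multiset.mem_add, Multiset.mem_add, Multiset.mem_singleton, Multiset.mem_singleton] at ht
    rcases ht with (ht | rfl) | rfl
    · exact hTF t ht
    · exact hu
    · exact hv
  · refine Or.inl (Or.inr (Or.inl ⟨x, y, z, u, hT, hxu, hyu, hzu, le_of_le_add_nsmul hle ?_⟩))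
    have main : ∀ {x y z u : V}, G.Adj x u → G.Adj y u → G.Adj z u →
        {x} + {y} + {z} + {u} ≤ a + 3 • F.val → u ∉ F := by
      intro x y z u hx hy hz hle hu
      refine hp' _ ((Multiset.le_add_right _ _).trans hle)
        (((powAt_half ⟨u, hu, hx⟩).add (powAt_half ⟨u, hu, hy⟩)).add (powAt_half ⟨u, hu, hz⟩))
    intro t ht
    simp only [Multiset.mem_add, Multiset.mem_singleton] at ht
    rcases ht with ((rfl | rfl) | rfl) | rfl
    · exact main hT.1.symm hT.2.2.symm hxu.symm (le_of_eq_of_le (by abel) hle)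
    · exact main hT.1 hT.2.1.symm hyu.symm (le_of_eq_of_le (by abel) hle)
    · exact main hT.2.2 hT.2.1 hzu.symm (le_of_eq_of_le (by abel) hle)
    · exact main hxu hyu hzu hle
  · refine Or.inl (Or.inr (Or.inr ⟨x, y, z, u, v, hxy, hyz, hzu, huv, hvx,
      le_of_le_add_nsmul hle ?_⟩))
    have main : ∀ {x y z u v : V}, G.Adj x y → G.Adj z u → G.Adj v x →
        {x} + {y} + {z} + {u} + {v} ≤ a + 3 • F.val → x ∉ F := by
      intro x y z u v hxy hzu hvx hle hx
      refine hp' ({y} + {v} + ({z} + {u})) (le_trans ?_ hle)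
        (((powAt_half ⟨x, hx, hxy.symm⟩).add (powAt_half ⟨x, hx, hvx⟩)).add (powAt_edge hzu F))
      exact le_of_le_of_eq (Multiset.le_add_right _ {x}) (by abel)
    intro t ht
    simp only [Multiset.mem_add, Multiset.mem_singleton] at ht
    rcases ht with (((rfl | rfl) | rfl) | rfl) | rfl
    · exact main hxy hzu hvx hle
    · exact main hyz huv hxy (le_of_eq_of_le (by abel) hle)
    · exact main hzu hvx hyz (le_of_eq_of_le (by abel) hle)
    · exact main huv hxy hzu (le_of_eq_of_le (by abel) hle)
    · exact main hvx hyz huv (le_of_eq_of_le (by abel) hle)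

/-- The obstruction is a five-cycle. -/
lemma le_regularity_of_fiveCycle {a : Multiset V} {A : Finset V} {i : ℕ} (hA : ∀ x ∈ a, x ∉ A)
    {x y z u v : V} (hxy : G.Adj x y) (hyz : G.Adj y z) (hzu : G.Adj z u) (huv : G.Adj u v)
    (hvx : G.Adj v x) (hle : {x} + {y} + {z} + {u} + {v} ≤ a)
    (h : ¬ AcyclicAt K (differenceFamily G 3 a A) i) :
    LERegularity (a.card - A.card + i + 1 : ℤ) (edgeIdeal K G ^ 3) ∧
      LERegularity (a.card - A.card + i + 1 : ℤ) (symbolicPower (edgeIdeal K G) 3) := by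
  refine le_regularity_of_core (s := 2) hle hA ?_ (symAt_fiveCycle hxy hyz hzu huv hvx _) ?_
    (by simp) (x := x) (y := y) (by simp) (by simp) hxy h
  · refine ((powAt_edge hxy ∅).add (powAt_edge hzu ∅)).of_le ?_
    exact le_of_le_of_eq (Multiset.le_add_right _ {v}) (by abel)
  -- Doubling `x` splits the cycle into xy, vx, zu; matching `x` with an outside neighbour leaves
  -- the path yzuv with a perfect matching.
  · have main : ∀ {q x y z u v : V}, G.Adj x y → G.Adj y z → G.Adj z u → G.Adj u v → G.Adj v x →
        (q = x ∨ G.Adj q x) → PowAt G 3 ({q} + ({x} + {y} + {z} + {u} + {v})) ∅ := by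
      rintro q x y z u v hxy hyz hzu huv hvx (rfl | hq)
      · exact (((powAt_edge hxy ∅).add (powAt_edge hvx ∅)).add (powAt_edge hzu ∅)).of_le
          (le_of_eq (by abel))
      · exact (((powAt_edge hq ∅).add (powAt_edge hyz ∅)).add (powAt_edge huv ∅)).of_le
          (le_of_eq (by abel))
    rintro q ⟨t, ht, hq⟩
    simp only [Multiset.mem_add, Multiset.mem_singleton] at ht
    rcases ht with (((rfl | rfl) | rfl) | rfl) | rfl
    · exact main hxy hyz hzu huv hvx hq
    · exact (main hyz hzu huv hvx hxy hq).of_le (le_of_eq (by abel))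
    · exact (main hzu huv hvx hxy hyz hq).of_le (le_of_eq (by abel))
    · exact (main huv hvx hxy hyz hzu hq).of_le (le_of_eq (by abel))
    · exact (main hvx hxy hyz hzu huv hq).of_le (le_of_eq (by abel))

/-- The obstruction is a triangle with an edge in its closed neighbourhood. -/
lemma le_regularity_of_triangle_near_edge {a : Multiset V} {A : Finset V} {i : ℕ}
    (hA : ∀ x ∈ a, x ∉ A) {x y z u v : V} (hT : IsTriangle G x y z) (huv : G.Adj u v)
    (hu : ∃ t ∈ ({x} + {y} + {z} : Multiset V), u = t ∨ G.Adj u t)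
    (hv : ∃ t ∈ ({x} + {y} + {z} : Multiset V), v = t ∨ G.Adj v t)
    (hle : {x} + {y} + {z} + {u} + {v} ≤ a)
    (h : ¬ AcyclicAt K (differenceFamily G 3 a A) i) :
    LERegularity (a.card - A.card + i + 1 : ℤ) (edgeIdeal K G ^ 3) ∧
      LERegularity (a.card - A.card + i + 1 : ℤ) (symbolicPower (edgeIdeal K G) 3) := by
  rw [add_assoc _ ({u} : Multiset V)] at hle
  refine le_regularity_of_core (s := 2) hle hA ((hT.powAt_one ∅).add (powAt_edge huv ∅))
    ((hT.symAt_two ∅).add (symAt_edge huv ∅)) ?_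
    (by simp) (x := x) (y := y) (by simp) (by simp) hT.1 h
  rintro q ⟨t, ht, hq⟩
  have hT' : (∃ t ∈ ({x} + {y} + {z} : Multiset V), q = t ∨ G.Adj q t) →
      PowAt G 3 ({q} + ({x} + {y} + {z} + ({u} + {v}))) ∅ := fun h =>
    ((hT.powAt_two h ∅).add (powAt_edge huv ∅)).of_le (le_of_eq (by abel))
  rw [Multiset.mem_add, Multiset.mem_add (s := {u}), Multiset.mem_singleton,
    Multiset.mem_singleton] at ht
  rcases ht with ht | rfl | rfl
  · exact hT' ⟨t, ht, hq⟩
  · rcases hq with rfl | hq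
    · exact hT' hu
    · exact ((powAt_edge hq ∅).add (hT.powAt_two hv ∅)).of_le (le_of_eq (by abel))
  · rcases hq with rfl | hq
    · exact hT' hv
    · exact ((powAt_edge hq ∅).add (hT.powAt_two hu ∅)).of_le (le_of_eq (by abel))

/-- A triangle and an edge with exactly one end in the closed neighbourhood of the triangle
give a cone. -/
lemma acyclicAt_of_triangle_half_near_edge {a : Multiset V} {A : Finset V}
    (hA : ∀ x ∈ a, x ∉ A) {x y z u v : V} (hT : IsTriangle G x y z) (huv : G.Adj u v)
    (hu : ¬ ∃ t ∈ ({x} + {y} + {z} : Multiset V), u = t ∨ G.Adj u t)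
    (hv : ∃ t ∈ ({x} + {y} + {z} : Multiset V), v = t ∨ G.Adj v t)
    (hle : {x} + {y} + {z} + {u} + {v} ≤ a) (i : ℕ) :
    AcyclicAt K (differenceFamily G 3 a A) i := by
  classical
  by_contra h
  apply h
  obtain ⟨F₀, -, -, hF₀⟩ := nonempty_of_not_acyclicAt h
  have hsym : ∀ F, SymAt G 3 a F := fun F =>
    ((hT.symAt_two F).add (symAt_edge huv F)).mono (by rwa [← add_assoc]) subset_rfl
  obtain ⟨b, rfl⟩ := Multiset.le_iff_exists_add.1 hle
  have huA := hA u (by simp)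
  refine AcyclicAt.of_cone (q := u) ?_ i
  rintro F ⟨hAF, -, hF⟩
  refine ⟨⟨hAF.trans (Finset.subset_insert _ _), hsym _, fun h => hF ?_⟩,
    fun w hw => Finset.mem_erase.2 ⟨fun h => huA (h ▸ hw), hAF hw⟩, hsym _,
    fun h => hF (h.mono le_rfl (Finset.erase_subset _ _))⟩
  refine h.of_insert (fun f hf huf => hF ?_) ?_
  · refine ((powAt_half ⟨f, hf, huf⟩).add (hT.powAt_two hv F)).of_le ?_
    exact le_of_le_of_eq (Multiset.le_add_right _ b) (by abel)
  -- The chosen copy of `v` is the only neighbour of `u` in the exponent: another one would pair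
  -- with `u` while `v` joins the triangle for two more edges. So `u` can be added to `F` freely.
  · have h1 : b.filter (G.Adj u) = 0 := by
      refine Multiset.filter_eq_nil.2 fun w hw huw => hF₀ ?_
      refine ((powAt_edge huw F₀).add (hT.powAt_two hv F₀)).of_le ?_
      have := add_le_add_right (Multiset.singleton_le.2 hw) ({x} + {y} + {z} + {u} + {v})
      convert this using 1
      abel
    have h2 : ({x} + {y} + {z} : Multiset V).filter (G.Adj u) = 0 :=
      Multiset.filter_eq_nil.2 fun w hw huw => hu ⟨w, hw, Or.inr huw⟩
    have h3 : ({u} : Multiset V).filter (G.Adj u) = 0 := by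
      simp [Multiset.filter_singleton]
    rw [Multiset.filter_add, Multiset.filter_add, Multiset.filter_add, h1, h2, h3]
    refine le_trans (Multiset.card_le_card (Multiset.filter_le (G.Adj u) {v} |> fun h => ?_) :
      _ ≤ ({v} : Multiset V).card) ?_
    · simpa using h
    · rw [Multiset.card_singleton]
      exact Multiset.one_le_count_iff_mem.2 (by simp)

end Difference

/-! ### Third powers: the remaining obstructions -/

section ThirdPower

variable {K V : Type*} [Field K] [Fintype V] [LinearOrder V] {G : SimpleGraph V}

/-- The obstruction consists of two triangles that are far from each other. -/
lemma le_regularity_of_two_triangles {a : Multiset V} {A : Finset V} {i : ℕ}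
    (hA : ∀ x ∈ a, x ∉ A) {x y z u v w : V} (hT : IsTriangle G x y z) (hT' : IsTriangle G u v w)
    (hfar : ∀ s ∈ ({x} + {y} + {z} : Multiset V), ∀ t ∈ ({u} + {v} + {w} : Multiset V),
      s ≠ t ∧ ¬ G.Adj s t)
    (hle : {x} + {y} + {z} + ({u} + {v} + {w}) ≤ a)
    (h : ¬ AcyclicAt K (differenceFamily G 3 a A) i) :
    LERegularity (a.card - A.card + i + 1 : ℤ) (symbolicPower (edgeIdeal K G) 3) := by
  have hN : ∀ q, (∃ t ∈ ({x} + {y} + {z} + ({u} + {v} + {w}) : Multiset V), q = t ∨ G.Adj q t) →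
      PowAt G 3 ({q} + ({x} + {y} + {z} + ({u} + {v} + {w}))) ∅ := by
    rintro q ⟨t, ht, hq⟩
    rcases Multiset.mem_add.1 ht with ht | ht
    · exact ((hT.powAt_two ⟨t, ht, hq⟩ ∅).add (hT'.powAt_one ∅)).of_le (le_of_eq (by abel))
    · exact ((hT'.powAt_two ⟨t, ht, hq⟩ ∅).add (hT.powAt_one ∅)).of_le (le_of_eq (by abel))
  have hlt : ∀ F, Indep G F → Far G F ({x} + {y} + {z} + ({u} + {v} + {w})) →
      ¬ PowAt G 3 ({x} + {y} + {z} + ({u} + {v} + {w})) F := by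
    intro F hF hFa hP
    refine not_powAt_of_far (s := 2) hF
      (hFa.mono subset_rfl fun t ht => Multiset.mem_add.2 (Or.inr ht)) (by simp)
      (hP.of_add_of_card_le (by simp) hfar fun t ht f hf => ?_)
    have := hFa f hf t (Multiset.mem_add.2 (Or.inl ht))
    exact ⟨this.1.symm, fun h => this.2 h.symm⟩
  have hsym : SymAt G 4 ({x} + {y} + {z} + ({u} + {v} + {w})) ∅ :=
    (hT.symAt_two ∅).add (hT'.symAt_two ∅)
  have hpow : PowAt G 2 ({x} + {y} + {z} + ({u} + {v} + {w})) ∅ :=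
    (hT.powAt_one ∅).add (hT'.powAt_one ∅)
  have hcard : (({x} + {y} + {z} + ({u} + {v} + {w}) : Multiset V).card : ℤ) = 6 := by simp
  obtain ⟨c, hc⟩ : ∃ c : Multiset V, c = {x} + {y} + {z} + ({u} + {v} + {w}) := ⟨_, rfl⟩
  have hTc : ∀ t ∈ ({x} + {y} + {z} : Multiset V), t ∈ c := fun t ht =>
    hc ▸ Multiset.mem_add.2 (Or.inl ht)
  have hTc' : ∀ t ∈ ({u} + {v} + {w} : Multiset V), t ∈ c := fun t ht =>
    hc ▸ Multiset.mem_add.2 (Or.inr ht)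
  have hu : u ∈ ({u} + {v} + {w} : Multiset V) := by simp
  have hv : v ∈ ({u} + {v} + {w} : Multiset V) := by simp
  rw [← hc] at hN hlt hle hsym hpow hcard
  obtain ⟨hac, h1⟩ := not_acyclicAt_far_of_core (s := 2) hle hA hpow
    (hsym.anti (by norm_num)) hN hlt h
  subst hac
  have h2 : ¬ AcyclicAt K {F | A ⊆ F ∧ F ⊆ farSet G a ∧ Indep G F} i := fun h' =>
    h1 (h'.congr fun F => by
      simp only [Set.mem_ofPred_eq, subset_farSet_iff]
      tauto)
  have hmem : ∀ {t p : V}, p ∈ farSet G a → t ∈ a → p ≠ t ∧ ¬ G.Adj p t :=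
    fun hp ht => mem_farSet.1 hp _ ht
  -- The edge uv of the second triangle suspends the far complex once; the edge xy is then used with
  -- m = 2, and 4 + (i + 1) + 2 is |a| + i + 1 for |a| = 6.
  have h3 := not_acyclicAt_suspension (S := Indep G) (fun E F hEF hF => hF.mono hEF)
    (x := u) (y := v) (fun h => (hmem h (hTc' u hu)).1 rfl)
    (fun h => (hmem h (hTc' v hv)).1 rfl) hT'.1.ne h2
  have hW : ∀ s ∈ ({x} + {y} + {z} : Multiset V), ∀ p ∈ insert u (insert v (farSet G a)),
      p ≠ s ∧ ¬ G.Adj p s := by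
    intro s hs p hp
    rw [Finset.mem_insert, Finset.mem_insert] at hp
    rcases hp with rfl | rfl | hp
    · exact ⟨((hfar s hs p hu).1).symm, fun h => (hfar s hs p hu).2 h.symm⟩
    · exact ⟨((hfar s hs p hv).1).symm, fun h => (hfar s hs p hv).2 h.symm⟩
    · exact hmem hp (hTc s hs)
  refine (le_regularity_of_indep_subset (m := 2) (A := A) (i := i + 1) hT.1 (hW x (by simp))
    (hW y (by simp)) fun h' => h3 (h'.congr fun F => ?_)).2.mono ?_
  · refine and_congr_right fun _ => and_congr_right fun hF => ⟨fun hI =>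
      ⟨hI.mono Finset.inter_subset_left, fun h => hI _ h.1 _ h.2 hT'.1⟩, fun ⟨hI, huv⟩ => ?_⟩
    have far : ∀ p ∈ F, p = u ∨ p = v ∨ p ∈ F ∩ farSet G a := by
      intro p hp
      have := hF hp
      rw [Finset.mem_insert, Finset.mem_insert] at this
      rw [Finset.mem_inter]
      tauto
    intro p hp q hq hpq
    rcases far p hp with rfl | rfl | hp' <;> rcases far q hq with rfl | rfl | hq'
    · exact hpq.ne rfl
    · exact huv ⟨hp, hq⟩
    · exact (hmem (Finset.mem_of_mem_inter_right hq') (hTc' _ hu)).2 hpq.symm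
    · exact huv ⟨hq, hp⟩
    · exact hpq.ne rfl
    · exact (hmem (Finset.mem_of_mem_inter_right hq') (hTc' _ hv)).2 hpq.symm
    · exact (hmem (Finset.mem_of_mem_inter_right hp') (hTc' _ hu)).2 hpq
    · exact (hmem (Finset.mem_of_mem_inter_right hp') (hTc' _ hv)).2 hpq
    · exact hI p hp' q hq' hpq
  · rw [hcard]
    push_cast
    omega

/-- The obstruction is a triangle with an edge far from it. -/
lemma le_regularity_of_triangle_far_edge {a : Multiset V} {A : Finset V} {i : ℕ}
    (hA : ∀ x ∈ a, x ∉ A) {x y z u v : V} (hT : IsTriangle G x y z) (huv : G.Adj u v)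
    (hu : ¬ ∃ t ∈ ({x} + {y} + {z} : Multiset V), u = t ∨ G.Adj u t)
    (hv : ¬ ∃ t ∈ ({x} + {y} + {z} : Multiset V), v = t ∨ G.Adj v t)
    (hle : {x} + {y} + {z} + {u} + {v} ≤ a)
    (h : ¬ AcyclicAt K (differenceFamily G 3 a A) i) :
    LERegularity (a.card - A.card + i + 1 : ℤ) (symbolicPower (edgeIdeal K G) 3) := by
  obtain ⟨F₀, -, -, hF₀⟩ := nonempty_of_not_acyclicAt h
  obtain ⟨b, rfl⟩ := Multiset.le_iff_exists_add.1 hle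
  obtain ⟨c, hc⟩ : ∃ c, c = {u} + {v} + b := ⟨_, rfl⟩
  have hac : {x} + {y} + {z} + {u} + {v} + b = {x} + {y} + {z} + c := by
    rw [hc]
    abel
  have hTc : ∀ s ∈ ({x} + {y} + {z} : Multiset V), ∀ t ∈ c, s ≠ t ∧ ¬ G.Adj s t := by
    intro s hs t ht
    by_contra hst
    have hst' : ∃ s ∈ ({x} + {y} + {z} : Multiset V), t = s ∨ G.Adj t s := by
      refine ⟨s, hs, ?_⟩
      rw [G.adj_comm]
      tauto
    rw [hc, Multiset.mem_add, Multiset.mem_add (s := ({u} : Multiset V)), Multiset.mem_singleton,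
      Multiset.mem_singleton] at ht
    rcases ht with (rfl | rfl) | ht
    · exact hu hst'
    · exact hv hst'
    · refine hF₀ (((hT.powAt_two hst' F₀).add (powAt_edge huv F₀)).of_le ?_)
      have := add_le_add_right (Multiset.singleton_le.2 ht) ({x} + {y} + {z} + {u} + {v})
      convert this using 1
      abel
  rw [hac] at hA h hF₀ ⊢
  by_cases hT' : ∃ p q r, IsTriangle G p q r ∧ {p} + {q} + {r} ≤ c
  · obtain ⟨p, q, r, hT', hle'⟩ := hT'
    exact le_regularity_of_two_triangles hA hT hT'
      (fun s hs t ht => hTc s hs t (Multiset.mem_of_le hle' ht)) (add_le_add_right hle' _) h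
  have hsym : ∀ F, SymAt G 3 ({x} + {y} + {z} + c) F := fun F =>
    ((hT.symAt_two F).add (symAt_edge huv F)).mono
      (add_le_add_right (by rw [hc]; exact Multiset.le_add_right _ _) _) subset_rfl
  -- Without a triangle in `c`, failure of `PowAt G 3` for the whole exponent means that `F` is far
  -- from the first triangle and `SymAt G 2 c F` fails. The triangle contributes one edge to
  -- packings, and its edge xy carries the suspension.
  refine (le_regularity_symbolicPower_of_edge (K := K) (k := 2) (m := 1) (c := c) (A := A)
    (W := farSet G ({x} + {y} + {z})) (i := i) hT.1 (fun t ht => mem_farSet.2 fun s hs => ?_)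
    (fun t ht => hA t (Multiset.mem_add.2 (Or.inr ht))) (fun w hw => mem_farSet.1 hw x (by simp))
    (fun w hw => mem_farSet.1 hw y (by simp)) fun h' => h (h'.congr fun F => ?_)).mono ?_
  · have := hTc s hs t ht
    exact ⟨this.1.symm, fun h => this.2 h.symm⟩
  · refine and_congr_right fun _ => ⟨fun ⟨hF, hs⟩ => ⟨hsym F, fun hp => hs ?_⟩, fun ⟨_, hp⟩ => ?_⟩
    · refine PowAt.symAt (hp.of_add_of_card_le (by simp) hTc fun t ht f hf => ?_)
      have := mem_farSet.1 (hF hf) t ht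
      exact ⟨this.1.symm, fun h => this.2 h.symm⟩
    · refine ⟨subset_farSet_iff.2 (hT.far fun h => hp ?_), fun hs => ?_⟩
      · refine (h.add (powAt_edge huv F)).of_le (add_le_add_right ?_ _)
        rw [hc]
        exact Multiset.le_add_right _ _
      · have hp2 : ¬ PowAt G 2 c F := fun h =>
          hp (((hT.powAt_one F).add h).of_le le_rfl)
        obtain ⟨p, q, r, hT2, hle2⟩ := exists_triangle_of_symAt_two hs.add_nsmul
          (fun h => hp2 h.of_add_nsmul)
        have hfar : Far G F ({p} + {q} + {r}) :=
          hT2.far fun h => hp2 (h.of_le hle2).of_add_nsmul_self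
        exact hT' ⟨p, q, r, hT2,
          le_of_le_add_nsmul hle2 fun t ht htF => (hfar t htF t ht).1 rfl⟩
  · simp only [Multiset.card_add, Multiset.card_singleton]
    push_cast
    omega

/-- A family is acyclic if its pieces of sets near a vertex of `S` are disjoint and acyclic, and
so is the remaining piece. -/
lemma acyclicAt_of_near_pieces {𝓕 : Set (Finset V)} (h𝓕 : 𝓕.OrdConnected) {i : ℕ} (S : Finset V)
    (hS : ∀ F ∈ 𝓕, ∀ p ∈ S, ∀ q ∈ S, Near G F p → Near G F q → p = q)
    (hp : ∀ p ∈ S, AcyclicAt K {F | F ∈ 𝓕 ∧ Near G F p} i)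
    (h0 : AcyclicAt K {F | F ∈ 𝓕 ∧ ∀ p ∈ S, ¬ Near G F p} i) : AcyclicAt K 𝓕 i := by
  have near_mono : ∀ {E F : Finset V} {p : V}, E ⊆ F → Near G E p → Near G F p :=
    fun hEF ⟨f, hf, h⟩ => ⟨f, hEF hf, h⟩
  induction S using Finset.induction_on generalizing 𝓕 with
  | empty => exact h0.congr fun F => by simp
  | insert v S hv ih =>
    -- Being near `v` is upward closed, so this piece splits off; disjointness keeps the other
    -- pieces intact in the remainder.
    refine AcyclicAt.of_sdiff h𝓕 (𝓑 := {F | F ∈ 𝓕 ∧ Near G F v}) (fun F hF => hF.1)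
      (fun E hE F hF hEF => ⟨hF, near_mono hEF hE.2⟩) ?_ (hp v (Finset.mem_insert_self _ _))
    refine ih ⟨?_⟩ ?_ ?_ ?_
    · rintro E ⟨hE, -⟩ F ⟨hF, hF'⟩ D hD
      exact ⟨h𝓕.out hE hF hD, fun h => hF' ⟨hF, near_mono hD.2 h.2⟩⟩
    · exact fun F hF p hp q hq => hS F hF.1 p (Finset.mem_insert_of_mem hp) q
        (Finset.mem_insert_of_mem hq)
    · intro p hpS
      refine (hp p (Finset.mem_insert_of_mem hpS)).congr fun F =>
        ⟨fun ⟨hF, hn⟩ => ⟨⟨hF, fun h => hv ?_⟩, hn⟩, fun ⟨hF, hn⟩ => ⟨hF.1, hn⟩⟩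
      rw [← hS F hF p (Finset.mem_insert_of_mem hpS) v (Finset.mem_insert_self _ _) hn h.2]
      exact hpS
    · refine h0.congr fun F => ⟨fun ⟨hF, hn⟩ =>
        ⟨⟨hF, fun h => hn v (Finset.mem_insert_self _ _) h.2⟩,
          fun p hp => hn p (Finset.mem_insert_of_mem hp)⟩, fun ⟨hF, hn⟩ => ⟨hF.1, fun p hp => ?_⟩⟩
      rcases Finset.mem_insert.1 hp with rfl | hp
      · exact fun h => hF.2 ⟨hF.1, h⟩
      · exact hn p hp

/-- A lower bound for the regularity from the independent sets that are far from `a` and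
near `u`. -/
lemma le_regularity_of_near {m : ℕ} {A : Finset V} {a : Multiset V} {u x y : V} (hxy : G.Adj x y)
    (hx : x ∈ a) (hy : y ∈ a) {i : ℕ}
    (h : ¬ AcyclicAt K {F | A ⊆ F ∧ Indep G F ∧ Far G F a ∧ Near G F u} i) :
    LERegularity (2 * m - A.card + i + 1 : ℤ) (edgeIdeal K G ^ (m + 1)) ∧
      LERegularity (2 * m - A.card + i + 1 : ℤ) (symbolicPower (edgeIdeal K G) (m + 1)) := by
  classical
  by_cases h1 : AcyclicAt K {F | A ⊆ F ∧ Indep G F ∧ Far G F a} i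
  -- The far sets not near `u` are the independent sets of a smaller vertex set. Cohomology of the
  -- near ones comes from all far sets in degree `i`, or from these in degree `i - 1`, hence the
  -- loss of one in the bound.
  · by_cases h2 : ∀ j, j + 1 = i →
        AcyclicAt K {F | A ⊆ F ∧ F ⊆ (farSet G a).filter (fun w => ¬ G.Adj u w) ∧ Indep G F} j
    · refine absurd (AcyclicAt.of_sdiff_prev (𝓕 := {F | A ⊆ F ∧ Indep G F ∧ Far G F a}) ⟨?_⟩
        ?_ ?_ h1 fun j hj => (h2 j hj).congr fun F => ?_) h
      · rintro E ⟨hE, -⟩ F ⟨-, hF2, hF3⟩ D ⟨hED, hDF⟩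
        exact ⟨hE.trans hED, hF2.mono hDF, hF3.mono hDF fun _ h => h⟩
      · exact fun F hF => ⟨hF.1, hF.2.1, hF.2.2.1⟩
      · rintro E ⟨-, -, -, f, hf, hfu⟩ F ⟨hF1, hF2, hF3⟩ hEF
        exact ⟨hF1, hF2, hF3, f, hEF hf, hfu⟩
      · constructor
        · rintro ⟨hF1, hF2, hF3⟩
          refine ⟨⟨hF1, hF3, subset_farSet_iff.1 (hF2.trans (Finset.filter_subset _ _))⟩, ?_⟩
          rintro ⟨-, -, -, f, hf, hfu⟩
          exact (Finset.mem_filter.1 (hF2 hf)).2 hfu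
        · rintro ⟨⟨hF1, hF2, hF3⟩, hF4⟩
          refine ⟨hF1, fun f hf => Finset.mem_filter.2 ⟨subset_farSet_iff.2 hF3 hf, fun hfu => ?_⟩,
            hF2⟩
          exact hF4 ⟨hF1, hF2, hF3, f, hf, hfu⟩
    · push Not at h2
      obtain ⟨j, rfl, hj⟩ := h2
      have h3 := le_regularity_of_indep_subset (m := m) hxy
        (fun w hw => mem_farSet.1 (Finset.mem_filter.1 hw).1 x hx)
        (fun w hw => mem_farSet.1 (Finset.mem_filter.1 hw).1 y hy) hj
      exact ⟨h3.1.mono (by push_cast; omega), h3.2.mono (by push_cast; omega)⟩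
  · have h3 := le_regularity_of_far (m := m) hxy hx hy h1
    exact ⟨h3.1.mono (by omega), h3.2.mono (by omega)⟩

/-- Weight 2 on `u`, 0 on `F` and 1 elsewhere gives every available edge at least 2, but the
exponent weighs only 5 < 6. -/
lemma not_powAt_three_of_far {x y z u : V} {F : Finset V} (hF : Indep G F)
    (hFT : Far G F ({x} + {y} + {z})) (hu : u ∉ F) (hux : u ≠ x) (huy : u ≠ y) (huz : u ≠ z) :
    ¬ PowAt G 3 ({x} + {y} + {z} + {u}) F := by
  intro h
  have hx : x ∉ F := fun h => (hFT x h x (by simp)).1 rfl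
  have hy : y ∉ F := fun h => (hFT y h y (by simp)).1 rfl
  have hz : z ∉ F := fun h => (hFT z h z (by simp)).1 rfl
  have h1 := h.le_sum_weight (c := 2) (fun v => if v = u then 2 else if v ∈ F then 0 else 1)
    (fun f hf => by
      have : f ≠ u := fun h => hu (h ▸ hf)
      simp [this, hf])
    (fun p q hpq hp hq => ?_)
  · simp [hux.symm, huy.symm, huz.symm, hx, hy, hz] at h1
  · by_cases hpu : p = u
    · simp [hpu]
    by_cases hqu : q = u
    · simp [hqu]
    have hp' : p ∈ ({x} + {y} + {z} : Multiset V) ∨ p ∈ F := by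
      rcases hp with hp | hp
      · rcases Multiset.mem_add.1 hp with hp | hp
        · exact Or.inl hp
        · exact absurd (Multiset.mem_singleton.1 hp) hpu
      · exact Or.inr hp
    have hq' : q ∈ ({x} + {y} + {z} : Multiset V) ∨ q ∈ F := by
      rcases hq with hq | hq
      · rcases Multiset.mem_add.1 hq with hq | hq
        · exact Or.inl hq
        · exact absurd (Multiset.mem_singleton.1 hq) hqu
      · exact Or.inr hq
    by_cases hpF : p ∈ F
    · rcases hq' with hq' | hq'
      · exact absurd hpq (hFT p hpF q hq').2
      · exact absurd hpq (hF p hpF q hq')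
    · by_cases hqF : q ∈ F
      · exact absurd hpq.symm (hFT q hqF p (hp'.resolve_right hpF)).2
      · simp [hpu, hqu, hpF, hqF]

/-- The obstruction is a complete graph on four vertices. -/
lemma le_regularity_of_completeFour {a : Multiset V} {A : Finset V} {i : ℕ}
    (hA : ∀ x ∈ a, x ∉ A)
    (hno : ¬ ∃ x y z u v, IsTriangle G x y z ∧ G.Adj u v ∧ {x} + {y} + {z} + {u} + {v} ≤ a)
    {x y z u : V} (hT : IsTriangle G x y z) (hxu : G.Adj x u) (hyu : G.Adj y u) (hzu : G.Adj z u)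
    (hle : {x} + {y} + {z} + {u} ≤ a)
    (h : ¬ AcyclicAt K (differenceFamily G 3 a A) i) :
    LERegularity (a.card - A.card + i + 1 : ℤ) (edgeIdeal K G ^ 3) ∧
      LERegularity (a.card - A.card + i + 1 : ℤ) (symbolicPower (edgeIdeal K G) 3) := by
  obtain ⟨b, rfl⟩ := Multiset.le_iff_exists_add.1 hle
  have hsym : ∀ F, SymAt G 3 ({x} + {y} + {z} + {u}) F :=
    symAt_completeFour hT.1 hT.2.1 hT.2.2 hxu hyu hzu
  have hb : b = 0 := by
    refine eq_zero_of_not_acyclicAt (s := 2) hA ?_ (hsym ∅) ?_ h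
    · exact ((powAt_edge hT.1 ∅).add (powAt_edge hzu ∅)).of_le (le_of_eq (by abel))
    · intro q hq t ht hqt
      have main : ∀ {x y z u : V} {c : Multiset V}, IsTriangle G x y z → G.Adj q u →
          c = {x} + {y} + {z} + {u} + b →
          ∃ x y z u v, IsTriangle G x y z ∧ G.Adj u v ∧ {x} + {y} + {z} + {u} + {v} ≤ c := by
        intro x y z u c hT hqu hc
        refine ⟨x, y, z, u, q, hT, hqu.symm, ?_⟩
        rw [hc]
        exact add_le_add_right (Multiset.singleton_le.2 hq) _
      simp only [Multiset.mem_add, Multiset.mem_singleton] at ht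
      rcases ht with ((rfl | rfl) | rfl) | rfl
      · exact hno (main (x := y) (y := z) (z := u) ⟨hT.2.1, hzu, hyu⟩ hqt (by abel))
      · exact hno (main (x := x) (y := z) (z := u) ⟨hT.2.2, hzu, hxu⟩ hqt (by abel))
      · exact hno (main (x := x) (y := y) (z := u) ⟨hT.1, hyu, hxu⟩ hqt (by abel))
      · exact hno (main hT hqt rfl)
  subst hb
  rw [add_zero] at h ⊢
  obtain ⟨a, ha⟩ : ∃ a : Multiset V, a = {x} + {y} + {z} + {u} := ⟨_, rfl⟩
  rw [← ha] at h hsym ⊢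
  have hcard : a.card = 4 := by simp [ha]
  -- each ordering of the four vertices gives the same information
  have hnotMem : ∀ {p q r s : V}, a = {p} + {q} + {r} + {s} → G.Adj p s → G.Adj q s → G.Adj r s →
      ∀ F, ¬ PowAt G 3 a F → s ∉ F := by
    intro p q r s ha hp hq hr F hF hs
    refine hF ((((powAt_half ⟨s, hs, hp⟩).add (powAt_half ⟨s, hs, hq⟩)).add
      (powAt_half ⟨s, hs, hr⟩)).of_le ?_)
    rw [ha]
    exact Multiset.le_add_right _ _
  have hpair : ∀ {p q r s : V}, a = {p} + {q} + {r} + {s} → G.Adj r s →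
      ∀ F, ¬ PowAt G 3 a F → Near G F p → ¬ Near G F q := by
    intro p q r s ha hrs F hF hp hq
    refine hF ((((powAt_half hp).add (powAt_half hq)).add (powAt_edge hrs F)).of_le ?_)
    rw [ha, add_assoc ({p} + {q} : Multiset V)]
  -- If `F` is near `s`, it is near none of the other three corners, since two half edges and the
  -- opposite edge would pack.
  have hpiece : ∀ {p q r s : V}, a = {p} + {q} + {r} + {s} → IsTriangle G p q r →
      G.Adj p s → G.Adj q s → G.Adj r s →
      (∀ F, F ∈ differenceFamily G 3 a A ∧ Near G F s ↔
        A ⊆ F ∧ Indep G F ∧ Far G F ({p} + {q} + {r}) ∧ Near G F s) := by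
    intro p q r s ha hT hp hq hr F
    constructor
    · rintro ⟨⟨hAF, -, hF⟩, hs⟩
      have hp' := hnotMem (p := s) (q := q) (r := r) (s := p) (by rw [ha]; abel) hp.symm
        hT.1.symm hT.2.2.symm F hF
      have hq' := hnotMem (p := p) (q := s) (r := r) (s := q) (by rw [ha]; abel) hT.1
        hq.symm hT.2.1.symm F hF
      have hr' := hnotMem (p := p) (q := q) (r := s) (s := r) (by rw [ha]; abel) hT.2.2
        hT.2.1 hr.symm F hF
      have np := hpair (p := s) (q := p) (r := q) (s := r) (by rw [ha]; abel) hT.2.1 F hF hs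
      have nq := hpair (p := s) (q := q) (r := p) (s := r) (by rw [ha]; abel) hT.2.2 F hF hs
      have nr := hpair (p := s) (q := r) (r := p) (s := q) (by rw [ha]; abel) hT.1 F hF hs
      refine ⟨hAF, indep_of_not_powAt hF, fun f hf t ht => ?_, hs⟩
      simp only [Multiset.mem_add, Multiset.mem_singleton] at ht
      rcases ht with (rfl | rfl) | rfl
      · exact ⟨fun h => hp' (h ▸ hf), fun h => np ⟨f, hf, h.symm⟩⟩
      · exact ⟨fun h => hq' (h ▸ hf), fun h => nq ⟨f, hf, h.symm⟩⟩
      · exact ⟨fun h => hr' (h ▸ hf), fun h => nr ⟨f, hf, h.symm⟩⟩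
    · rintro ⟨hAF, hF, hfar, hs⟩
      refine ⟨⟨hAF, hsym F, ?_⟩, hs⟩
      rw [ha]
      exact not_powAt_three_of_far hF hfar (fun h => (hfar s h p (by simp)).2 hp.symm)
        hp.ne' hq.ne' hr.ne'
  have hbound : ∀ {p q r s : V}, a = {p} + {q} + {r} + {s} → IsTriangle G p q r →
      G.Adj p s → G.Adj q s → G.Adj r s →
      ¬ AcyclicAt K {F | F ∈ differenceFamily G 3 a A ∧ Near G F s} i →
      LERegularity (a.card - A.card + i + 1 : ℤ) (edgeIdeal K G ^ 3) ∧
        LERegularity (a.card - A.card + i + 1 : ℤ) (symbolicPower (edgeIdeal K G) 3) := by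
    intro p q r s ha hT hp hq hr h
    rw [hcard]
    have h3 := le_regularity_of_near (K := K) (m := 2) (A := A) (i := i)
      (a := ({p} + {q} + {r} : Multiset V)) (u := s) hT.1 (by simp) (by simp)
      fun h' => h (h'.congr fun F => by exact (hpiece ha hT hp hq hr F).symm)
    exact ⟨h3.1.mono (by push_cast; omega), h3.2.mono (by push_cast; omega)⟩
  -- The family splits into the pieces near exactly one corner and the sets near no corner, which
  -- are the independent sets far from all four.
  by_cases h0 : AcyclicAt K {F | F ∈ differenceFamily G 3 a A ∧
      ∀ p ∈ ({x, y, z, u} : Finset V), ¬ Near G F p} i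
  · by_cases h1 : ∀ p ∈ ({x, y, z, u} : Finset V),
        AcyclicAt K {F | F ∈ differenceFamily G 3 a A ∧ Near G F p} i
    · refine absurd (acyclicAt_of_near_pieces (differenceFamily_ordConnected 3 a A) _ ?_ h1 h0) h
      rintro F ⟨-, -, hF⟩ p hp q hq hnp hnq
      by_contra hpq
      have key : ∃ r s, a = {p} + {q} + {r} + {s} ∧ G.Adj r s := by
        obtain ⟨hxy, hyz, hxz⟩ := hT
        simp only [Finset.mem_insert, Finset.mem_singleton] at hp hq
        rcases hp with rfl | rfl | rfl | rfl <;> rcases hq with rfl | rfl | rfl | rfl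
        · exact absurd rfl hpq
        · exact ⟨z, u, by rw [ha], hzu⟩
        · exact ⟨y, u, by rw [ha]; abel, hyu⟩
        · exact ⟨y, z, by rw [ha]; abel, hyz⟩
        · exact ⟨z, u, by rw [ha]; abel, hzu⟩
        · exact absurd rfl hpq
        · exact ⟨x, u, by rw [ha]; abel, hxu⟩
        · exact ⟨x, z, by rw [ha]; abel, hxz⟩
        · exact ⟨y, u, by rw [ha]; abel, hyu⟩
        · exact ⟨x, u, by rw [ha]; abel, hxu⟩
        · exact absurd rfl hpq
        · exact ⟨x, y, by rw [ha]; abel, hxy⟩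
        · exact ⟨y, z, by rw [ha]; abel, hyz⟩
        · exact ⟨x, z, by rw [ha]; abel, hxz⟩
        · exact ⟨x, y, by rw [ha]; abel, hxy⟩
        · exact absurd rfl hpq
      obtain ⟨r, s, hrs, hadj⟩ := key
      exact hpair hrs hadj F hF hnp hnq
    · push Not at h1
      obtain ⟨p, hp, h1⟩ := h1
      simp only [Finset.mem_insert, Finset.mem_singleton] at hp
      rcases hp with rfl | rfl | rfl | rfl
      · exact hbound (p := y) (q := z) (r := u) (by rw [ha]; abel) ⟨hT.2.1, hzu, hyu⟩ hT.1.symm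
          hT.2.2.symm hxu.symm h1
      · exact hbound (p := x) (q := z) (r := u) (by rw [ha]; abel) ⟨hT.2.2, hzu, hxu⟩ hT.1
          hT.2.1.symm hyu.symm h1
      · exact hbound (p := x) (q := y) (r := u) (by rw [ha]; abel) ⟨hT.1, hyu, hxu⟩ hT.2.2
          hT.2.1 hzu.symm h1
      · exact hbound ha hT hxu hyu hzu h1
  · have h2 := le_regularity_of_far (m := 2) (a := a) (A := A) (i := i) hT.1 (by simp [ha])
      (by simp [ha]) fun h' => h0 (h'.congr fun F => ?_)
    · rw [hcard]
      exact ⟨h2.1.mono (by push_cast; omega), h2.2.mono (by push_cast; omega)⟩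
    · simp only [Finset.mem_insert, Finset.mem_singleton, forall_eq_or_imp, forall_eq]
      constructor
      · rintro ⟨hAF, hF, hfar⟩
        exact ⟨⟨hAF, hsym F, not_powAt_of_far hF hfar (by omega)⟩,
          fun ⟨f, hf, h⟩ => (hfar f hf x (by simp [ha])).2 h.symm,
          fun ⟨f, hf, h⟩ => (hfar f hf y (by simp [ha])).2 h.symm,
          fun ⟨f, hf, h⟩ => (hfar f hf z (by simp [ha])).2 h.symm,
          fun ⟨f, hf, h⟩ => (hfar f hf u (by simp [ha])).2 h.symm⟩
      · rintro ⟨⟨hAF, -, hF⟩, nx, ny, nz, nu⟩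
        have hx' := hnotMem (p := u) (q := y) (r := z) (s := x) (by rw [ha]; abel) hxu.symm
          hT.1.symm hT.2.2.symm F hF
        have hy' := hnotMem (p := x) (q := u) (r := z) (s := y) (by rw [ha]; abel) hT.1
          hyu.symm hT.2.1.symm F hF
        have hz' := hnotMem (p := x) (q := y) (r := u) (s := z) (by rw [ha]; abel) hT.2.2
          hT.2.1 hzu.symm F hF
        have hu' := hnotMem ha hxu hyu hzu F hF
        refine ⟨hAF, indep_of_not_powAt hF, fun f hf t ht => ?_⟩
        simp only [ha, Multiset.mem_add, Multiset.mem_singleton] at ht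
        rcases ht with ((rfl | rfl) | rfl) | rfl
        · exact ⟨fun h => hx' (h ▸ hf), fun h => nx ⟨f, hf, h.symm⟩⟩
        · exact ⟨fun h => hy' (h ▸ hf), fun h => ny ⟨f, hf, h.symm⟩⟩
        · exact ⟨fun h => hz' (h ▸ hf), fun h => nz ⟨f, hf, h.symm⟩⟩
        · exact ⟨fun h => hu' (h ▸ hf), fun h => nu ⟨f, hf, h.symm⟩⟩

/-- No obstruction is contained in `a` itself. -/
lemma le_regularity_of_not_hasObstruction {a : Multiset V} {A : Finset V} {i : ℕ}
    (hA : ∀ x ∈ a, x ∉ A) (hno : ¬ HasObstruction G a)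
    (h : ¬ AcyclicAt K (differenceFamily G 3 a A) i) :
    LERegularity (a.card - A.card + i + 1 : ℤ) (edgeIdeal K G ^ 3) ∧
      LERegularity (a.card - A.card + i + 1 : ℤ) (symbolicPower (edgeIdeal K G) 3) := by
  have hstruct : ∀ F ∈ differenceFamily G 3 a A, ∃ x y z v, IsTriangle G x y z ∧
      {x} + {y} + {z} + {v} ≤ a ∧ Far G F ({x} + {y} + {z}) ∧ Near G F v :=
    fun F hF => (hasObstruction_or_of_mem_difference hF.2.1 hF.2.2).resolve_left hno
  -- an element of `a` that is near `F` is the vertex `v` of every such structure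
  have hnear : ∀ F ∈ differenceFamily G 3 a A, ∀ {x y z v p : V}, IsTriangle G x y z →
      {x} + {y} + {z} + {v} ≤ a → Far G F ({x} + {y} + {z}) → Near G F v → p ∈ a → Near G F p →
        p = v := by
    intro F hF x y z v p hT hle hfar hv hp hnp
    by_contra hpv
    have hpT : p ∉ ({x} + {y} + {z} : Multiset V) := by
      intro hpT
      obtain ⟨f, hf, hpf⟩ := hnp
      exact (hfar f hf p hpT).2 hpf.symm
    refine hF.2.2 ((((hT.powAt_one F).add (powAt_half hv)).add (powAt_half hnp)).of_le ?_)
    rw [add_comm _ ({p} : Multiset V), Multiset.singleton_add, Multiset.cons_le_of_notMem]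
    · exact ⟨hp, hle⟩
    · rw [Multiset.mem_add, Multiset.mem_singleton]
      tauto
  -- Each `F` is near exactly one vertex of `a`, so the pieces are disjoint and exhaust the family;
  -- one of them carries the cohomology.
  obtain ⟨v, hva, hv⟩ : ∃ v ∈ a.toFinset,
      ¬ AcyclicAt K {F | F ∈ differenceFamily G 3 a A ∧ Near G F v} i := by
    by_contra! hac
    refine h (acyclicAt_of_near_pieces (differenceFamily_ordConnected 3 a A) a.toFinset ?_ hac ?_)
    · intro F hF p hp q hq hnp hnq
      obtain ⟨x, y, z, v, hT, hle, hfar, hv⟩ := hstruct F hF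
      rw [hnear F hF hT hle hfar hv (Multiset.mem_toFinset.1 hp) hnp,
        hnear F hF hT hle hfar hv (Multiset.mem_toFinset.1 hq) hnq]
    · rw [show {F | F ∈ differenceFamily G 3 a A ∧ ∀ p ∈ a.toFinset, ¬ Near G F p} = ∅ from
        Set.eq_empty_of_forall_notMem fun F ⟨hF, hn⟩ => by
          obtain ⟨x, y, z, v, hT, hle, hfar, hv⟩ := hstruct F hF
          exact hn v (Multiset.mem_toFinset.2 (Multiset.mem_of_le hle (by simp))) hv]
      exact fun c _ _ => ⟨0, by simp, by simp⟩
  rw [Multiset.mem_toFinset] at hva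
  obtain ⟨F₀, hF₀, hF₀v⟩ := nonempty_of_not_acyclicAt hv
  obtain ⟨x, y, z, v', hT, hle, hfar, hv'⟩ := hstruct F₀ hF₀
  obtain rfl := hnear F₀ hF₀ hT hle hfar hv' hva hF₀v
  have hvT : v ∉ ({x} + {y} + {z} : Multiset V) := by
    intro hvT
    obtain ⟨f, hf, hvf⟩ := hv'
    exact (hfar f hf v hvT).2 hvf.symm
  have hsym : ∀ F, Near G F v → SymAt G 3 ({x} + {y} + {z} + {v}) F :=
    fun F ⟨f, hf, hvf⟩ => (hT.symAt_two F).add (symAt_half hvf hf)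
  obtain ⟨b, rfl⟩ := Multiset.le_iff_exists_add.1 hle
  -- A spare vertex `q` is away from the triangle, differs from `v`, and has no neighbour in the
  -- exponent, as that would give a packing or an obstruction. So the piece near `v` would be a cone
  -- over `q`.
  have hb : b = 0 := by
    by_contra hb
    obtain ⟨q, hq⟩ := Multiset.exists_mem_of_ne_zero hb
    have hle1 : ({x} + {y} + {z} + {v} + {q} : Multiset V) ≤ {x} + {y} + {z} + {v} + b :=
      add_le_add_right (Multiset.singleton_le.2 hq) _
    have hqT : ¬ ∃ t ∈ ({x} + {y} + {z} : Multiset V), q = t ∨ G.Adj q t := fun hqT =>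
      hF₀.2.2 (((hT.powAt_two hqT F₀).add (powAt_half hv')).of_le
        (le_of_eq_of_le (by abel) hle1))
    have hqv : q ≠ v := by
      rintro rfl
      exact hF₀.2.2 ((((hT.powAt_one F₀).add (powAt_half hv')).add (powAt_half hv')).of_le hle1)
    have hqa : ∀ p ∈ {x} + {y} + {z} + {v} + b, ¬ G.Adj q p := by
      intro p hp hqp
      rw [Multiset.mem_add, Multiset.mem_add (t := ({v} : Multiset V)), Multiset.mem_singleton] at hp
      rcases hp with (hp | rfl) | hp
      · exact hqT ⟨p, hp, Or.inr hqp⟩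
      · exact hno (Or.inl ⟨x, y, z, p, q, hT, hqp.symm, hle1⟩)
      · refine hno (Or.inl ⟨x, y, z, q, p, hT, hqp, ?_⟩)
        have h1 := add_le_add (Multiset.le_add_right ({x} + {y} + {z}) {v})
          (singleton_add_singleton_le hq hp hqp.ne)
        rwa [← add_assoc] at h1
    refine hv ((acyclicAt_of_cone_powAt (s := 3) (q := q) (A := A)
      (S := fun F => SymAt G 3 ({x} + {y} + {z} + {v} + b) F ∧ Near G F v)
      (hA q (Multiset.mem_add.2 (Or.inr hq))) (fun F hAF hSF hF => ⟨?_, ?_, fun hn => hqv ?_⟩)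
      hqa i).congr fun F => ?_)
    · obtain ⟨f, hf, hvf⟩ := hSF.2
      exact ⟨hSF.1.mono le_rfl (Finset.subset_insert _ _), f, Finset.mem_insert_of_mem hf, hvf⟩
    · obtain ⟨f, hf, hvf⟩ := hSF.2
      have hn : Near G (F.erase q) v := by
        refine ⟨f, Finset.mem_erase.2 ⟨?_, hf⟩, hvf⟩
        rintro rfl
        exact hqa v (by simp) hvf.symm
      exact ⟨(hsym _ hn).mono (Multiset.le_add_right _ _) subset_rfl, hn⟩
    · have hF' : F ∈ differenceFamily G 3 ({x} + {y} + {z} + {v} + b) A := ⟨hAF, hSF.1, hF⟩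
      obtain ⟨x', y', z', v', hT', hle', hfar', hv''⟩ := hstruct F hF'
      rw [hnear F hF' hT' hle' hfar' hv'' (Multiset.mem_add.2 (Or.inr hq)) hn,
        hnear F hF' hT' hle' hfar' hv'' hva hSF.2]
    · simp only [Set.mem_ofPred_eq, differenceFamily]
      tauto
  subst hb
  rw [add_zero] at *
  have hcard : (({x} + {y} + {z} + {v} : Multiset V).card : ℤ) = 4 := by simp
  rw [hcard]
  have h3 := le_regularity_of_near (K := K) (m := 2) (A := A) (i := i)
    (a := ({x} + {y} + {z} : Multiset V)) (u := v) hT.1 (by simp) (by simp)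
    fun h' => hv (h'.congr fun F => ?_)
  · exact ⟨h3.1.mono (by push_cast; omega), h3.2.mono (by push_cast; omega)⟩
  constructor
  · rintro ⟨hAF, hF, hFT, hn⟩
    refine ⟨⟨hAF, hsym F hn, not_powAt_three_of_far hF hFT (fun h => ?_) ?_ ?_ ?_⟩, hn⟩
    · obtain ⟨f, hf, hvf⟩ := hn
      exact hF v h f hf hvf
    · exact fun h => hvT (by simp [h])
    · exact fun h => hvT (by simp [h])
    · exact fun h => hvT (by simp [h])
  · rintro ⟨hF, hn⟩
    obtain ⟨x', y', z', v', hT', hle', hfar', hv''⟩ := hstruct F hF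
    obtain rfl := hnear F hF hT' hle' hfar' hv'' hva hn
    -- The exponent has only four elements, so every `F` in the piece comes from the same triangle.
    have heq := Multiset.eq_of_le_of_card_le (Multiset.le_of_add_le_add_right hle') (by simp)
    rw [heq] at hfar'
    exact ⟨hF.1, indep_of_not_powAt hF.2.2, hfar', hn⟩

/-- The case of third powers. -/
lemma le_regularity_of_difference_three {a : Multiset V} {A : Finset V} {i : ℕ}
    (hA : ∀ x ∈ a, x ∉ A) (h : ¬ AcyclicAt K (differenceFamily G 3 a A) i) :
    (¬ SymAt G 3 a ∅ → LERegularity (a.card - A.card + i + 1 : ℤ) (edgeIdeal K G ^ 3)) ∧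
      LERegularity (a.card - A.card + i + 1 : ℤ) (symbolicPower (edgeIdeal K G) 3) := by
  have weaken : ∀ {p q : Prop}, p ∧ q → (¬ SymAt G 3 a ∅ → p) ∧ q := fun h => ⟨fun _ => h.1, h.2⟩
  by_cases hno : HasObstruction G a
  · by_cases hTe : ∃ x y z u v, IsTriangle G x y z ∧ G.Adj u v ∧ {x} + {y} + {z} + {u} + {v} ≤ a
    · obtain ⟨x, y, z, u, v, hT, huv, hle⟩ := hTe
      by_cases hu : ∃ t ∈ ({x} + {y} + {z} : Multiset V), u = t ∨ G.Adj u t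
      · by_cases hv : ∃ t ∈ ({x} + {y} + {z} : Multiset V), v = t ∨ G.Adj v t
        · exact weaken (le_regularity_of_triangle_near_edge hA hT huv hu hv hle h)
        · exact absurd (acyclicAt_of_triangle_half_near_edge hA hT huv.symm hv hu
            (le_of_eq_of_le (add_right_comm _ _ _) hle) i) h
      · by_cases hv : ∃ t ∈ ({x} + {y} + {z} : Multiset V), v = t ∨ G.Adj v t
        · exact absurd (acyclicAt_of_triangle_half_near_edge hA hT huv hu hv hle i) h
        -- The triangle and the edge already give `SymAt G 3 a ∅`, so no bound for the ordinary
        -- power is required here.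
        · refine ⟨fun hs => absurd ?_ hs,
            le_regularity_of_triangle_far_edge hA hT huv hu hv hle h⟩
          exact ((hT.symAt_two ∅).add (symAt_edge huv ∅)).mono (by rwa [← add_assoc]) subset_rfl
    · rcases hno with hno | ⟨x, y, z, u, hT, hxu, hyu, hzu, hle⟩ |
        ⟨x, y, z, u, v, hxy, hyz, hzu, huv, hvx, hle⟩
      · exact absurd hno hTe
      · exact weaken (le_regularity_of_completeFour hA hTe hT hxu hyu hzu hle h)
      · exact weaken (le_regularity_of_fiveCycle hA hxy hyz hzu huv hvx hle h)
  · exact weaken (le_regularity_of_not_hasObstruction hA hno h)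

lemma not_symAt_zero (s : ℕ) : ¬ SymAt G (s + 1) 0 ∅ := by
  intro h
  have := h ∅ (by simp [Indep]) subset_rfl
  simp at this

end ThirdPower

theorem theorem1p1 (K : Type*) [Field K] (n : ℕ) (G : SimpleGraph (Fin n)) :
    regularity (symbolicPower (edgeIdeal K G) 2) = regularity (edgeIdeal K G ^ 2) ∧
      regularity (symbolicPower (edgeIdeal K G) 3) = regularity (edgeIdeal K G ^ 3) := by
  refine ⟨regularity_eq_of_difference (isDescribedBy_edgeIdeal_pow G 2)
    (isDescribedBy_symbolicPower G 2) (fun a F h => h.symAt) (not_symAt_zero 1)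
    fun a A i hA h => ?_, regularity_eq_of_difference (isDescribedBy_edgeIdeal_pow G 3)
    (isDescribedBy_symbolicPower G 3) (fun a F h => h.symAt) (not_symAt_zero 2)
    fun a A i hA h => ?_⟩
  · have := le_regularity_of_difference_two hA h
    exact ⟨fun _ => this.1.mono (by omega), this.2⟩
  · have := le_regularity_of_difference_three hA h
    exact ⟨fun hs => (this.1 hs).mono (by omega), this.2⟩
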